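/- Let $p$ be a complex polynomial of degree $d$ with distinct roots $\lambda_1,\dots,\lambda_d$, let $\delta_j$ be the Lagrange interpolation basis polynomials at the roots ($\delta_j(\lambda_i)=\delta_{ij}$, $\deg\delta_j\le d-1$). There is a constant $C>0$, depending only on $p$, such that the following holds. Let $A$ be a bounded operator on a complex Hilbert space and $n\ge 1$ an integer such that $$V=V_{p^n}(A)=\{z\in\mathbb C:\ |p(z)^n|\le\|p(A)^n\|\}$$ has at least two connected components. Put $\rho=\|p(A)^n\|^{1/n}$, let $K$ be one of the components of $V$, and let $\varphi$ be a function with $\varphi=1$ in a neighbourhood of $K$ and $\varphi=0$ in a neighbourhood of $V\setminus K$. (1) There are functions $f_j$ $(1\le j\le d)$, holomorphic in a neighbourhood of the disc $|w|\le\rho$, with $\varphi(z)=\sum_{j=1}^d\delta_j(z)f_j(p(z))$ for all $z$ in a neighbourhood of $V$, and given by $$f_j(w)=\sum_{l=1}^d\frac{p(\lambda_j)-w}{p'(\zeta_l(w))\,(\lambda_j-\zeta_l(w))}\,\varphi(\zeta_l(w))$$ for every $w$ with $0<|w|\le\rho$ that is not a critical value of $p$, where $\zeta_1(w),\dots,\zeta_d(w)$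 are the roots of $p-w$. There are functions $f_{j,k}$ $(1\le j\le d,\ 0\le k\le n-1)$, holomorphic in a neighbourhood of the disc $|v|\le\rho^n$, with $$w^kf_{j,k}(w^n)=\frac1n\sum_{m=0}^{n-1}e^{-2\pi i mk/n}f_j\big(e^{2\pi i m/n}w\big)$$ for all $w$ in a neighbourhood of the disc $|w|\le\rho$. (2) For all such $f_j$, $f_{j,k}$, with $\varphi(A)$ and $f_{j,k}(p(A)^n)$ defined by the holomorphic functional calculus, $$\varphi(A)=\sum_{j=1}^d\delta_j(A)\sum_{k=0}^{n-1}p(A)^kf_{j,k}(p(A)^n).$$ (3) $P=\varphi(A)$ is the Riesz spectral projection of $A$ for $\sigma(A)\cap K$: $P=\frac1{2\pi i}\oint_\Gamma(z-A)^{-1}\,dz$ for a cycle $\Gamma$ off $\sigma(A)$ with winding number $1$ about the points of $\sigma(A)\cap K$ and $0$ about those of $\sigma(A)\setminus K$; $P^2=P$, $PA=AP$, the range and the kernel of $P$ are invariant under $A$, and $A$ restricted to them has spectrum $\sigma(A)\cap K$ and $\sigma(A)\setminus K$, respectively. (4) Let $s$ be the distance from the nearest critical point of $p$ outside $V$ to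 the boundary of $V$, that is, the minimum of $\operatorname{dist}(c,\partial V)$ over all $c\notin V$ with $p'(c)=0$. If $n=1$ or $p(A)^n\ne0$, then $$\|\varphi(A)\|\le\Big(1+\frac{C}{s^{d-1}}\Big)\Big(\sum_{k=0}^{n-1}\frac{\|p(A)^k\|}{\rho^k}\Big)\Big(\sum_{j=1}^d\|\delta_j(A)\|\Big)\sup_{z\in V}|\varphi(z)|.$$ (For $k=0$ the quotient is $\|I\|$, with $\rho^0=1$.) -/

import Mathlib

open Polynomial Topology

noncomputable section

/-! ### Cycles and contour integrals in the complex plane -/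

/-- A cycle: a finite family of `C¹` paths `[0,1] → ℂ` which, joined end to end along a
permutation of the indices, form finitely many closed curves. -/
structure PlaneCycle where
  /-- number of paths -/
  m : ℕ
  /-- the paths, only their values on `[0,1]` matter -/
  path : Fin m → ℝ → ℂ
  contDiffOn_path : ∀ i, ContDiffOn ℝ 1 (path i) (Set.Icc 0 1)
  /-- the path that continues a given path -/
  next : Equiv.Perm (Fin m)
  path_closed : ∀ i, path i 1 = path (next i) 0

namespace PlaneCycle

/-- The set of points on the cycle. -/
def support (Γ : PlaneCycle) : Set ℂ := ⋃ i, Γ.path i '' Set.Icc 0 1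

/-- The contour integral `∮_Γ F(z) dz`. -/
def integral {E : Type*} [NormedAddCommGroup E] [NormedSpace ℂ E] (Γ : PlaneCycle) (F : ℂ → E) :
    E :=
  ∑ i, ∫ t in (0 : ℝ)..1, deriv (Γ.path i) t • F (Γ.path i t)

/-- The winding number `(2πi)⁻¹ ∮_Γ dz / (z - a)` about a point `a` off the cycle. -/
def index (Γ : PlaneCycle) (a : ℂ) : ℂ :=
  (2 * Real.pi * Complex.I)⁻¹ * Γ.integral fun z => (z - a)⁻¹

end PlaneCycle

/-! ### Holomorphic functional calculus and Riesz projections -/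

section Operators

variable {H : Type*} [NormedAddCommGroup H] [InnerProductSpace ℂ H]

/-- `B = φ(A)` in the sense of the holomorphic (Riesz-Dunford) functional calculus:
`φ` is holomorphic on an open `U ⊇ σ(A)`, and `B = (2πi)⁻¹ ∮_Γ φ(z) (z - A)⁻¹ dz` for a cycle `Γ`
in `U \ σ(A)` that surrounds `σ(A)` in `U`. -/
def IsHolomorphicCalculus (A : H →L[ℂ] H) (φ : ℂ → ℂ) (B : H →L[ℂ] H) : Prop :=
  ∃ U : Set ℂ, IsOpen U ∧ spectrum ℂ A ⊆ U ∧ DifferentiableOn ℂ φ U ∧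
    ∃ Γ : PlaneCycle, Γ.support ⊆ U \ spectrum ℂ A ∧
      (∀ a ∈ spectrum ℂ A, Γ.index a = 1) ∧ (∀ a ∉ U, Γ.index a = 0) ∧
      B = (2 * Real.pi * Complex.I)⁻¹ • Γ.integral fun z => φ z • resolvent A z

/-- `P` is the Riesz spectral projection of `A` for the part `σ(A) ∩ K` of the spectrum:
it is `(2πi)⁻¹ ∮_Γ (z - A)⁻¹ dz` for a cycle `Γ` off `σ(A)` that winds once around `σ(A) ∩ K` and
not around `σ(A) \ K`; it is a projection commuting with `A`; its range and its kernel are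
invariant under `A`, and `A` restricted to them has the spectrum `σ(A) ∩ K` and `σ(A) \ K`,
respectively. -/
structure IsRieszProjection (A : H →L[ℂ] H) (K : Set ℂ) (P : H →L[ℂ] H) : Prop where
  contour : ∃ Γ : PlaneCycle, Disjoint Γ.support (spectrum ℂ A) ∧
    (∀ a ∈ spectrum ℂ A ∩ K, Γ.index a = 1) ∧ (∀ a ∈ spectrum ℂ A \ K, Γ.index a = 0) ∧
    P = (2 * Real.pi * Complex.I)⁻¹ • Γ.integral fun z => resolvent A z
  idempotent : IsIdempotentElem P
  commute : Commute A P
  spectrum_range : ∃ h : Set.MapsTo A P.range P.range,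
    spectrum ℂ (A.restrict h : P.range →L[ℂ] P.range) = spectrum ℂ A ∩ K
  spectrum_ker : ∃ h : Set.MapsTo A P.ker P.ker,
    spectrum ℂ (A.restrict h : P.ker →L[ℂ] P.ker) = spectrum ℂ A \ K

/-- The set `V_{pⁿ}(A) = {z : |p(z)ⁿ| ≤ ‖p(A)ⁿ‖}`. -/
def lemniscateSet (p : ℂ[X]) (n : ℕ) (A : H →L[ℂ] H) : Set ℂ :=
  {z | ‖p.eval z ^ n‖ ≤ ‖aeval A p ^ n‖}

/-- The level `ρ = ‖p(A)ⁿ‖^{1/n}`. -/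
def lemniscateLevel (p : ℂ[X]) (n : ℕ) (A : H →L[ℂ] H) : ℝ :=
  ‖aeval A p ^ n‖ ^ (1 / (n : ℝ))

end Operators

/-- The set of connected components of a subset of the plane. -/
def componentsOf (V : Set ℂ) : Set (Set ℂ) := connectedComponentIn V '' V

/-- `s` is the distance from the nearest critical point of `p` outside `V` to the boundary
of `V`. -/
def IsOutsideCriticalDistance (p : ℂ[X]) (V : Set ℂ) (s : ℝ) : Prop :=
  IsLeast {r : ℝ | ∃ c : ℂ, (derivative p).eval c = 0 ∧ c ∉ V ∧ r = Metric.infDist c (frontier V)} s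

/-! ### Multicentric representation

The roots of `p` themselves index the functions: `l` ranges over `p.roots.toFinset`. -/

/-- The Lagrange interpolation basis polynomial `δ_l` at the roots of `p`. -/
def rootBasis (p : ℂ[X]) (l : ℂ) : ℂ[X] := Lagrange.basis p.roots.toFinset id l

/-- `∑_ζ δ_ζ(l, w) φ(ζ)` over the roots `ζ` of `p - w`, where
`δ_ζ(x, w) = (p(x) - w) / (p'(ζ) (x - ζ))`. -/
def multicentricValue (p : ℂ[X]) (φ : ℂ → ℂ) (l w : ℂ) : ℂ :=
  ∑ ζ ∈ (p - C w).roots.toFinset,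
    (p.eval l - w) / ((derivative p).eval ζ * (l - ζ)) * φ ζ

/-- `f` is the family of functions, holomorphic in a neighbourhood of the disc `|w| ≤ ρ`, of the
multicentric representation `φ(z) = ∑_l δ_l(z) f_l(p(z))` near `V`; they are given by the
explicit formula wherever its denominators do not vanish. -/
structure IsMulticentricFamily (p : ℂ[X]) (φ : ℂ → ℂ) (V : Set ℂ) (ρ : ℝ) (f : ℂ → ℂ → ℂ) :
    Prop where
  analytic : ∀ l ∈ p.roots.toFinset, AnalyticOnNhd ℂ (f l) (Metric.closedBall 0 ρ)
  representation : ∀ᶠ z in 𝓝ˢ V, φ z = ∑ l ∈ p.roots.toFinset, (rootBasis p l).eval z * f l (p.eval z)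
  formula : ∀ l ∈ p.roots.toFinset, ∀ w ∈ Metric.closedBall (0 : ℂ) ρ, w ≠ 0 →
    (∀ ζ, p.eval ζ = w → (derivative p).eval ζ ≠ 0) → f l w = multicentricValue p φ l w

/-- `g l k` (`k < n`) are the functions `f_{l,k}`, holomorphic in a neighbourhood of the disc
`|v| ≤ ρⁿ`, with `wᵏ f_{l,k}(wⁿ) = n⁻¹ ∑_{m<n} e^{-2πimk/n} f_l(e^{2πim/n} w)`. -/
structure IsPowerSplitting (p : ℂ[X]) (n : ℕ) (ρ : ℝ) (f : ℂ → ℂ → ℂ) (g : ℂ → ℕ → ℂ → ℂ) :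
    Prop where
  analytic : ∀ l ∈ p.roots.toFinset, ∀ k < n,
    AnalyticOnNhd ℂ (g l k) (Metric.closedBall 0 (ρ ^ n))
  formula : ∀ l ∈ p.roots.toFinset, ∀ k < n, ∀ᶠ w in 𝓝ˢ (Metric.closedBall (0 : ℂ) ρ),
    w ^ k * g l k (w ^ n) = (n : ℂ)⁻¹ * ∑ m ∈ Finset.range n,
      Complex.exp (-(2 * Real.pi * Complex.I * m * k / n)) *
        f l (Complex.exp (2 * Real.pi * Complex.I * m / n) * w)

end

noncomputable section

/-! ### Fibres of a polynomial and partial fractions -/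

section Fibres

/-- `w` is not a critical value of `p`. -/
def IsRegularValue (p : ℂ[X]) (w : ℂ) : Prop :=
  ∀ ζ, p.eval ζ = w → (derivative p).eval ζ ≠ 0

/-- The fibre `{ζ | p ζ = w}` as a finite set. -/
def fiber (p : ℂ[X]) (w : ℂ) : Finset ℂ := (p - C w).roots.toFinset

/-- The difference quotient `(p(z) - p(l)) / (z - l)` as a polynomial in `z`. -/
def diffQuot (p : ℂ[X]) (l : ℂ) : ℂ[X] := (p - C (p.eval l)) /ₘ (X - C l)

variable {p : ℂ[X]} {w : ℂ}

lemma sub_C_ne_zero (hd : 0 < p.natDegree) (w : ℂ) : p - C w ≠ 0 := by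
  intro h
  have : p = C w := sub_eq_zero.1 h
  rw [this] at hd
  simp at hd

lemma mem_fiber (hd : 0 < p.natDegree) {ζ : ℂ} : ζ ∈ fiber p w ↔ p.eval ζ = w := by
  simp [fiber, sub_C_ne_zero hd w, sub_eq_zero]

lemma card_fiber (hd : 0 < p.natDegree) (hw : IsRegularValue p w) :
    (fiber p w).card = p.natDegree := by
  have hsep : (p - C w).roots.Nodup := by
    rw [Multiset.nodup_iff_count_le_one]
    intro ζ
    rw [count_roots]
    by_contra! h
    have := (one_lt_rootMultiplicity_iff_isRoot (sub_C_ne_zero hd w)).1 h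
    refine hw ζ ?_ ?_
    · simpa [IsRoot, sub_eq_zero] using this.1
    · simpa [IsRoot] using this.2
  rw [fiber, Multiset.toFinset_card_of_nodup hsep, IsAlgClosed.card_roots_eq_natDegree,
    natDegree_sub_C]

lemma diffQuot_spec (p : ℂ[X]) (l : ℂ) : (X - C l) * diffQuot p l = p - C (p.eval l) :=
  mul_divByMonic_eq_iff_isRoot.2 (by simp [IsRoot])

lemma eval_diffQuot (p : ℂ[X]) (l z : ℂ) :
    (z - l) * (diffQuot p l).eval z = p.eval z - p.eval l := by
  simpa using congrArg (eval z) (diffQuot_spec p l)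

lemma eval_diffQuot_self (p : ℂ[X]) (l : ℂ) :
    (diffQuot p l).eval l = (derivative p).eval l := by
  simpa using congrArg (fun q => eval l (derivative q)) (diffQuot_spec p l)

lemma eval_diffQuot_eq_div (p : ℂ[X]) {l z : ℂ} (h : z ≠ l) :
    (diffQuot p l).eval z = (p.eval z - p.eval l) / (z - l) := by
  rw [eq_div_iff (sub_ne_zero.2 h), mul_comm, eval_diffQuot]

lemma eval_diffQuot_comm (p : ℂ[X]) (l z : ℂ) :
    (diffQuot p l).eval z = (diffQuot p z).eval l := by
  rcases eq_or_ne z l with rfl | h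
  · rfl
  · rw [eval_diffQuot_eq_div p h, eval_diffQuot_eq_div p h.symm, ← neg_div_neg_eq]
    ring

lemma degree_diffQuot_lt (hd : 0 < p.natDegree) (l : ℂ) :
    (diffQuot p l).degree < (p.natDegree : WithBot ℕ) := by
  have h0 : p - C (p.eval l) ≠ 0 := sub_C_ne_zero hd _
  have := degree_divByMonic_lt (p - C (p.eval l)) (q := X - C l) h0
    (by rw [degree_X_sub_C]; exact zero_lt_one)
  rwa [degree_eq_natDegree h0, natDegree_sub_C] at this

/-- Lagrange interpolation at the points of a regular fibre. -/
lemma eq_sum_fiber_diffQuot (hd : 0 < p.natDegree) (hw : IsRegularValue p w) {q : ℂ[X]}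
    (hq : q.degree < (p.natDegree : WithBot ℕ)) :
    q = ∑ ζ ∈ fiber p w, C (q.eval ζ / (derivative p).eval ζ) * diffQuot p ζ := by
  refine eq_of_degrees_lt_of_eval_finset_eq (fiber p w) ?_ ?_ ?_
  · rwa [card_fiber hd hw]
  · rw [card_fiber hd hw]
    refine (degree_sum_le _ _).trans_lt ?_
    rw [Finset.sup_lt_iff (WithBot.bot_lt_coe _)]
    intro ζ _
    refine (degree_mul_le _ _).trans_lt ?_
    refine lt_of_le_of_lt ?_ (degree_diffQuot_lt hd ζ)
    calc _ ≤ 0 + (diffQuot p ζ).degree := by gcongr; exact degree_C_le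
      _ = _ := zero_add _
  · intro ζ hζ
    have hζw := (mem_fiber hd).1 hζ
    rw [eval_finsetSum, Finset.sum_eq_single ζ]
    · rw [eval_mul, eval_C, eval_diffQuot_self, div_mul_cancel₀ _ (hw ζ hζw)]
    · intro ξ hξ hne
      rw [eval_mul, eval_diffQuot_eq_div p hne.symm, hζw, (mem_fiber hd).1 hξ]
      simp
    · exact fun h => absurd hζ h

lemma resolvent_mul_sub {R : Type*} [Ring R] [Algebra ℂ R] {a : R} {z : ℂ}
    (hz : z ∉ spectrum ℂ a) : resolvent a z * (algebraMap ℂ R z - a) = 1 :=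
  Ring.inverse_mul_cancel _ (spectrum.notMem_iff.1 hz)

lemma sub_mul_resolvent {R : Type*} [Ring R] [Algebra ℂ R] {a : R} {z : ℂ}
    (hz : z ∉ spectrum ℂ a) : (algebraMap ℂ R z - a) * resolvent a z = 1 :=
  Ring.mul_inverse_cancel _ (spectrum.notMem_iff.1 hz)

lemma notMem_spectrum_of_eval {R : Type*} [Ring R] [Algebra ℂ R] {a : R} {z : ℂ}
    (h : p.eval z ∉ spectrum ℂ (aeval a p)) : z ∉ spectrum ℂ a :=
  fun hz => h (spectrum.subset_polynomial_aeval a p ⟨z, hz, rfl⟩)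

/-- Partial fractions of `q(a) (w - p(a))⁻¹` in an algebra. -/
lemma sum_fiber_smul_resolvent {R : Type*} [Ring R] [Algebra ℂ R] (a : R)
    (hd : 0 < p.natDegree) (hw : IsRegularValue p w) (hwa : w ∉ spectrum ℂ (aeval a p))
    {q : ℂ[X]} (hq : q.degree < (p.natDegree : WithBot ℕ)) :
    ∑ ζ ∈ fiber p w, (q.eval ζ / (derivative p).eval ζ) • resolvent a ζ =
      aeval a q * resolvent (aeval a p) w := by
  have key : ∀ ζ ∈ fiber p w,
      aeval a (diffQuot p ζ) * resolvent (aeval a p) w = resolvent a ζ := by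
    intro ζ hζ
    have hζw := (mem_fiber hd).1 hζ
    have h1 : ζ ∉ spectrum ℂ a := notMem_spectrum_of_eval (p := p) (by rwa [hζw])
    have h2 : (algebraMap ℂ R ζ - a) * aeval a (diffQuot p ζ)
        = algebraMap ℂ R w - aeval a p := by
      have := congrArg (aeval a) (diffQuot_spec p ζ)
      rw [map_mul, map_sub, map_sub, aeval_X, aeval_C, aeval_C, hζw] at this
      rw [← neg_sub a, neg_mul, this, neg_sub]
    calc _ = resolvent a ζ * ((algebraMap ℂ R ζ - a) * aeval a (diffQuot p ζ))
          * resolvent (aeval a p) w := by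
          rw [← mul_assoc (resolvent a ζ), resolvent_mul_sub h1, one_mul]
      _ = resolvent a ζ := by rw [h2, mul_assoc, sub_mul_resolvent hwa, mul_one]
  conv_rhs => rw [eq_sum_fiber_diffQuot hd hw hq, map_sum, Finset.sum_mul]
  refine Finset.sum_congr rfl fun ζ hζ => ?_
  rw [map_mul, aeval_C, mul_assoc, key ζ hζ, Algebra.smul_def]

lemma resolvent_complex (a z : ℂ) : resolvent a z = (z - a)⁻¹ := by
  simp [resolvent]

lemma mem_spectrum_complex {a z : ℂ} : z ∈ spectrum ℂ a ↔ z = a := by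
  simp [spectrum.mem_iff, sub_eq_zero]

/-- Partial fractions of `q / (w - p)`. -/
lemma sum_fiber_div (hd : 0 < p.natDegree) (hw : IsRegularValue p w) {x : ℂ}
    (hx : p.eval x ≠ w) {q : ℂ[X]} (hq : q.degree < (p.natDegree : WithBot ℕ)) :
    ∑ ζ ∈ fiber p w, (q.eval ζ / (derivative p).eval ζ) * (ζ - x)⁻¹ =
      q.eval x * (w - p.eval x)⁻¹ := by
  have := sum_fiber_smul_resolvent x hd hw (q := q)
    (by rw [mem_spectrum_complex]; simpa [coe_aeval_eq_eval] using hx.symm) hq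
  simpa [resolvent_complex, coe_aeval_eq_eval] using this

lemma finite_critical (hd : 0 < p.natDegree) : {c | (derivative p).eval c = 0}.Finite := by
  have h : derivative p ≠ 0 := fun h => hd.ne' (derivative_eq_zero.1 h)
  refine ((derivative p).roots.toFinset.finite_toSet).subset fun c hc => ?_
  simpa [h] using hc

lemma finite_not_regular (hd : 0 < p.natDegree) : {w | ¬ IsRegularValue p w}.Finite := by
  refine ((finite_critical hd).image p.eval).subset fun w hw => ?_
  simp only [IsRegularValue, Set.mem_ofPred_eq, not_forall, not_not] at hw
  obtain ⟨ζ, h, hc⟩ := hw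
  exact ⟨ζ, hc, h⟩

end Fibres

section RootBasis

variable {p : ℂ[X]} {w : ℂ}

lemma natDegree_eq_card_roots (hp : p.roots.Nodup) :
    p.roots.toFinset.card = p.natDegree := by
  rw [Multiset.toFinset_card_of_nodup hp, IsAlgClosed.card_roots_eq_natDegree]

lemma degree_rootBasis_lt (hp : p.roots.Nodup) {l : ℂ} (hl : l ∈ p.roots.toFinset) :
    (rootBasis p l).degree < (p.natDegree : WithBot ℕ) := by
  rw [rootBasis, Lagrange.degree_basis (v := id) Function.injective_id.injOn hl, natDegree_eq_card_roots hp]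
  have : 0 < p.natDegree := by
    rw [← natDegree_eq_card_roots hp]; exact Finset.card_pos.2 ⟨l, hl⟩
  exact_mod_cast Nat.sub_lt this one_pos

/-- Expansion of the difference quotient in the interpolation basis. -/
lemma sum_rootBasis_mul_diffQuot (hd : 0 < p.natDegree) (hp : p.roots.Nodup) (z ζ : ℂ) :
    ∑ l ∈ p.roots.toFinset, (rootBasis p l).eval z * (diffQuot p l).eval ζ =
      (diffQuot p ζ).eval z := by
  have h := Lagrange.eq_interpolate (s := p.roots.toFinset) (v := (id : ℂ → ℂ))
    (f := diffQuot p ζ) (fun _ _ _ _ h => h)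
    (by rw [natDegree_eq_card_roots hp]; exact degree_diffQuot_lt hd ζ)
  conv_rhs => rw [h, Lagrange.interpolate_apply, eval_finsetSum]
  refine Finset.sum_congr rfl fun l _ => ?_
  rw [eval_mul, eval_C, eval_diffQuot_comm, mul_comm]
  rfl

/-- The sum `∑ q(ζ) φ(ζ) / p'(ζ)` over the fibre of `w`. -/
def fiberTrace (p q : ℂ[X]) (φ : ℂ → ℂ) (w : ℂ) : ℂ :=
  ∑ ζ ∈ fiber p w, q.eval ζ / (derivative p).eval ζ * φ ζ

lemma multicentricValue_eq_fiberTrace (hd : 0 < p.natDegree) {l : ℂ} (hl : l ∈ p.roots.toFinset)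
    (hw : w ≠ 0) (φ : ℂ → ℂ) : multicentricValue p φ l w = fiberTrace p (diffQuot p l) φ w := by
  have hl0 : p.eval l = 0 := by
    rw [Multiset.mem_toFinset] at hl; exact isRoot_of_mem_roots hl
  refine Finset.sum_congr rfl fun ζ hζ => ?_
  have hζw := (mem_fiber hd).1 hζ
  have hne : ζ ≠ l := fun h => hw (by rw [← hζw, h, hl0])
  rw [eval_diffQuot_eq_div p hne, hl0, hζw, div_div, mul_comm (ζ - l), ← neg_div_neg_eq]
  ring_nf

/-- The multicentric representation at a regular fibre. -/
lemma sum_rootBasis_mul_fiberTrace (hd : 0 < p.natDegree) (hp : p.roots.Nodup) {z : ℂ}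
    (hw : IsRegularValue p (p.eval z)) (φ : ℂ → ℂ) :
    ∑ l ∈ p.roots.toFinset, (rootBasis p l).eval z *
      fiberTrace p (diffQuot p l) φ (p.eval z) = φ z := by
  simp only [fiberTrace, Finset.mul_sum]
  rw [Finset.sum_comm]
  have : ∀ ζ ∈ fiber p (p.eval z), ∑ l ∈ p.roots.toFinset, (rootBasis p l).eval z *
      ((diffQuot p l).eval ζ / (derivative p).eval ζ * φ ζ) =
      (diffQuot p ζ).eval z * (φ ζ / (derivative p).eval ζ) := by
    intro ζ _
    rw [← sum_rootBasis_mul_diffQuot hd hp, Finset.sum_mul]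
    exact Finset.sum_congr rfl fun l _ => by ring
  rw [Finset.sum_congr rfl this, Finset.sum_eq_single z]
  · rw [eval_diffQuot_self, mul_div_cancel₀ _ (hw z rfl)]
  · intro ζ hζ hne
    rw [eval_diffQuot_eq_div p hne.symm, (mem_fiber hd).1 hζ]
    simp
  · intro h
    exact absurd ((mem_fiber hd).2 rfl) h

end RootBasis

/-! ### Holomorphy of fibre traces -/

section Trace

open Metric Filter

/-- Cauchy-type integrals `∮ g / (h - w)` are holomorphic in `w`. -/
lemma differentiableOn_circleIntegral_div {g h : ℂ → ℂ} {c w₀ : ℂ} {R m : ℝ} (hR : 0 ≤ R)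
    (hg : ContinuousOn g (sphere c R)) (hh : Continuous h)
    (hm : ∀ z ∈ sphere c R, m ≤ ‖h z - w₀‖) :
    DifferentiableOn ℂ (fun w => ∮ z in C(c, R), g z / (h z - w)) (ball w₀ m) := by
  intro x hx
  refine DifferentiableAt.differentiableWithinAt ?_
  set δ := (m - ‖x - w₀‖) / 2 with hδ
  have hx' : ‖x - w₀‖ < m := by simpa [dist_eq_norm] using hx
  have hδ0 : 0 < δ := by rw [hδ]; linarith
  have hlow : ∀ y ∈ ball x δ, ∀ z ∈ sphere c R, δ ≤ ‖h z - y‖ := by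
    intro y hy z hz
    have h1 : ‖y - x‖ < δ := by simpa [dist_eq_norm] using hy
    have h2 := hm z hz
    have h3 : ‖h z - w₀‖ ≤ ‖h z - y‖ + ‖y - x‖ + ‖x - w₀‖ := by
      calc ‖h z - w₀‖ = ‖(h z - y) + (y - x) + (x - w₀)‖ := by ring_nf
        _ ≤ _ := norm_add₃_le
    linarith [hδ]
  have hs : ∀ t, circleMap c R t ∈ sphere c R := fun t => circleMap_mem_sphere c hR t
  have hgc : Continuous fun t => g (circleMap c R t) :=
    hg.comp_continuous (continuous_circleMap c R) hs
  have hhc : Continuous fun t => h (circleMap c R t) := hh.comp (continuous_circleMap c R)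
  have hdc : Continuous fun t => deriv (circleMap c R) t := by
    simp only [deriv_circleMap]
    exact (continuous_circleMap 0 R).mul continuous_const
  have hne : ∀ y ∈ ball x δ, ∀ t, h (circleMap c R t) - y ≠ 0 := fun y hy t =>
    norm_pos_iff.1 (hδ0.trans_le (hlow y hy _ (hs t)))
  have hF : ∀ y ∈ ball x δ, Continuous fun t => deriv (circleMap c R) t •
      (g (circleMap c R t) / (h (circleMap c R t) - y)) := fun y hy =>
    hdc.smul (hgc.div (hhc.sub continuous_const) (hne y hy))
  have hF' : Continuous fun t => deriv (circleMap c R) t •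
      (g (circleMap c R t) / (h (circleMap c R t) - x) ^ 2) :=
    hdc.smul (hgc.div ((hhc.sub continuous_const).pow 2)
      fun t => pow_ne_zero 2 (hne x (mem_ball_self hδ0) t))
  have hb : Continuous fun t => ‖deriv (circleMap c R) t‖ * (‖g (circleMap c R t)‖ / δ ^ 2) :=
    hdc.norm.mul (hgc.norm.div_const _)
  refine (intervalIntegral.hasDerivAt_integral_of_dominated_loc_of_deriv_le
    (F := fun y t => deriv (circleMap c R) t •
      (g (circleMap c R t) / (h (circleMap c R t) - y)))
    (F' := fun y t => deriv (circleMap c R) t •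
      (g (circleMap c R t) / (h (circleMap c R t) - y) ^ 2))
    (bound := fun t => ‖deriv (circleMap c R) t‖ * (‖g (circleMap c R t)‖ / δ ^ 2))
    (ball_mem_nhds x hδ0) ?_ ?_ ?_ ?_ ?_ ?_).2.differentiableAt
  · filter_upwards [ball_mem_nhds x hδ0] with y hy
    exact (hF y hy).aestronglyMeasurable
  · exact (hF x (mem_ball_self hδ0)).intervalIntegrable _ _
  · exact hF'.aestronglyMeasurable
  · refine Eventually.of_forall fun t _ y hy => ?_
    rw [norm_smul, norm_div, norm_pow]
    have := hlow y hy _ (hs t)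
    gcongr
  · exact hb.intervalIntegrable _ _
  · refine Eventually.of_forall fun t _ y hy => ?_
    have h1 : HasDerivAt (fun y : ℂ => h (circleMap c R t) - y) (-1) y := by
      simpa using (hasDerivAt_id y).const_sub (h (circleMap c R t))
    have h2 := (h1.inv (hne y hy t)).const_mul (g (circleMap c R t))
    have h3 := h2.const_smul (deriv (circleMap c R) t)
    refine (h3.congr_deriv ?_).congr_of_eventuallyEq ?_
    · simp [div_eq_mul_inv]
    · exact Eventually.of_forall fun y => by simp [div_eq_mul_inv]

variable {p : ℂ[X]}

open scoped Classical in
/-- Residues: the part of a fibre trace belonging to a disc. -/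
lemma circleIntegral_mul_div (hd : 0 < p.natDegree) {w : ℂ} (hw : IsRegularValue p w)
    {φ : ℂ → ℂ} {c : ℂ} {R : ℝ} (hR : 0 < R) (hφ : DifferentiableOn ℂ φ (closedBall c R))
    (hsph : ∀ z ∈ sphere c R, p.eval z ≠ w) {q : ℂ[X]}
    (hq : q.degree < (p.natDegree : WithBot ℕ)) :
    ∮ z in C(c, R), (φ z * q.eval z) / (p.eval z - w) = (2 * Real.pi * Complex.I) *
      ∑ ζ ∈ fiber p w with ζ ∈ ball c R, q.eval ζ / (derivative p).eval ζ * φ ζ := by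
  have h1 : ∮ z in C(c, R), (φ z * q.eval z) / (p.eval z - w) =
      ∮ z in C(c, R), ∑ ζ ∈ fiber p w,
        (q.eval ζ / (derivative p).eval ζ) * ((z - ζ)⁻¹ • φ z) := by
    refine circleIntegral.integral_congr hR.le fun z hz => ?_
    have := sum_fiber_div hd hw (hsph z hz) hq
    calc (φ z * q.eval z) / (p.eval z - w) = -(φ z * (q.eval z * (w - p.eval z)⁻¹)) := by
          rw [← neg_sub w, div_neg, div_eq_mul_inv, mul_assoc]
      _ = _ := by
          rw [← this, Finset.mul_sum, ← Finset.sum_neg_distrib]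
          refine Finset.sum_congr rfl fun ζ _ => ?_
          rw [← neg_sub z ζ, inv_neg, smul_eq_mul]
          ring
  have hfib : ∀ ζ ∈ fiber p w, ζ ∉ sphere c R := fun ζ hζ h => hsph ζ h ((mem_fiber hd).1 hζ)
  rw [h1, circleIntegral.integral_fun_sum, Finset.sum_filter, Finset.mul_sum]
  · refine Finset.sum_congr rfl fun ζ hζ => ?_
    rw [circleIntegral.integral_const_mul]
    split_ifs with hb
    · rw [hφ.circleIntegral_sub_inv_smul hb, smul_eq_mul]; ring
    · have hout : ζ ∉ closedBall c R := fun h =>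
        (lt_or_eq_of_le (mem_closedBall.1 h)).elim (fun h => hb h) (fun h => hfib ζ hζ h)
      rw [Complex.circleIntegral_eq_zero_of_differentiable_on_off_countable hR.le
        Set.countable_empty, mul_zero, mul_zero]
      · refine ContinuousOn.smul (ContinuousOn.inv₀ (f := fun z => z - ζ) (by fun_prop) fun z hz h => ?_) hφ.continuousOn
        exact hout (by rwa [← sub_eq_zero.1 h])
      · intro z hz
        have hz' : closedBall c R ∈ 𝓝 z :=
          mem_of_superset (isOpen_ball.mem_nhds hz.1) ball_subset_closedBall
        refine DifferentiableAt.smul (DifferentiableAt.inv (h := fun z => z - ζ) (by fun_prop) fun h => ?_)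
          (hφ.differentiableAt hz')
        exact hout (by rw [← sub_eq_zero.1 h]; exact ball_subset_closedBall hz.1)
  · intro ζ hζ
    refine ContinuousOn.circleIntegrable hR.le ?_
    refine continuousOn_const.mul
      (ContinuousOn.smul (ContinuousOn.inv₀ (f := fun z => z - ζ) (by fun_prop) fun z hz h => ?_)
        (hφ.continuousOn.mono sphere_subset_closedBall))
    exact hfib ζ hζ (by rwa [← sub_eq_zero.1 h])

lemma isProperMap_eval (hd : 0 < p.natDegree) : IsProperMap fun z => p.eval z :=
  p.isProperMap_eval (natDegree_pos_iff_degree_pos.1 hd)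

/-- Values of `p` off an open set containing the fibre of `w₀` stay away from `w₀`. -/
lemma exists_pos_le_norm_eval_sub (hd : 0 < p.natDegree) {w₀ : ℂ} {O : Set ℂ} (hO : IsOpen O)
    (h : ∀ z, p.eval z = w₀ → z ∈ O) : ∃ m > 0, ∀ z ∉ O, m ≤ ‖p.eval z - w₀‖ := by
  have hcl : IsClosed ((fun z => p.eval z) '' Oᶜ) := (isProperMap_eval hd).isClosedMap _ hO.isClosed_compl
  have hw : w₀ ∈ ((fun z => p.eval z) '' Oᶜ)ᶜ := by
    rintro ⟨z, hz, hzw⟩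
    exact hz (h z hzw)
  obtain ⟨m, hm, hball⟩ := Metric.isOpen_iff.1 hcl.isOpen_compl w₀ hw
  refine ⟨m, hm, fun z hz => ?_⟩
  by_contra! hlt
  exact hball (by simpa [dist_eq_norm] using hlt) ⟨z, hz, rfl⟩

open scoped Classical in
/-- A fibre trace of a holomorphic function extends holomorphically over critical values. -/
lemma exists_analyticAt_eq_fiberTrace (hd : 0 < p.natDegree) {φ : ℂ → ℂ} {r₀ : ℝ}
    (hφ : DifferentiableOn ℂ φ {z | ‖p.eval z‖ < r₀}) {q : ℂ[X]}
    (hq : q.degree < (p.natDegree : WithBot ℕ)) {w₀ : ℂ} (hw₀ : w₀ ∈ ball (0 : ℂ) r₀) :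
    ∃ G : ℂ → ℂ, AnalyticAt ℂ G w₀ ∧
      ∀ᶠ w in 𝓝 w₀, IsRegularValue p w → fiberTrace p q φ w = G w := by
  have hΩ : IsOpen {z | ‖p.eval z‖ < r₀} := isOpen_lt p.continuous.norm continuous_const
  have hw₀' : ‖w₀‖ < r₀ := by simpa using hw₀
  obtain ⟨η, hη0, hη1, hη2⟩ : ∃ η > 0, (∀ ξ ∈ fiber p w₀,
      closedBall ξ η ⊆ {z | ‖p.eval z‖ < r₀}) ∧
      ∀ ξ ∈ fiber p w₀, ∀ ξ' ∈ fiber p w₀, ξ ≠ ξ' → 2 * η < dist ξ ξ' := by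
    have h1 : ∀ ξ ∈ fiber p w₀, ∀ᶠ η in 𝓝[>] (0 : ℝ),
        closedBall ξ η ⊆ {z | ‖p.eval z‖ < r₀} := by
      intro ξ hξ
      obtain ⟨ε, hε, hb⟩ := Metric.nhds_basis_closedBall.mem_iff.1
        (hΩ.mem_nhds (show ξ ∈ {z | ‖p.eval z‖ < r₀} by
          simpa [(mem_fiber hd).1 hξ] using hw₀'))
      filter_upwards [Ioo_mem_nhdsGT hε] with η hη
      exact (closedBall_subset_closedBall hη.2.le).trans hb
    have h2 : ∀ ξ ∈ fiber p w₀, ∀ ξ' ∈ fiber p w₀, ∀ᶠ η in 𝓝[>] (0 : ℝ),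
        ξ ≠ ξ' → 2 * η < dist ξ ξ' := by
      intro ξ _ ξ' _
      by_cases h : ξ = ξ'
      · simp [h]
      · filter_upwards [Ioo_mem_nhdsGT (half_pos (dist_pos.2 h))] with η hη _
        linarith [hη.2]
    obtain ⟨η, ⟨ha, hb⟩, hc⟩ := (((eventually_all_finset _).2 h1).and
      ((eventually_all_finset _).2 fun ξ hξ => (eventually_all_finset _).2 (h2 ξ hξ))).and
        self_mem_nhdsWithin |>.exists
    exact ⟨η, hc, ha, hb⟩
  obtain ⟨m, hm0, hm⟩ := exists_pos_le_norm_eval_sub hd (w₀ := w₀)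
    (O := ⋃ ξ ∈ fiber p w₀, ball ξ η) (isOpen_biUnion fun _ _ => isOpen_ball)
    (fun z hz => Set.mem_biUnion ((mem_fiber hd).2 hz) (mem_ball_self hη0))
  have hsph : ∀ ξ ∈ fiber p w₀, ∀ z ∈ sphere ξ η, m ≤ ‖p.eval z - w₀‖ := by
    intro ξ hξ z hz
    refine hm z fun hmem => ?_
    obtain ⟨ξ', hξ', hz'⟩ := Set.mem_iUnion₂.1 hmem
    have hz1 : dist z ξ = η := hz
    have hz2 : dist z ξ' < η := hz'
    rcases eq_or_ne ξ ξ' with rfl | hne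
    · exact absurd hz1 hz2.ne
    · have := hη2 ξ hξ ξ' hξ' hne
      have h3 := dist_triangle_left ξ ξ' z
      linarith
  refine ⟨fun w => ∑ ξ ∈ fiber p w₀, (2 * Real.pi * Complex.I)⁻¹ *
    ∮ z in C(ξ, η), (φ z * q.eval z) / (p.eval z - w), ?_, ?_⟩
  · have hD : DifferentiableOn ℂ (fun w => ∑ ξ ∈ fiber p w₀, (2 * Real.pi * Complex.I)⁻¹ *
        ∮ z in C(ξ, η), (φ z * q.eval z) / (p.eval z - w)) (ball w₀ m) := by
      refine DifferentiableOn.fun_sum fun ξ hξ => DifferentiableOn.const_mul ?_ _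
      refine differentiableOn_circleIntegral_div hη0.le ?_ p.continuous (hsph ξ hξ)
      exact ((hφ.continuousOn.mono (hη1 ξ hξ)).mono sphere_subset_closedBall).mul
        q.continuous.continuousOn
    exact hD.analyticAt (ball_mem_nhds w₀ hm0)
  · filter_upwards [ball_mem_nhds w₀ hm0] with w hw hreg
    have hw' : ‖w - w₀‖ < m := by simpa [dist_eq_norm] using hw
    have hI : (2 * Real.pi * Complex.I : ℂ) ≠ 0 := Complex.two_pi_I_ne_zero
    have hval : ∀ ξ ∈ fiber p w₀, (2 * Real.pi * Complex.I)⁻¹ *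
        ∮ z in C(ξ, η), (φ z * q.eval z) / (p.eval z - w) =
        ∑ ζ ∈ fiber p w, if ζ ∈ ball ξ η then
          q.eval ζ / (derivative p).eval ζ * φ ζ else 0 := by
      intro ξ hξ
      rw [circleIntegral_mul_div hd hreg hη0 (hφ.mono (hη1 ξ hξ)) ?_ hq, inv_mul_cancel_left₀ hI,
        Finset.sum_filter]
      intro z hz h
      exact absurd (hsph ξ hξ z hz) (by rw [h]; exact not_le.2 hw')
    rw [Finset.sum_congr rfl hval, Finset.sum_comm, fiberTrace]
    refine Finset.sum_congr rfl fun ζ hζ => ?_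
    have hζO : ζ ∈ ⋃ ξ ∈ fiber p w₀, ball ξ η := by
      by_contra hnot
      have := hm ζ hnot
      rw [(mem_fiber hd).1 hζ] at this
      exact absurd this (not_le.2 hw')
    obtain ⟨ξ, hξ, hζξ⟩ := Set.mem_iUnion₂.1 hζO
    rw [Finset.sum_eq_single ξ, if_pos hζξ]
    · intro ξ' hξ' hne
      refine if_neg fun hmem => ?_
      have h1 := hη2 ξ hξ ξ' hξ' hne.symm
      have h2 := dist_triangle_left ξ ξ' ζ
      have h3 : dist ζ ξ < η := hζξ
      have h4 : dist ζ ξ' < η := hmem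
      linarith
    · exact fun h => absurd hξ h

lemma eventually_isRegularValue (hd : 0 < p.natDegree) (w₀ : ℂ) :
    ∀ᶠ w in 𝓝[≠] w₀, IsRegularValue p w := by
  have h := ((finite_not_regular hd).subset Set.sdiff_subset :
    ({w | ¬ IsRegularValue p w} \ {w₀}).Finite).isClosed.isOpen_compl.mem_nhds
      (show w₀ ∈ ({w | ¬ IsRegularValue p w} \ {w₀})ᶜ by simp)
  filter_upwards [mem_nhdsWithin_of_mem_nhds h, self_mem_nhdsWithin] with w hw hne
  by_contra hn
  exact hw ⟨hn, hne⟩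

/-- The holomorphic extension of the trace of `q φ` over the fibres of `p`. -/
def traceExtension (p q : ℂ[X]) (φ : ℂ → ℂ) (w : ℂ) : ℂ :=
  limUnder (𝓝[≠] w) (fiberTrace p q φ)

lemma traceExtension_eventuallyEq (hd : 0 < p.natDegree) {q : ℂ[X]} {φ G : ℂ → ℂ} {w₀ : ℂ}
    (hG : AnalyticAt ℂ G w₀)
    (h : ∀ᶠ w in 𝓝 w₀, IsRegularValue p w → fiberTrace p q φ w = G w) :
    traceExtension p q φ =ᶠ[𝓝 w₀] G := by
  filter_upwards [hG.eventually_analyticAt, h.eventually_nhds] with w hGw hw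
  have : Tendsto (fiberTrace p q φ) (𝓝[≠] w) (𝓝 (G w)) := by
    refine Tendsto.congr' ?_ (hGw.continuousAt.tendsto.mono_left nhdsWithin_le_nhds)
    filter_upwards [mem_nhdsWithin_of_mem_nhds hw, eventually_isRegularValue hd w] with x hx hr
    exact (hx hr).symm
  exact this.limUnder_eq

lemma analyticAt_traceExtension (hd : 0 < p.natDegree) {φ : ℂ → ℂ} {r₀ : ℝ}
    (hφ : DifferentiableOn ℂ φ {z | ‖p.eval z‖ < r₀}) {q : ℂ[X]}
    (hq : q.degree < (p.natDegree : WithBot ℕ)) {w : ℂ} (hw : w ∈ ball (0 : ℂ) r₀) :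
    AnalyticAt ℂ (traceExtension p q φ) w := by
  obtain ⟨G, hG, h⟩ := exists_analyticAt_eq_fiberTrace hd hφ hq hw
  exact hG.congr (traceExtension_eventuallyEq hd hG h).symm

lemma traceExtension_eq (hd : 0 < p.natDegree) {φ : ℂ → ℂ} {r₀ : ℝ}
    (hφ : DifferentiableOn ℂ φ {z | ‖p.eval z‖ < r₀}) {q : ℂ[X]}
    (hq : q.degree < (p.natDegree : WithBot ℕ)) {w : ℂ} (hw : w ∈ ball (0 : ℂ) r₀)
    (hreg : IsRegularValue p w) : traceExtension p q φ w = fiberTrace p q φ w := by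
  obtain ⟨G, hG, h⟩ := exists_analyticAt_eq_fiberTrace hd hφ hq hw
  rw [(traceExtension_eventuallyEq hd hG h).self_of_nhds, h.self_of_nhds hreg]

/-- The functions of the multicentric representation of `φ`. -/
def multicentricFun (p : ℂ[X]) (φ : ℂ → ℂ) (l w : ℂ) : ℂ := traceExtension p (diffQuot p l) φ w

lemma sum_rootBasis_mul_multicentricFun (hd : 0 < p.natDegree) (hp : p.roots.Nodup)
    {φ : ℂ → ℂ} {r₀ : ℝ} (hφ : DifferentiableOn ℂ φ {z | ‖p.eval z‖ < r₀}) {z : ℂ}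
    (hz : ‖p.eval z‖ < r₀) :
    ∑ l ∈ p.roots.toFinset, (rootBasis p l).eval z * multicentricFun p φ l (p.eval z) = φ z := by
  have hΩ : IsOpen {z | ‖p.eval z‖ < r₀} := isOpen_lt p.continuous.norm continuous_const
  set F : ℂ → ℂ := fun z =>
    ∑ l ∈ p.roots.toFinset, (rootBasis p l).eval z * multicentricFun p φ l (p.eval z)
  have hF : ContinuousAt F z := by
    refine tendsto_finsetSum _ fun l _ => Tendsto.mul (rootBasis p l).continuousAt ?_
    exact ContinuousAt.comp (f := fun z => p.eval z)
      (analyticAt_traceExtension hd hφ (degree_diffQuot_lt hd l)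
      (by simpa using hz)).continuousAt p.continuousAt
  have hφz : ContinuousAt φ z := (hφ.differentiableAt (hΩ.mem_nhds hz)).continuousAt
  have hev : F =ᶠ[𝓝[≠] z] φ := by
    have hfin : {x | ¬ IsRegularValue p (p.eval x)}.Finite := by
      refine Set.Finite.subset (Finset.finite_toSet
        ((finite_not_regular hd).toFinset.biUnion fun w => fiber p w)) fun x hx => ?_
      simpa [mem_fiber hd] using hx
    have h := ((hfin.subset Set.sdiff_subset :
      ({x | ¬ IsRegularValue p (p.eval x)} \ {z}).Finite)).isClosed.isOpen_compl.mem_nhds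
      (show z ∈ ({x | ¬ IsRegularValue p (p.eval x)} \ {z})ᶜ by simp)
    filter_upwards [mem_nhdsWithin_of_mem_nhds h, self_mem_nhdsWithin,
      mem_nhdsWithin_of_mem_nhds (hΩ.mem_nhds hz)] with x hx hne hxΩ
    have hreg : IsRegularValue p (p.eval x) := by
      by_contra hn
      exact hx ⟨hn, hne⟩
    rw [← sum_rootBasis_mul_fiberTrace hd hp hreg φ]
    refine Finset.sum_congr rfl fun l _ => ?_
    rw [multicentricFun, traceExtension_eq hd hφ (degree_diffQuot_lt hd l)
      (by simpa using hxΩ) hreg]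
  exact tendsto_nhds_unique ((hF.tendsto.mono_left nhdsWithin_le_nhds).congr' hev)
    (hφz.tendsto.mono_left nhdsWithin_le_nhds)

end Trace

/-! ### The cycle over a circle of regular values -/

section Cycles

open Metric Filter

variable {p : ℂ[X]}

/-- The parametrised circle `t ↦ r e^{2πit}`. -/
def turn (r t : ℝ) : ℂ := circleMap 0 r (2 * Real.pi * t)

lemma hasDerivAt_turn (r t : ℝ) :
    HasDerivAt (turn r) (2 * Real.pi * Complex.I * turn r t) t := by
  have h := (hasDerivAt_circleMap 0 r (2 * Real.pi * t)).scomp t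
    ((hasDerivAt_id t).const_mul (2 * Real.pi))
  refine h.congr_deriv ?_
  simp [turn]
  ring

lemma continuous_turn (r : ℝ) : Continuous (turn r) :=
  continuous_iff_continuousAt.2 fun t => (hasDerivAt_turn r t).continuousAt

lemma norm_turn {r : ℝ} (hr : 0 ≤ r) (t : ℝ) : ‖turn r t‖ = r := by
  simp [turn, abs_of_nonneg hr]

lemma turn_one (r : ℝ) : turn r 1 = turn r 0 := by
  simp [turn, circleMap]

/-- A continuous lift of the circle along `p` is differentiable at regular values. -/
lemma hasDerivAt_lift {γ : ℝ → ℂ} {r t : ℝ} (hγ : Continuous γ)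
    (h : ∀ s, p.eval (γ s) = turn r s) (hreg : (derivative p).eval (γ t) ≠ 0) :
    HasDerivAt γ (2 * Real.pi * Complex.I * turn r t * ((derivative p).eval (γ t))⁻¹) t := by
  have hs := p.hasStrictDerivAt (γ t)
  have hinv := (hs.to_localInverse hreg).hasDerivAt
  have hev : γ =ᶠ[𝓝 t] hs.localInverse _ _ _ hreg ∘ turn r := by
    have := (hs.hasStrictFDerivAt_equiv hreg).eventually_left_inverse
    filter_upwards [hγ.continuousAt.eventually this] with s hs
    rw [Function.comp_apply, ← h s]
    exact hs.symm
  rw [h t] at hinv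
  exact (hinv.scomp t (hasDerivAt_turn r t)).congr_of_eventuallyEq hev

/-- The paths of `Γ` enumerate the part in `W` of the fibres of `p` over the circle of
radius `r`. -/
structure IsFiberCycle (p : ℂ[X]) (r : ℝ) (W : Set ℂ) (Γ : PlaneCycle) : Prop where
  continuous : ∀ i, Continuous (Γ.path i)
  bijOn : ∀ t, Set.BijOn (fun i => Γ.path i t) Set.univ {ζ | p.eval ζ = turn r t ∧ ζ ∈ W}

lemma exists_lift {r : ℝ} (hr : 0 < r) (hreg : ∀ w : ℂ, ‖w‖ = r → IsRegularValue p w)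
    {t : ℝ} {ζ : ℂ} (hζ : p.eval ζ = turn r t) :
    ∃! γ : C(ℝ, ℂ), γ t = ζ ∧ ∀ s, p.eval (γ s) = turn r s := by
  have := p.isCoveringMapOn_eval.existsUnique_continuousMap_lifts
    (f := ⟨turn r, continuous_turn r⟩) (a₀ := t) (e₀ := ζ) hζ (by
      rintro a ⟨z, hz, hza⟩
      exact hreg _ (norm_turn hr.le a) z hza hz)
  simpa [funext_iff] using this

lemma exists_isFiberCycle (hd : 0 < p.natDegree) {r : ℝ} (hr : 0 < r)
    (hreg : ∀ w : ℂ, ‖w‖ = r → IsRegularValue p w) {W W' : Set ℂ} (hW : IsOpen W)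
    (hW' : IsOpen W') (hdisj : Disjoint W W') (hcov : ∀ z, ‖p.eval z‖ = r → z ∈ W ∪ W') :
    ∃ Γ, IsFiberCycle p r W Γ := by
  have hlift : ∀ i : {ζ // p.eval ζ = turn r 0 ∧ ζ ∈ W},
      ∃ γ : C(ℝ, ℂ), γ 0 = i ∧ ∀ s, p.eval (γ s) = turn r s := fun i =>
    (exists_lift hr hreg i.2.1).exists
  choose γ hγ0 hγ using hlift
  have hstay : ∀ (γ : C(ℝ, ℂ)), (∀ s, p.eval (γ s) = turn r s) → ∀ t, γ t ∈ W → ∀ s, γ s ∈ W := by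
    intro γ hγ t ht s
    have hsub : Set.range γ ⊆ W ∪ W' := by
      rintro _ ⟨s, rfl⟩
      exact hcov _ (by rw [hγ, norm_turn hr.le])
    exact (isPreconnected_range γ.continuous).subset_left_of_subset_union hW hW' hdisj hsub
      ⟨γ t, ⟨t, rfl⟩, ht⟩ ⟨s, rfl⟩
  have hγW : ∀ i t, γ i t ∈ W := fun i t => hstay (γ i) (hγ i) 0 (by rw [hγ0]; exact i.2.2) t
  have hinj : ∀ t i j, γ i t = γ j t → i = j := by
    intro t i j hij
    have h := (exists_lift hr hreg (hγ i t)).unique ⟨rfl, hγ i⟩ ⟨hij.symm, hγ j⟩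
    exact Subtype.ext (by rw [← hγ0 i, ← hγ0 j, h])
  have hfin : Finite {ζ // p.eval ζ = turn r 0 ∧ ζ ∈ W} :=
    Set.Finite.to_subtype (((fiber p (turn r 0)).finite_toSet).subset fun ζ hζ =>
      (mem_fiber hd).2 hζ.1)
  let next : {ζ // p.eval ζ = turn r 0 ∧ ζ ∈ W} → {ζ // p.eval ζ = turn r 0 ∧ ζ ∈ W} :=
    fun i => ⟨γ i 1, by rw [hγ, turn_one], hγW i 1⟩
  have hnext : Function.Bijective next := Finite.injective_iff_bijective.1 fun i j hij =>
    hinj 1 i j (congrArg Subtype.val hij)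
  let e := Finite.equivFin {ζ // p.eval ζ = turn r 0 ∧ ζ ∈ W}
  have hderiv : ∀ i t, HasDerivAt (γ i)
      (2 * Real.pi * Complex.I * turn r t * ((derivative p).eval (γ i t))⁻¹) t := fun i t =>
    hasDerivAt_lift (γ i).continuous (hγ i) (hreg _ (by rw [hγ, norm_turn hr.le]) _ rfl)
  refine ⟨⟨_, fun i => γ (e.symm i), fun i => ContDiff.contDiffOn ?_,
    (e.symm.trans (Equiv.ofBijective next hnext)).trans e, fun i => ?_⟩, ⟨fun i => ?_, fun t => ?_⟩⟩
  · rw [contDiff_one_iff_deriv]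
    refine ⟨fun t => (hderiv _ t).differentiableAt, ?_⟩
    rw [funext fun t => (hderiv (e.symm i) t).deriv]
    refine (continuous_const.mul (continuous_turn r)).mul (Continuous.inv₀ ?_ fun t => ?_)
    · exact (derivative p).continuous.comp (γ (e.symm i)).continuous
    · exact hreg _ (by rw [hγ, norm_turn hr.le]) _ rfl
  · simp [hγ0, next]
  · exact (γ (e.symm i)).continuous
  · refine ⟨fun i _ => ⟨hγ _ t, hγW _ t⟩, fun i _ j _ hij => ?_, ?_⟩
    · exact e.symm.injective (hinj t _ _ hij)
    · rintro ζ ⟨hζ, hζW⟩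
      obtain ⟨γ', hγ't, hγ'⟩ := (exists_lift hr hreg hζ).exists
      have h0 : γ' 0 ∈ W := hstay γ' hγ' t (by rwa [hγ't]) 0
      refine ⟨e ⟨γ' 0, hγ' 0, h0⟩, trivial, ?_⟩
      have h := (exists_lift hr hreg (hγ' 0)).unique ⟨hγ0 ⟨γ' 0, hγ' 0, h0⟩, hγ _⟩ ⟨rfl, hγ'⟩
      simp [h, hγ't]

namespace IsFiberCycle

variable {r : ℝ} {W : Set ℂ} {Γ : PlaneCycle}

lemma eval_path (h : IsFiberCycle p r W Γ) (i : Fin Γ.m) (t : ℝ) :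
    p.eval (Γ.path i t) = turn r t := ((h.bijOn t).mapsTo (Set.mem_univ i)).1

lemma path_mem (h : IsFiberCycle p r W Γ) (i : Fin Γ.m) (t : ℝ) : Γ.path i t ∈ W :=
  ((h.bijOn t).mapsTo (Set.mem_univ i)).2

lemma support_subset (h : IsFiberCycle p r W Γ) (hr : 0 ≤ r) :
    Γ.support ⊆ {z | ‖p.eval z‖ = r} ∩ W := by
  intro z hz
  obtain ⟨i, t, -, rfl⟩ := Set.mem_iUnion.1 hz
  exact ⟨by simp [h.eval_path, norm_turn hr], h.path_mem i t⟩

lemma hasDerivAt_path (h : IsFiberCycle p r W Γ) (hr : 0 < r)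
    (hreg : ∀ w : ℂ, ‖w‖ = r → IsRegularValue p w) (i : Fin Γ.m) (t : ℝ) :
    HasDerivAt (Γ.path i)
      (2 * Real.pi * Complex.I * turn r t * ((derivative p).eval (Γ.path i t))⁻¹) t :=
  hasDerivAt_lift (h.continuous i) (h.eval_path i)
    (hreg _ (by rw [h.eval_path, norm_turn hr.le]) _ rfl)

lemma continuous_deriv_path (h : IsFiberCycle p r W Γ) (hr : 0 < r)
    (hreg : ∀ w : ℂ, ‖w‖ = r → IsRegularValue p w) (i : Fin Γ.m) :
    Continuous (deriv (Γ.path i)) := by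
  rw [funext fun t => (h.hasDerivAt_path hr hreg i t).deriv]
  refine (continuous_const.mul (continuous_turn r)).mul (Continuous.inv₀ ?_ fun t => ?_)
  · exact (derivative p).continuous.comp (h.continuous i)
  · exact hreg _ (by rw [h.eval_path, norm_turn hr.le]) _ rfl

variable {E : Type*} [NormedAddCommGroup E] [NormedSpace ℂ E]

lemma continuous_integrand (h : IsFiberCycle p r W Γ) (hr : 0 < r)
    (hreg : ∀ w : ℂ, ‖w‖ = r → IsRegularValue p w) {F : ℂ → E}
    (hF : ContinuousOn F ({z | ‖p.eval z‖ = r} ∩ W)) (i : Fin Γ.m) :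
    Continuous fun t => deriv (Γ.path i) t • F (Γ.path i t) :=
  (h.continuous_deriv_path hr hreg i).smul (hF.comp_continuous (h.continuous i) fun t =>
    ⟨by simp [h.eval_path, norm_turn hr.le], h.path_mem i t⟩)

open scoped Classical in
/-- Integration over a fibre cycle is integration of the trace over the circle. -/
lemma integral_eq (h : IsFiberCycle p r W Γ) (hd : 0 < p.natDegree) (hr : 0 < r)
    (hreg : ∀ w : ℂ, ‖w‖ = r → IsRegularValue p w) {F : ℂ → E}
    (hF : ContinuousOn F ({z | ‖p.eval z‖ = r} ∩ W)) :
    Γ.integral F = ∮ w in C(0, r),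
      ∑ ζ ∈ fiber p w with ζ ∈ W, ((derivative p).eval ζ)⁻¹ • F ζ := by
  set S : ℂ → E := fun w => ∑ ζ ∈ fiber p w with ζ ∈ W, ((derivative p).eval ζ)⁻¹ • F ζ
  have hsum : ∀ t, ∑ i, deriv (Γ.path i) t • F (Γ.path i t) =
      (2 * Real.pi : ℝ) • (fun θ => deriv (circleMap 0 r) θ • S (circleMap 0 r θ))
        (2 * Real.pi * t) := by
    intro t
    have h1 : S (turn r t) = ∑ i, ((derivative p).eval (Γ.path i t))⁻¹ • F (Γ.path i t) := by
      refine (Finset.sum_bij (fun i _ => Γ.path i t) ?_ ?_ ?_ fun _ _ => rfl).symm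
      · intro i _
        simpa [mem_fiber hd] using ⟨h.eval_path i t, h.path_mem i t⟩
      · exact fun i _ j _ hij => (h.bijOn t).injOn trivial trivial hij
      · intro ζ hζ
        rw [Finset.mem_filter, mem_fiber hd] at hζ
        obtain ⟨i, -, hi⟩ := (h.bijOn t).surjOn hζ
        exact ⟨i, Finset.mem_univ i, hi⟩
    change _ = (2 * Real.pi : ℝ) • (deriv (circleMap 0 r) (2 * Real.pi * t) • S (turn r t))
    rw [h1, Finset.smul_sum, Finset.smul_sum]
    refine Finset.sum_congr rfl fun i _ => ?_
    rw [(h.hasDerivAt_path hr hreg i t).deriv, deriv_circleMap, ← Complex.coe_smul, smul_smul,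
      smul_smul]
    congr 1
    simp only [turn]
    push_cast
    ring
  rw [PlaneCycle.integral, ← intervalIntegral.integral_finsetSum, funext hsum,
    intervalIntegral.integral_smul, intervalIntegral.smul_integral_comp_mul_left
      (fun θ => deriv (circleMap 0 r) θ • S (circleMap 0 r θ)), circleIntegral]
  · simp
  · exact fun i _ => (h.continuous_integrand hr hreg hF i).intervalIntegrable _ _

end IsFiberCycle

end Cycles

/-! ### Functions of an operator by circle integrals -/

section CircleCalculus

open Metric Filter

variable {R : Type*} [NormedRing R] [NormedAlgebra ℂ R] [CompleteSpace R]

/-- `(2πi)⁻¹ ∮_{|w| = r} f(w) (w - T)⁻¹ dw`. -/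
def circleCalc (T : R) (f : ℂ → ℂ) (r : ℝ) : R :=
  (2 * Real.pi * Complex.I : ℂ)⁻¹ • ∮ w in C(0, r), f w • resolvent T w

lemma differentiableAt_resolvent {a : R} {z : ℂ} (hz : z ∉ spectrum ℂ a) :
    DifferentiableAt ℂ (resolvent a) z :=
  (spectrum.hasDerivAt_resolvent_const_left (spectrum.mem_resolventSet_iff.2
    (spectrum.notMem_iff.1 hz))).differentiableAt

lemma continuousOn_resolvent {a : R} {s : Set ℂ} (hs : Disjoint s (spectrum ℂ a)) :
    ContinuousOn (resolvent a) s := fun _ hz =>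
  (differentiableAt_resolvent (hs.notMem_of_mem_left hz)).continuousAt.continuousWithinAt

lemma circleIntegral_mul_left (b : R) {F : ℂ → R} {c : ℂ} {r : ℝ} (hF : CircleIntegrable F c r) :
    ∮ w in C(c, r), b * F w = b * ∮ w in C(c, r), F w := by
  have h := (ContinuousLinearMap.mul ℂ R b).intervalIntegral_comp_comm hF.out
  simp only [ContinuousLinearMap.mul_apply', mul_smul_comm] at h
  exact h

lemma circleIntegrable_smul_resolvent {a : R} {f : ℂ → ℂ} {r : ℝ} (hr : 0 ≤ r)
    (hf : ContinuousOn f (sphere 0 r)) (ha : Disjoint (sphere 0 r) (spectrum ℂ a)) :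
    CircleIntegrable (fun w => f w • resolvent a w) 0 r :=
  (hf.smul (continuousOn_resolvent ha)).circleIntegrable hr

variable {p : ℂ[X]}

/-- The trace of `φ(ζ) (ζ - a)⁻¹` over the fibres of `p`, for `φ = ∑ δ_l · (f_l ∘ p)`. -/
lemma circleIntegral_fiber_resolvent (hd : 0 < p.natDegree) (hp : p.roots.Nodup) (a : R) {r : ℝ}
    (hr : 0 ≤ r) (hreg : ∀ w : ℂ, ‖w‖ = r → IsRegularValue p w)
    (ha : Disjoint (sphere 0 r) (spectrum ℂ (aeval a p))) {φ : ℂ → ℂ} {f : ℂ → ℂ → ℂ}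
    (hf : ∀ l ∈ p.roots.toFinset, ContinuousOn (f l) (sphere 0 r))
    (hφ : ∀ z, ‖p.eval z‖ = r →
      φ z = ∑ l ∈ p.roots.toFinset, (rootBasis p l).eval z * f l (p.eval z)) :
    (2 * Real.pi * Complex.I : ℂ)⁻¹ • ∮ w in C(0, r),
        ∑ ζ ∈ fiber p w, ((derivative p).eval ζ)⁻¹ • φ ζ • resolvent a ζ =
      ∑ l ∈ p.roots.toFinset, aeval a (rootBasis p l) * circleCalc (aeval a p) (f l) r := by
  have hpt : Set.EqOn
      (fun w => ∑ ζ ∈ fiber p w, ((derivative p).eval ζ)⁻¹ • φ ζ • resolvent a ζ)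
      (fun w => ∑ l ∈ p.roots.toFinset,
        aeval a (rootBasis p l) * (f l w • resolvent (aeval a p) w)) (sphere 0 r) := by
    intro w hw
    have hwn : ‖w‖ = r := by simpa using hw
    have hl : ∀ l ∈ p.roots.toFinset,
        aeval a (rootBasis p l) * (f l w • resolvent (aeval a p) w) = ∑ ζ ∈ fiber p w,
          (f l w * ((rootBasis p l).eval ζ / (derivative p).eval ζ)) • resolvent a ζ := by
      intro l hl
      rw [mul_smul_comm, ← sum_fiber_smul_resolvent a hd (hreg w hwn) (ha.notMem_of_mem_left hw)
        (degree_rootBasis_lt hp hl), Finset.smul_sum]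
      simp only [smul_smul]
    simp only
    rw [Finset.sum_congr rfl hl, Finset.sum_comm]
    refine Finset.sum_congr rfl fun ζ hζ => ?_
    have hζw := (mem_fiber hd).1 hζ
    rw [← Finset.sum_smul, smul_smul, hφ ζ (by rw [hζw, hwn]), Finset.mul_sum, hζw]
    congr 1
    exact Finset.sum_congr rfl fun l _ => by ring
  have hint := fun l (hl : l ∈ p.roots.toFinset) => circleIntegrable_smul_resolvent hr (hf l hl) ha
  rw [circleIntegral.integral_congr hr hpt, circleIntegral.integral_fun_sum, Finset.smul_sum]
  · refine Finset.sum_congr rfl fun l hl => ?_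
    rw [circleIntegral_mul_left _ (hint l hl), circleCalc, mul_smul_comm]
  · intro l hl
    refine ContinuousOn.circleIntegrable hr ?_
    exact continuousOn_const.mul ((hf l hl).smul (continuousOn_resolvent ha))

lemma circleCalc_congr_radius {T : R} {f : ℂ → ℂ} {ρ r₁ r₂ r₀ : ℝ} (h0 : 0 < r₁)
    (hf : DifferentiableOn ℂ f (ball 0 r₀)) (hT : ∀ w ∈ spectrum ℂ T, ‖w‖ ≤ ρ)
    (h1 : ρ < r₁) (h12 : r₁ ≤ r₂) (h2 : r₂ < r₀) : circleCalc T f r₂ = circleCalc T f r₁ := by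
  have hD : ∀ z ∈ closedBall (0 : ℂ) r₂ \ ball 0 r₁,
      DifferentiableAt ℂ (fun w => f w • resolvent T w) z := by
    rintro z ⟨hz2, hz1⟩
    have hz1' : r₁ ≤ ‖z‖ := by simpa using hz1
    refine DifferentiableAt.smul (hf.differentiableAt (isOpen_ball.mem_nhds ?_))
      (differentiableAt_resolvent fun hz => ?_)
    · exact closedBall_subset_ball h2 hz2
    · linarith [hT z hz]
  rw [circleCalc, circleCalc,
    Complex.circleIntegral_eq_of_differentiable_on_annulus_off_countable h0 h12
      Set.countable_empty]
  · exact fun z hz => (hD z hz).continuousAt.continuousWithinAt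
  · exact fun z hz => hD z ⟨ball_subset_closedBall hz.1.1, fun h => hz.1.2 (ball_subset_closedBall h)⟩

lemma circleCalc_one {T : R} {ρ r : ℝ} (h0 : 0 < r) (hT : ∀ w ∈ spectrum ℂ T, ‖w‖ ≤ ρ)
    (h1 : ρ < r) : circleCalc T (fun _ => 1) r = 1 := by
  have hI : (2 * Real.pi * Complex.I : ℂ) ≠ 0 := Complex.two_pi_I_ne_zero
  rw [← sub_eq_zero, ← norm_eq_zero]
  refine le_antisymm (le_of_forall_pos_le_add fun ε hε => ?_) (norm_nonneg _)
  rw [zero_add]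
  set K := ‖T‖ + 1 with hK
  have hK0 : 0 < K := by positivity
  have hev : ∀ᶠ z in Bornology.cobounded ℂ, ‖resolvent T z‖ < ε / K := by
    have := (spectrum.resolvent_tendsto_cobounded (𝕜 := ℂ) T).norm
    rw [norm_zero] at this
    exact this.eventually_lt_const (div_pos hε hK0)
  rw [← comap_norm_atTop, eventually_comap, eventually_atTop] at hev
  obtain ⟨b, hb⟩ := hev
  set s := max r b with hs
  have hrs : r ≤ s := le_max_left _ _
  have hs0 : 0 < s := h0.trans_le hrs
  have hdisj : Disjoint (sphere (0 : ℂ) s) (spectrum ℂ T) := by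
    rw [Set.disjoint_left]
    intro z hz hzT
    have : ‖z‖ = s := by simpa using hz
    linarith [hT z hzT]
  rw [← circleCalc_congr_radius (f := fun _ => 1) h0 (differentiableOn_const 1) hT h1 hrs
    (lt_add_one s)]
  have hint : CircleIntegrable (fun w => (1 : ℂ) • resolvent T w) 0 s :=
    circleIntegrable_smul_resolvent hs0.le continuousOn_const hdisj
  have hint2 : CircleIntegrable (fun w : ℂ => w⁻¹ • (1 : R)) 0 s := by
    refine ContinuousOn.circleIntegrable hs0.le (ContinuousOn.smul
      (continuousOn_id.inv₀ fun z hz h => ?_) continuousOn_const)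
    have : ‖z‖ = s := by simpa using hz
    rw [id] at h
    rw [h, norm_zero] at this
    exact hs0.ne this
  have hone : (1 : R) = (2 * Real.pi * Complex.I : ℂ)⁻¹ • ∮ w in C(0, s), w⁻¹ • (1 : R) := by
    rw [circleIntegral.integral_smul_const]
    have := circleIntegral.integral_sub_center_inv 0 hs0.ne'
    simp only [sub_zero] at this
    rw [this, smul_smul, inv_mul_cancel₀ hI, one_smul]
  conv_lhs => rw [hone]
  rw [circleCalc, ← smul_sub, ← circleIntegral.integral_sub hint hint2]
  refine (circleIntegral.norm_two_pi_i_inv_smul_integral_le_of_norm_le_const (C := ε / s) hs0.le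
    fun z hz => ?_).trans (by rw [mul_div_cancel₀ _ hs0.ne'])
  have hzn : ‖z‖ = s := by simpa using hz
  have hz0 : z ≠ 0 := by rintro rfl; rw [norm_zero] at hzn; exact hs0.ne hzn
  have hres := sub_mul_resolvent (hdisj.notMem_of_mem_left hz)
  have heq : (1 : ℂ) • resolvent T z - z⁻¹ • (1 : R) = z⁻¹ • (T * resolvent T z) := by
    rw [← hres, sub_mul, ← Algebra.smul_def, smul_sub, smul_smul, inv_mul_cancel₀ hz0]
    abel
  rw [heq, norm_smul, norm_inv, hzn, div_eq_inv_mul]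
  refine mul_le_mul_of_nonneg_left ?_ (inv_nonneg.2 hs0.le)
  have hbz := hb s (le_max_right _ _) z hzn
  calc ‖T * resolvent T z‖ ≤ ‖T‖ * ‖resolvent T z‖ := norm_mul_le _ _
    _ ≤ K * (ε / K) := by gcongr; linarith
    _ = ε := mul_div_cancel₀ _ hK0.ne'

end CircleCalculus

/-! ### Splittings of a sublevel set -/

section Splitting

open Metric Filter

/-- `W` and `W'` separate the set `|p| < r₀`, and `φ` is `1` on `W` and `0` on `W'`. -/
structure IsSplitting (p : ℂ[X]) (r₀ : ℝ) (W W' : Set ℂ) (φ : ℂ → ℂ) : Prop where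
  isOpen_left : IsOpen W
  isOpen_right : IsOpen W'
  disjoint : Disjoint W W'
  cover : ∀ z, ‖p.eval z‖ < r₀ → z ∈ W ∪ W'
  eq_one : ∀ z ∈ W, φ z = 1
  eq_zero : ∀ z ∈ W', φ z = 0

namespace IsSplitting

variable {p : ℂ[X]} {r₀ : ℝ} {W W' : Set ℂ} {φ : ℂ → ℂ}

lemma symm (h : IsSplitting p r₀ W W' φ) : IsSplitting p r₀ W' W (fun z => 1 - φ z) where
  isOpen_left := h.isOpen_right
  isOpen_right := h.isOpen_left
  disjoint := h.disjoint.symm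
  cover := fun z hz => (h.cover z hz).symm
  eq_one := fun z hz => by rw [h.eq_zero z hz, sub_zero]
  eq_zero := fun z hz => by rw [h.eq_one z hz, sub_self]

lemma univ (p : ℂ[X]) (r₀ : ℝ) : IsSplitting p r₀ Set.univ ∅ (fun _ => 1) where
  isOpen_left := isOpen_univ
  isOpen_right := isOpen_empty
  disjoint := by simp
  cover := by simp
  eq_one := by simp
  eq_zero := by simp

lemma differentiableOn (h : IsSplitting p r₀ W W' φ) :
    DifferentiableOn ℂ φ {z | ‖p.eval z‖ < r₀} := by
  intro z hz
  refine DifferentiableAt.differentiableWithinAt ?_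
  rcases h.cover z hz with hW | hW
  · exact (differentiableAt_const (1 : ℂ)).congr_of_eventuallyEq
      (eventually_of_mem (h.isOpen_left.mem_nhds hW) h.eq_one)
  · exact (differentiableAt_const (0 : ℂ)).congr_of_eventuallyEq
      (eventually_of_mem (h.isOpen_right.mem_nhds hW) h.eq_zero)

lemma exists_cycle (h : IsSplitting p r₀ W W' φ) (hd : 0 < p.natDegree) {r : ℝ} (hr : 0 < r)
    (hr₀ : r < r₀) (hreg : ∀ w : ℂ, ‖w‖ = r → IsRegularValue p w) :
    ∃ Γ, IsFiberCycle p r W Γ :=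
  exists_isFiberCycle hd hr hreg h.isOpen_left h.isOpen_right h.disjoint
    fun z hz => h.cover z (hz.trans_lt hr₀)

lemma differentiableOn_multicentricFun (h : IsSplitting p r₀ W W' φ) (hd : 0 < p.natDegree)
    (l : ℂ) : DifferentiableOn ℂ (multicentricFun p φ l) (ball 0 r₀) := fun _ hw =>
  (analyticAt_traceExtension hd h.differentiableOn (degree_diffQuot_lt hd l)
    hw).differentiableAt.differentiableWithinAt

variable {R : Type*} [NormedRing R] [NormedAlgebra ℂ R] [CompleteSpace R]

/-- The contour integral of the resolvent over the part of a fibre cycle in `W`. -/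
lemma integral_resolvent (h : IsSplitting p r₀ W W' φ) (hd : 0 < p.natDegree)
    (hp : p.roots.Nodup) {r : ℝ} (hr : 0 < r) (hr₀ : r < r₀)
    (hreg : ∀ w : ℂ, ‖w‖ = r → IsRegularValue p w) {Γ : PlaneCycle} (hΓ : IsFiberCycle p r W Γ)
    {a : R} (ha : Disjoint (sphere 0 r) (spectrum ℂ (aeval a p))) :
    (2 * Real.pi * Complex.I : ℂ)⁻¹ • Γ.integral (fun z => resolvent a z) =
      ∑ l ∈ p.roots.toFinset, aeval a (rootBasis p l) *
        circleCalc (aeval a p) (multicentricFun p φ l) r := by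
  classical
  have hF : ContinuousOn (fun z => resolvent a z) ({z | ‖p.eval z‖ = r} ∩ W) := by
    refine continuousOn_resolvent (Set.disjoint_left.2 fun z hz => ?_)
    exact notMem_spectrum_of_eval (p := p)
      (ha.notMem_of_mem_left (by simpa using hz.1))
  rw [← circleIntegral_fiber_resolvent hd hp a hr.le hreg ha (φ := φ)
    (fun l _ => (h.differentiableOn_multicentricFun hd l).continuousOn.mono
      (sphere_subset_closedBall.trans (closedBall_subset_ball hr₀)))
    (fun z hz => (sum_rootBasis_mul_multicentricFun hd hp h.differentiableOn
      (hz.trans_lt hr₀)).symm), hΓ.integral_eq hd hr hreg hF]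
  congr 1
  refine circleIntegral.integral_congr hr.le fun w hw => ?_
  simp only [Finset.sum_filter]
  refine Finset.sum_congr rfl fun ζ hζ => ?_
  have hζr : ‖p.eval ζ‖ < r₀ := by
    rw [(mem_fiber hd).1 hζ]
    simpa using (mem_sphere_zero_iff_norm.1 hw).trans_lt hr₀
  split_ifs with hW
  · rw [h.eq_one ζ hW, one_smul]
  · rw [h.eq_zero ζ ((h.cover ζ hζr).resolve_left hW), zero_smul, smul_zero]

/-- The contour integral of `φ` times the resolvent over a full fibre cycle. -/
lemma integral_smul_resolvent (hd : 0 < p.natDegree)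
    (hp : p.roots.Nodup) {r : ℝ} (hr : 0 < r)
    (hreg : ∀ w : ℂ, ‖w‖ = r → IsRegularValue p w) {Γ : PlaneCycle}
    (hΓ : IsFiberCycle p r Set.univ Γ) {f : ℂ → ℂ → ℂ}
    (hf : ∀ l ∈ p.roots.toFinset, ContinuousOn (f l) (sphere 0 r))
    (hφc : ContinuousOn φ {z | ‖p.eval z‖ = r})
    (hφ : ∀ z, ‖p.eval z‖ = r →
      φ z = ∑ l ∈ p.roots.toFinset, (rootBasis p l).eval z * f l (p.eval z))
    {a : R} (ha : Disjoint (sphere 0 r) (spectrum ℂ (aeval a p))) :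
    (2 * Real.pi * Complex.I : ℂ)⁻¹ • Γ.integral (fun z => φ z • resolvent a z) =
      ∑ l ∈ p.roots.toFinset, aeval a (rootBasis p l) * circleCalc (aeval a p) (f l) r := by
  have hF : ContinuousOn (fun z => φ z • resolvent a z)
      ({z | ‖p.eval z‖ = r} ∩ Set.univ) := by
    rw [Set.inter_univ]
    refine hφc.smul (continuousOn_resolvent (Set.disjoint_left.2 fun z hz => ?_))
    exact notMem_spectrum_of_eval (p := p) (ha.notMem_of_mem_left (by simpa using hz))
  rw [← circleIntegral_fiber_resolvent hd hp a hr.le hreg ha hf hφ, hΓ.integral_eq hd hr hreg hF]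
  simp

lemma index_eq (h : IsSplitting p r₀ W W' φ) (hd : 0 < p.natDegree)
    (hp : p.roots.Nodup) {r : ℝ} (hr : 0 < r) (hr₀ : r < r₀)
    (hreg : ∀ w : ℂ, ‖w‖ = r → IsRegularValue p w) {Γ : PlaneCycle} (hΓ : IsFiberCycle p r W Γ)
    {a : ℂ} (ha : ‖p.eval a‖ ≠ r) : Γ.index a = if ‖p.eval a‖ < r then φ a else 0 := by
  have h1 := h.integral_resolvent hd hp hr hr₀ hreg hΓ (a := a) (by
    rw [Set.disjoint_left]
    intro w hw hwa
    rw [mem_spectrum_complex, coe_aeval_eq_eval] at hwa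
    exact ha (by rw [← hwa]; simpa using hw))
  simp only [resolvent_complex, coe_aeval_eq_eval] at h1
  rw [PlaneCycle.index, ← smul_eq_mul, h1]
  have hdf : ∀ l, DifferentiableOn ℂ (multicentricFun p φ l) (closedBall 0 r) := fun l =>
    (h.differentiableOn_multicentricFun hd l).mono (closedBall_subset_ball hr₀)
  have hI : (2 * Real.pi * Complex.I : ℂ) ≠ 0 := Complex.two_pi_I_ne_zero
  split_ifs with hlt
  · rw [← sum_rootBasis_mul_multicentricFun hd hp h.differentiableOn (hlt.trans hr₀)]
    refine Finset.sum_congr rfl fun l _ => ?_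
    have := (hdf l).circleIntegral_sub_inv_smul (w := p.eval a) (by simpa using hlt)
    simp only [circleCalc, resolvent_complex, smul_eq_mul] at this ⊢
    simp only [mul_comm (multicentricFun p φ l _)]
    rw [this, inv_mul_cancel_left₀ hI]
  · have hgt : r < ‖p.eval a‖ := lt_of_le_of_ne (not_lt.1 hlt) (Ne.symm ha)
    refine Finset.sum_eq_zero fun l _ => ?_
    have hne : ∀ z ∈ closedBall (0 : ℂ) r, z - p.eval a ≠ 0 := by
      intro z hz h
      rw [sub_eq_zero] at h
      rw [mem_closedBall_zero_iff, h] at hz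
      linarith
    have hD : DifferentiableOn ℂ (fun w => multicentricFun p φ l w • (w - p.eval a)⁻¹)
        (closedBall 0 r) := (hdf l).smul ((by fun_prop :
          DifferentiableOn ℂ (fun w => w - p.eval a) (closedBall 0 r)).inv hne)
    simp only [circleCalc, resolvent_complex]
    rw [Complex.circleIntegral_eq_zero_of_differentiable_on_off_countable hr.le
      Set.countable_empty hD.continuousOn, smul_zero, mul_zero]
    exact fun z hz => hD.differentiableAt
      (mem_of_superset (isOpen_ball.mem_nhds hz.1) ball_subset_closedBall)

end IsSplitting

end Splitting

/-! ### Riesz projections from fibre cycles -/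

section Riesz

open Metric Filter

namespace IsFiberCycle

variable {p : ℂ[X]} {r r' : ℝ} {W W' : Set ℂ} {Γ Γ' : PlaneCycle}
  {E E' : Type*} [NormedAddCommGroup E] [NormedSpace ℂ E]
  [NormedAddCommGroup E'] [NormedSpace ℂ E']

lemma integral_clm [CompleteSpace E] [CompleteSpace E'] (h : IsFiberCycle p r W Γ) (hr : 0 < r)
    (hreg : ∀ w : ℂ, ‖w‖ = r → IsRegularValue p w) {F : ℂ → E}
    (hF : ContinuousOn F ({z | ‖p.eval z‖ = r} ∩ W)) (L : E →L[ℂ] E') :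
    Γ.integral (fun z => L (F z)) = L (Γ.integral F) := by
  simp only [PlaneCycle.integral, map_sum]
  refine Finset.sum_congr rfl fun i _ => ?_
  rw [← L.intervalIntegral_comp_comm
    ((h.continuous_integrand hr hreg hF i).intervalIntegrable _ _)]
  simp only [map_smul]

lemma integral_sub (h : IsFiberCycle p r W Γ) (hr : 0 < r)
    (hreg : ∀ w : ℂ, ‖w‖ = r → IsRegularValue p w) {F G : ℂ → E}
    (hF : ContinuousOn F ({z | ‖p.eval z‖ = r} ∩ W))
    (hG : ContinuousOn G ({z | ‖p.eval z‖ = r} ∩ W)) :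
    Γ.integral (fun z => F z - G z) = Γ.integral F - Γ.integral G := by
  simp only [PlaneCycle.integral, ← Finset.sum_sub_distrib]
  refine Finset.sum_congr rfl fun i _ => ?_
  rw [← intervalIntegral.integral_sub
    ((h.continuous_integrand hr hreg hF i).intervalIntegrable _ _)
    ((h.continuous_integrand hr hreg hG i).intervalIntegrable _ _)]
  simp only [smul_sub]

lemma integral_congr (h : IsFiberCycle p r W Γ) (hr : 0 < r) {F G : ℂ → E}
    (hFG : Set.EqOn F G ({z | ‖p.eval z‖ = r} ∩ W)) : Γ.integral F = Γ.integral G := by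
  simp only [PlaneCycle.integral]
  refine Finset.sum_congr rfl fun i _ => ?_
  congr 1
  funext t
  rw [hFG ⟨by simp [h.eval_path, norm_turn hr.le], h.path_mem i t⟩]

lemma integral_swap (h : IsFiberCycle p r W Γ) (h' : IsFiberCycle p r' W' Γ') (hr : 0 < r)
    (hr' : 0 < r') (hreg : ∀ w : ℂ, ‖w‖ = r → IsRegularValue p w)
    (hreg' : ∀ w : ℂ, ‖w‖ = r' → IsRegularValue p w) {G : ℂ → ℂ → E}
    (hG : ContinuousOn (Function.uncurry G)
      (({z | ‖p.eval z‖ = r} ∩ W) ×ˢ ({z | ‖p.eval z‖ = r'} ∩ W'))) :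
    Γ.integral (fun z => Γ'.integral (fun w => G z w)) =
      Γ'.integral (fun w => Γ.integral (fun z => G z w)) := by
  have hmem : ∀ i t, Γ.path i t ∈ {z | ‖p.eval z‖ = r} ∩ W := fun i t =>
    ⟨by simp [h.eval_path, norm_turn hr.le], h.path_mem i t⟩
  have hmem' : ∀ j t, Γ'.path j t ∈ {z | ‖p.eval z‖ = r'} ∩ W' := fun j t =>
    ⟨by simp [h'.eval_path, norm_turn hr'.le], h'.path_mem j t⟩
  have hc : ∀ i j, Continuous (Function.uncurry fun s t =>
      deriv (Γ.path i) s • deriv (Γ'.path j) t • G (Γ.path i s) (Γ'.path j t)) := by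
    intro i j
    refine ((h.continuous_deriv_path hr hreg i).comp continuous_fst).smul
      (((h'.continuous_deriv_path hr' hreg' j).comp continuous_snd).smul ?_)
    exact hG.comp_continuous (((h.continuous i).comp continuous_fst).prodMk
      ((h'.continuous j).comp continuous_snd)) fun x => ⟨hmem i x.1, hmem' j x.2⟩
  have hL : Γ.integral (fun z => Γ'.integral (fun w => G z w)) = ∑ i, ∑ j,
      ∫ s in (0 : ℝ)..1, ∫ t in (0 : ℝ)..1,
        deriv (Γ.path i) s • deriv (Γ'.path j) t • G (Γ.path i s) (Γ'.path j t) := by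
    simp only [PlaneCycle.integral]
    refine Finset.sum_congr rfl fun i _ => ?_
    rw [← intervalIntegral.integral_finsetSum]
    · simp only [Finset.smul_sum, intervalIntegral.integral_smul]
    · exact fun j _ => (intervalIntegral.continuous_parametric_intervalIntegral_of_continuous'
        (hc i j) 0 1).intervalIntegrable _ _
  have hR : Γ'.integral (fun w => Γ.integral (fun z => G z w)) = ∑ j, ∑ i,
      ∫ t in (0 : ℝ)..1, ∫ s in (0 : ℝ)..1,
        deriv (Γ.path i) s • deriv (Γ'.path j) t • G (Γ.path i s) (Γ'.path j t) := by
    simp only [PlaneCycle.integral]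
    refine Finset.sum_congr rfl fun j _ => ?_
    rw [← intervalIntegral.integral_finsetSum]
    · simp only [Finset.smul_sum, smul_comm (deriv (Γ.path _) _) (deriv (Γ'.path _) _),
        intervalIntegral.integral_smul]
    · exact fun i _ => (intervalIntegral.continuous_parametric_intervalIntegral_of_continuous'
        (f := fun t s => deriv (Γ.path i) s • deriv (Γ'.path j) t • G (Γ.path i s) (Γ'.path j t))
        ((hc i j).comp continuous_swap) 0 1).intervalIntegrable _ _
  rw [hL, hR, Finset.sum_comm]
  refine Finset.sum_congr rfl fun j _ => Finset.sum_congr rfl fun i _ => ?_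
  refine MeasureTheory.intervalIntegral_intervalIntegral_swap ?_
  exact ((hc i j).continuousOn.integrableOn_compact
    (isCompact_uIcc.prod isCompact_uIcc)).mono_set
      (Set.prod_mono Set.uIoc_subset_uIcc Set.uIoc_subset_uIcc)

end IsFiberCycle

lemma exists_regular_radius {p : ℂ[X]} (hd : 0 < p.natDegree) {a b : ℝ} (hab : a < b) :
    ∃ r ∈ Set.Ioo a b, ∀ w : ℂ, ‖w‖ = r → IsRegularValue p w := by
  obtain ⟨r, hr, hn⟩ := (Set.Ioo_infinite hab).exists_notMem_finite
    ((finite_not_regular hd).image norm)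
  refine ⟨r, hr, fun w hw => ?_⟩
  by_contra h
  exact hn ⟨w, h, hw⟩

section Algebra

variable {R : Type*} [NormedRing R] [NormedAlgebra ℂ R]

lemma commute_resolvent {a b : R} (h : Commute b a) (z : ℂ) : Commute b (resolvent a z) := by
  by_cases hz : z ∈ spectrum ℂ a
  · rw [spectrum.resolvent_zero_of_mem_spectrum hz]
    exact Commute.zero_right b
  · have hc : b * (algebraMap ℂ R z - a) = (algebraMap ℂ R z - a) * b := by
      rw [mul_sub, sub_mul, h.eq, Algebra.commutes]
    calc b * resolvent a z
        = (resolvent a z * (algebraMap ℂ R z - a)) * b * resolvent a z := by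
          rw [resolvent_mul_sub hz, one_mul]
      _ = resolvent a z * (b * (algebraMap ℂ R z - a)) * resolvent a z := by
          rw [hc, mul_assoc (resolvent a z)]
      _ = resolvent a z * b := by
          rw [← mul_assoc, mul_assoc, sub_mul_resolvent hz, mul_one]

namespace IsSplitting

variable {p : ℂ[X]} {r₀ ρ r r' : ℝ} {W W' : Set ℂ} {φ : ℂ → ℂ} {Γ Γ' : PlaneCycle} {a : R}

lemma disjoint_sphere_spectrum {T : R} (hT : ∀ w ∈ spectrum ℂ T, ‖w‖ ≤ ρ) (hr : ρ < r) :
    Disjoint (sphere (0 : ℂ) r) (spectrum ℂ T) := by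
  rw [Set.disjoint_left]
  intro z hz hzT
  have : ‖z‖ = r := by simpa using hz
  linarith [hT z hzT]

variable [CompleteSpace R]

lemma continuousOn_resolvent_fiber (hT : ∀ w ∈ spectrum ℂ (aeval a p), ‖w‖ ≤ ρ) (hr : ρ < r) :
    ContinuousOn (resolvent a) ({z | ‖p.eval z‖ = r} ∩ W) :=
  continuousOn_resolvent (Set.disjoint_left.2 fun z hz =>
    notMem_spectrum_of_eval (p := p) ((disjoint_sphere_spectrum hT hr).notMem_of_mem_left
      (by simpa using hz.1)))

/-- The spectral projection `(2πi)⁻¹ ∮_Γ (z - a)⁻¹ dz`. -/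
def proj (Γ : PlaneCycle) (a : R) : R :=
  (2 * Real.pi * Complex.I : ℂ)⁻¹ • Γ.integral (fun z => resolvent a z)

lemma proj_add_proj (h : IsSplitting p r₀ W W' φ) (hd : 0 < p.natDegree) (hp : p.roots.Nodup)
    (hr : 0 < r) (hr₀ : r < r₀) (hreg : ∀ w : ℂ, ‖w‖ = r → IsRegularValue p w)
    (hΓ : IsFiberCycle p r W Γ) (hΓ' : IsFiberCycle p r W' Γ')
    (hT : ∀ w ∈ spectrum ℂ (aeval a p), ‖w‖ ≤ ρ) (hρ : ρ < r) :
    proj Γ a + proj Γ' a = 1 := by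
  have hdisj := disjoint_sphere_spectrum hT hρ
  have hc : ∀ l, ContinuousOn (multicentricFun p φ l) (sphere 0 r) := fun l =>
    (h.differentiableOn_multicentricFun hd l).continuousOn.mono
      (sphere_subset_closedBall.trans (closedBall_subset_ball hr₀))
  have hc' : ∀ l, ContinuousOn (multicentricFun p (fun z => 1 - φ z) l) (sphere 0 r) := fun l =>
    (h.symm.differentiableOn_multicentricFun hd l).continuousOn.mono
      (sphere_subset_closedBall.trans (closedBall_subset_ball hr₀))
  have hsum := circleIntegral_fiber_resolvent hd hp a hr.le hreg hdisj (φ := fun _ => 1)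
    (f := fun l w => multicentricFun p φ l w + multicentricFun p (fun z => 1 - φ z) l w)
    (fun l _ => (hc l).add (hc' l)) (fun z hz => by
      simp only [mul_add, Finset.sum_add_distrib]
      rw [sum_rootBasis_mul_multicentricFun hd hp h.differentiableOn (hz.trans_lt hr₀),
        sum_rootBasis_mul_multicentricFun hd hp h.symm.differentiableOn (hz.trans_lt hr₀)]
      ring)
  have hone : (2 * Real.pi * Complex.I : ℂ)⁻¹ • ∮ w in C(0, r),
      ∑ ζ ∈ fiber p w, ((derivative p).eval ζ)⁻¹ • (1 : ℂ) • resolvent a ζ = 1 := by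
    rw [← circleCalc_one hr hT hρ, circleCalc]
    congr 1
    refine circleIntegral.integral_congr hr.le fun w hw => ?_
    have := sum_fiber_smul_resolvent a hd (hreg w (by simpa using hw))
      (hdisj.notMem_of_mem_left hw) (q := 1)
      (by rw [degree_one]; exact_mod_cast hd)
    simpa using this
  rw [proj, proj, h.integral_resolvent hd hp hr hr₀ hreg hΓ hdisj,
    h.symm.integral_resolvent hd hp hr hr₀ hreg hΓ' hdisj, ← hone, hsum,
    ← Finset.sum_add_distrib]
  refine Finset.sum_congr rfl fun l _ => ?_
  rw [← mul_add, circleCalc, circleCalc, circleCalc, ← smul_add, ← circleIntegral.integral_add]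
  · simp only [add_smul]
  · exact circleIntegrable_smul_resolvent hr.le (hc l) hdisj
  · exact circleIntegrable_smul_resolvent hr.le (hc' l) hdisj

/-- The projection does not depend on the radius. -/
lemma proj_eq_proj (h : IsSplitting p r₀ W W' φ) (hd : 0 < p.natDegree) (hp : p.roots.Nodup)
    (hr : 0 < r) (hr₀ : r' < r₀) (hrr' : r ≤ r')
    (hreg : ∀ w : ℂ, ‖w‖ = r → IsRegularValue p w)
    (hreg' : ∀ w : ℂ, ‖w‖ = r' → IsRegularValue p w)
    (hΓ : IsFiberCycle p r W Γ) (hΓ' : IsFiberCycle p r' W Γ')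
    (hT : ∀ w ∈ spectrum ℂ (aeval a p), ‖w‖ ≤ ρ) (hρ : ρ < r) :
    proj Γ a = proj Γ' a := by
  rw [proj, proj, h.integral_resolvent hd hp hr (hrr'.trans_lt hr₀) hreg hΓ
      (disjoint_sphere_spectrum hT hρ),
    h.integral_resolvent hd hp (hr.trans_le hrr') hr₀ hreg' hΓ'
      (disjoint_sphere_spectrum hT (hρ.trans_le hrr'))]
  refine Finset.sum_congr rfl fun l _ => ?_
  rw [circleCalc_congr_radius hr (h.differentiableOn_multicentricFun hd l) hT hρ hrr' hr₀]

lemma commute_proj (hr : 0 < r) (hreg : ∀ w : ℂ, ‖w‖ = r → IsRegularValue p w)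
    (hΓ : IsFiberCycle p r W Γ) (hT : ∀ w ∈ spectrum ℂ (aeval a p), ‖w‖ ≤ ρ) (hρ : ρ < r)
    {b : R} (hb : Commute b a) : Commute b (proj Γ a) := by
  have hF : ContinuousOn (resolvent a) ({z | ‖p.eval z‖ = r} ∩ W) :=
    continuousOn_resolvent_fiber hT hρ
  have h1 := hΓ.integral_clm hr hreg hF (ContinuousLinearMap.mul ℂ R b)
  have h2 := hΓ.integral_clm hr hreg hF ((ContinuousLinearMap.mul ℂ R).flip b)
  simp only [ContinuousLinearMap.mul_apply', ContinuousLinearMap.flip_apply] at h1 h2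
  rw [Commute, SemiconjBy, proj, mul_smul_comm, smul_mul_assoc, ← h1, ← h2]
  simp only [(commute_resolvent hb _).eq]

/-- Projections for separated parts are orthogonal. -/
lemma proj_mul_proj (h : IsSplitting p r₀ W W' φ) (hd : 0 < p.natDegree) (hp : p.roots.Nodup)
    (hr : 0 < r) (hr₀ : r' < r₀) (hrr' : r < r')
    (hreg : ∀ w : ℂ, ‖w‖ = r → IsRegularValue p w)
    (hreg' : ∀ w : ℂ, ‖w‖ = r' → IsRegularValue p w)
    (hΓ : IsFiberCycle p r W Γ) (hΓ' : IsFiberCycle p r' W' Γ')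
    (hT : ∀ w ∈ spectrum ℂ (aeval a p), ‖w‖ ≤ ρ) (hρ : ρ < r) :
    proj Γ a * proj Γ' a = 0 := by
  have hI : (2 * Real.pi * Complex.I : ℂ) ≠ 0 := Complex.two_pi_I_ne_zero
  have hr' := hr.trans hrr'
  set S : Set ℂ := {z | ‖p.eval z‖ = r} ∩ W with hS
  set S' : Set ℂ := {z | ‖p.eval z‖ = r'} ∩ W' with hS'
  have hF : ContinuousOn (resolvent a) S := continuousOn_resolvent_fiber hT hρ
  have hF' : ContinuousOn (resolvent a) S' := continuousOn_resolvent_fiber hT (hρ.trans hrr')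
  have hne : ∀ z ∈ S, ∀ w ∈ S', w - z ≠ 0 := by
    intro z hz w hw h0
    rw [sub_eq_zero] at h0
    subst h0
    exact h.disjoint.notMem_of_mem_left hz.2 hw.2
  have hnot : ∀ z ∈ S, z ∉ spectrum ℂ a := fun z hz => notMem_spectrum_of_eval (p := p)
    ((disjoint_sphere_spectrum hT hρ).notMem_of_mem_left (by simpa using hz.1))
  have hnot' : ∀ z ∈ S', z ∉ spectrum ℂ a := fun z hz => notMem_spectrum_of_eval (p := p)
    ((disjoint_sphere_spectrum hT (hρ.trans hrr')).notMem_of_mem_left (by simpa using hz.1))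
  have hcinv : ∀ z ∈ S, ContinuousOn (fun w => (w - z)⁻¹) S' := fun z hz =>
    ContinuousOn.inv₀ (by fun_prop) (hne z hz)
  have hcinv' : ∀ w ∈ S', ContinuousOn (fun z => (w - z)⁻¹) S := fun w hw =>
    ContinuousOn.inv₀ (by fun_prop) fun z hz => hne z hz w hw
  have hidx : ∀ z ∈ S, Γ'.integral (fun w => (w - z)⁻¹) = 0 := by
    intro z hz
    have hz1 : ‖p.eval z‖ = r := hz.1
    have hi := h.symm.index_eq hd hp hr' hr₀ hreg' hΓ' (a := z) (by rw [hz1]; exact hrr'.ne)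
    rw [if_pos (by rw [hz1]; exact hrr'), h.eq_one z hz.2, sub_self, PlaneCycle.index] at hi
    exact (mul_eq_zero.1 hi).resolve_left (inv_ne_zero hI)
  have hidx' : ∀ w ∈ S', Γ.integral (fun z => (w - z)⁻¹) = 0 := by
    intro w hw
    have hw1 : ‖p.eval w‖ = r' := hw.1
    have hi := h.index_eq hd hp hr (hrr'.trans hr₀) hreg hΓ (a := w) (by rw [hw1]; exact hrr'.ne')
    rw [if_neg (by rw [hw1]; exact hrr'.not_gt), PlaneCycle.index] at hi
    have h0 := (mul_eq_zero.1 hi).resolve_left (inv_ne_zero hI)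
    have hneg := hΓ.integral_clm hr hreg (hcinv' w hw) (-ContinuousLinearMap.id ℂ ℂ)
    simp only [neg_apply, ContinuousLinearMap.id_apply, ← inv_neg,
      neg_sub] at hneg
    rw [h0] at hneg
    exact neg_eq_zero.1 hneg.symm
  have hsmul : ∀ {f : ℂ → ℂ} (b : R), ContinuousOn f S' →
      Γ'.integral (fun w => f w • b) = Γ'.integral f • b := fun {f} b hf =>
    hΓ'.integral_clm hr' hreg' hf ((ContinuousLinearMap.id ℂ ℂ).smulRight b)
  have hsmul' : ∀ {f : ℂ → ℂ} (b : R), ContinuousOn f S →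
      Γ.integral (fun w => f w • b) = Γ.integral f • b := fun {f} b hf =>
    hΓ.integral_clm hr hreg hf ((ContinuousLinearMap.id ℂ ℂ).smulRight b)
  have hid : ∀ z ∈ S, ∀ w ∈ S', resolvent a z * resolvent a w =
      (w - z)⁻¹ • resolvent a z - (w - z)⁻¹ • resolvent a w := by
    intro z hz w hw
    have e1 : resolvent a z * ((algebraMap ℂ R w - a) - (algebraMap ℂ R z - a)) * resolvent a w =
        resolvent a z - resolvent a w := by
      rw [mul_sub, sub_mul, mul_assoc, sub_mul_resolvent (hnot' w hw), mul_one,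
        resolvent_mul_sub (hnot z hz), one_mul]
    rw [← smul_sub, ← e1, sub_sub_sub_cancel_right, ← map_sub, ← Algebra.commutes, mul_assoc,
      ← Algebra.smul_def, smul_smul, inv_mul_cancel₀ (hne z hz w hw), one_smul]
  have hinner : ∀ z ∈ S, resolvent a z * Γ'.integral (resolvent a) =
      - Γ'.integral (fun w => (w - z)⁻¹ • resolvent a w) := by
    intro z hz
    have e1 := hΓ'.integral_clm hr' hreg' hF' (ContinuousLinearMap.mul ℂ R (resolvent a z))
    simp only [ContinuousLinearMap.mul_apply'] at e1
    rw [← e1, hΓ'.integral_congr hr' (hid z hz), hΓ'.integral_sub hr' hreg'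
      (F := fun w => (w - z)⁻¹ • resolvent a z) (G := fun w => (w - z)⁻¹ • resolvent a w)
      ((hcinv z hz).smul continuousOn_const) ((hcinv z hz).smul hF'), hsmul _ (hcinv z hz),
      hidx z hz, zero_smul, zero_sub]
  have hswap := hΓ.integral_swap hΓ' hr hr' hreg hreg'
    (G := fun z w => (w - z)⁻¹ • resolvent a w) (by
      refine ContinuousOn.smul (ContinuousOn.inv₀ (by fun_prop) ?_) ?_
      · rintro ⟨z, w⟩ ⟨hz, hw⟩
        exact hne z hz w hw
      · exact hF'.comp continuousOn_snd fun x hx => hx.2)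
  have hzero : Γ'.integral (fun w => Γ.integral fun z => (w - z)⁻¹ • resolvent a w) = 0 := by
    rw [hΓ'.integral_congr hr' (G := fun _ => 0) fun w hw => by
      rw [hsmul' _ (hcinv' w hw), hidx' w hw, zero_smul]]
    simp [PlaneCycle.integral]
  have e2 := hΓ.integral_clm hr hreg hF
    ((ContinuousLinearMap.mul ℂ R).flip (Γ'.integral (resolvent a)))
  simp only [ContinuousLinearMap.mul_apply', ContinuousLinearMap.flip_apply] at e2
  have e3 : Γ.integral (fun z => -Γ'.integral fun w => (w - z)⁻¹ • resolvent a w) = 0 := by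
    rw [← neg_eq_zero, ← hzero, ← hswap]
    simp [PlaneCycle.integral]
  have e4 : Γ.integral (resolvent a) * Γ'.integral (resolvent a) = 0 := by
    rw [← e2, ← e3]
    exact hΓ.integral_congr hr hinner
  change (_ • Γ.integral (resolvent a)) * (_ • Γ'.integral (resolvent a)) = 0
  rw [smul_mul_smul_comm, e4, smul_zero]

lemma isIdempotentElem_proj (h : IsSplitting p r₀ W W' φ) (hd : 0 < p.natDegree)
    (hp : p.roots.Nodup) (hr : 0 < r) (hr₀ : r < r₀)
    (hreg : ∀ w : ℂ, ‖w‖ = r → IsRegularValue p w) (hΓ : IsFiberCycle p r W Γ)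
    (hT : ∀ w ∈ spectrum ℂ (aeval a p), ‖w‖ ≤ ρ) (hρ : ρ < r) :
    IsIdempotentElem (proj Γ a) := by
  obtain ⟨r', ⟨hrr', hr'₀⟩, hreg'⟩ := exists_regular_radius hd hr₀
  have hr' := hr.trans hrr'
  obtain ⟨Γ₁, hΓ₁⟩ := h.exists_cycle hd hr' hr'₀ hreg'
  obtain ⟨Γ₂, hΓ₂⟩ := h.symm.exists_cycle hd hr' hr'₀ hreg'
  have h1 := h.proj_add_proj hd hp hr' hr'₀ hreg' hΓ₁ hΓ₂ hT (hρ.trans hrr')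
  have h2 := h.proj_mul_proj hd hp hr hr'₀ hrr' hreg hreg' hΓ hΓ₂ hT hρ
  rw [← h.proj_eq_proj hd hp hr hr'₀ hrr'.le hreg hreg' hΓ hΓ₁ hT hρ] at h1
  calc proj Γ a * proj Γ a = proj Γ a * (proj Γ a + proj Γ₂ a) := by rw [mul_add, h2, add_zero]
    _ = proj Γ a := by rw [h1, mul_one]

/-- `λ - a` is invertible on the range of the projection for `λ` outside of `W`. -/
lemma exists_inverse_on_range (h : IsSplitting p r₀ W W' φ) (hd : 0 < p.natDegree)
    (hp : p.roots.Nodup) (hr : 0 < r) (hr₀ : r < r₀)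
    (hreg : ∀ w : ℂ, ‖w‖ = r → IsRegularValue p w) (hΓ : IsFiberCycle p r W Γ)
    (hT : ∀ w ∈ spectrum ℂ (aeval a p), ‖w‖ ≤ ρ) (hρ : ρ < r) {z₀ : ℂ}
    (hz : z₀ ∈ spectrum ℂ a → z₀ ∉ W) :
    ∃ X : R, (∀ b, Commute b a → Commute b X) ∧ (algebraMap ℂ R z₀ - a) * X = proj Γ a := by
  by_cases hz₀ : z₀ ∈ spectrum ℂ a
  swap
  · refine ⟨resolvent a z₀ * proj Γ a, fun b hb => (commute_resolvent hb z₀).mul_right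
      (commute_proj hr hreg hΓ hT hρ hb), ?_⟩
    rw [← mul_assoc, sub_mul_resolvent hz₀, one_mul]
  have hW := hz hz₀
  have hpz : ‖p.eval z₀‖ ≤ ρ := hT _ (spectrum.subset_polynomial_aeval a p ⟨z₀, hz₀, rfl⟩)
  have hW' : z₀ ∈ W' := (h.cover z₀ ((hpz.trans_lt hρ).trans hr₀)).resolve_left hW
  have hI : (2 * Real.pi * Complex.I : ℂ) ≠ 0 := Complex.two_pi_I_ne_zero
  set S : Set ℂ := {z | ‖p.eval z‖ = r} ∩ W with hS
  have hF : ContinuousOn (resolvent a) S := continuousOn_resolvent_fiber hT hρ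
  have hne : ∀ z ∈ S, z - z₀ ≠ 0 := fun z hzS h0 => hW (by rw [← sub_eq_zero.1 h0]; exact hzS.2)
  have hnot : ∀ z ∈ S, z ∉ spectrum ℂ a := fun z hz => notMem_spectrum_of_eval (p := p)
    ((disjoint_sphere_spectrum hT hρ).notMem_of_mem_left (by simpa using hz.1))
  have hcinv : ContinuousOn (fun z => (z - z₀)⁻¹) S := ContinuousOn.inv₀ (by fun_prop) hne
  have hcX : ContinuousOn (fun z => (z - z₀)⁻¹ • resolvent a z) S := hcinv.smul hF
  have hidx : Γ.integral (fun z => (z - z₀)⁻¹) = 0 := by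
    have hi := h.index_eq hd hp hr hr₀ hreg hΓ (a := z₀) (hpz.trans_lt hρ).ne
    rw [if_pos (hpz.trans_lt hρ), h.eq_zero z₀ hW', PlaneCycle.index] at hi
    exact (mul_eq_zero.1 hi).resolve_left (inv_ne_zero hI)
  refine ⟨-((2 * Real.pi * Complex.I : ℂ)⁻¹ •
    Γ.integral (fun z => (z - z₀)⁻¹ • resolvent a z)), fun b hb => ?_, ?_⟩
  · refine Commute.neg_right ?_
    have h1 := hΓ.integral_clm hr hreg hcX (ContinuousLinearMap.mul ℂ R b)
    have h2 := hΓ.integral_clm hr hreg hcX ((ContinuousLinearMap.mul ℂ R).flip b)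
    simp only [ContinuousLinearMap.mul_apply', ContinuousLinearMap.flip_apply] at h1 h2
    rw [Commute, SemiconjBy, mul_smul_comm, smul_mul_assoc, ← h1, ← h2]
    simp only [mul_smul_comm, smul_mul_assoc, (commute_resolvent hb _).eq]
  · have h1 := hΓ.integral_clm hr hreg hcX
      (ContinuousLinearMap.mul ℂ R (algebraMap ℂ R z₀ - a))
    simp only [ContinuousLinearMap.mul_apply'] at h1
    have h2 : Set.EqOn
        (fun z => (algebraMap ℂ R z₀ - a) * ((z - z₀)⁻¹ • resolvent a z))
        (fun z => (z - z₀)⁻¹ • (1 : R) - resolvent a z) S := by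
      intro z hz
      have e1 : (algebraMap ℂ R z₀ - a) * resolvent a z = 1 - (z - z₀) • resolvent a z := by
        rw [← sub_mul_resolvent (hnot z hz), Algebra.smul_def, map_sub]
        noncomm_ring
      simp only
      rw [mul_smul_comm, e1, smul_sub, smul_smul, inv_mul_cancel₀ (hne z hz), one_smul]
    have h3 := hΓ.integral_clm hr hreg hcinv ((ContinuousLinearMap.id ℂ ℂ).smulRight (1 : R))
    simp only [ContinuousLinearMap.smulRight_apply, ContinuousLinearMap.id_apply] at h3
    rw [mul_neg, mul_smul_comm, ← h1, hΓ.integral_congr hr h2, hΓ.integral_sub hr hreg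
      (F := fun z => (z - z₀)⁻¹ • (1 : R)) (hcinv.smul continuousOn_const) hF, h3, hidx, zero_smul, zero_sub, smul_neg, neg_neg]
    rfl

end IsSplitting
end Algebra
end Riesz

/-! ### Spectra of restrictions -/

section Restriction

variable {H : Type*} [NormedAddCommGroup H] [InnerProductSpace ℂ H]

lemma mapsTo_range_of_commute {A P : H →L[ℂ] H} (hAP : Commute A P) :
    Set.MapsTo A P.range P.range := by
  rintro _ ⟨y, rfl⟩
  exact ⟨A y, (DFunLike.congr_fun hAP.eq y).symm⟩

/-- `z - A` is invertible on the range of `P` if and only if it divides `P`. -/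
lemma notMem_spectrum_restrict_iff {A P : H →L[ℂ] H} (hP : IsIdempotentElem P)
    (hAP : Commute A P) {M : Submodule ℂ H} (hM : M = P.range) (h : Set.MapsTo A M M) {z : ℂ} :
    z ∉ spectrum ℂ (A.restrict h : M →L[ℂ] M) ↔
      ∃ X : H →L[ℂ] H, Commute X P ∧ (algebraMap ℂ _ z - A) * X = P ∧
        X * (algebraMap ℂ _ z - A) = P := by
  subst hM
  have hPx : ∀ x ∈ P.range, P x = x := by
    rintro _ ⟨y, rfl⟩
    exact DFunLike.congr_fun hP.eq y
  constructor
  · intro hz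
    obtain ⟨u, hu⟩ := spectrum.notMem_iff.1 hz
    set S : P.range →L[ℂ] P.range := ↑u⁻¹
    have h1 : ∀ x : P.range, z • (S x : H) - A (S x) = x := by
      intro x
      have : (u : P.range →L[ℂ] P.range) * S = 1 := u.mul_inv
      rw [hu] at this
      have := congrArg Subtype.val (DFunLike.congr_fun this x)
      rw [Algebra.algebraMap_eq_smul_one] at this
      exact this
    have h2 : ∀ x : P.range, S (z • x - ⟨A x, h x.2⟩) = x := by
      intro x
      have : S * (u : P.range →L[ℂ] P.range) = 1 := u.inv_mul
      rw [hu] at this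
      exact DFunLike.congr_fun this x
    set P' : H →L[ℂ] P.range := P.codRestrict P.range fun x => ⟨x, rfl⟩
    have hP' : ∀ x, (P' x : H) = P x := fun x => rfl
    refine ⟨P.range.subtypeL.comp (S.comp P'), ?_, ?_, ?_⟩
    · ext x
      have e1 : P' (P x) = P' x := Subtype.ext (DFunLike.congr_fun hP.eq x)
      have e2 : P (S (P' x)) = S (P' x) := hPx _ (S (P' x)).2
      simp [e1, e2]
    · ext x
      have := h1 (P' x)
      simpa [hP', Algebra.algebraMap_eq_smul_one] using this
    · ext x
      have := congrArg Subtype.val (h2 (P' x))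
      have e : P' (z • x - A x) = z • P' x - ⟨A (P' x), h (P' x).2⟩ := by
        apply Subtype.ext
        have hc : P (A x) = A (P x) := (DFunLike.congr_fun hAP.eq x).symm
        simp [hP', hc]
      rw [← e] at this
      simpa [hP', Algebra.algebraMap_eq_smul_one] using this
  · rintro ⟨X, hXP, hX1, hX2⟩
    have hX := mapsTo_range_of_commute hXP
    refine spectrum.notMem_iff.2 (isUnit_iff_exists.2 ⟨X.restrict hX, ?_, ?_⟩)
    · ext x
      have := DFunLike.congr_fun hX1 (x : H)
      rw [hPx x x.2] at this
      rw [Algebra.algebraMap_eq_smul_one] at this ⊢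
      exact this
    · ext x
      have := DFunLike.congr_fun hX2 (x : H)
      rw [hPx x x.2] at this
      rw [Algebra.algebraMap_eq_smul_one] at this ⊢
      exact this

variable [CompleteSpace H]

open Metric IsSplitting

lemma IsSplitting.isRieszProjection {p : ℂ[X]} {r₀ ρ r : ℝ} {W W' K : Set ℂ} {φ : ℂ → ℂ}
    {Γ : PlaneCycle} {A : H →L[ℂ] H} (h : IsSplitting p r₀ W W' φ) (hd : 0 < p.natDegree)
    (hp : p.roots.Nodup) (hr : 0 < r) (hr₀ : r < r₀)
    (hreg : ∀ w : ℂ, ‖w‖ = r → IsRegularValue p w) (hΓ : IsFiberCycle p r W Γ)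
    (hT : ∀ w ∈ spectrum ℂ (aeval A p), ‖w‖ ≤ ρ) (hρ : ρ < r)
    (hK : ∀ z ∈ spectrum ℂ A, z ∈ K ↔ z ∈ W) :
    IsRieszProjection A K (proj Γ A) := by
  have hlt : ∀ z ∈ spectrum ℂ A, ‖p.eval z‖ < r := fun z hz =>
    (hT _ (spectrum.subset_polynomial_aeval A p ⟨z, hz, rfl⟩)).trans_lt hρ
  have hW' : ∀ z ∈ spectrum ℂ A, z ∈ W' ↔ z ∉ W := fun z hz =>
    ⟨fun h1 h2 => h.disjoint.notMem_of_mem_left h2 h1,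
      (h.cover z ((hlt z hz).trans hr₀)).resolve_left⟩
  obtain ⟨Γ', hΓ'⟩ := h.symm.exists_cycle hd hr hr₀ hreg
  have hsum := h.proj_add_proj hd hp hr hr₀ hreg hΓ hΓ' hT hρ
  have hidem := h.isIdempotentElem_proj hd hp hr hr₀ hreg hΓ hT hρ
  have hidem' := h.symm.isIdempotentElem_proj hd hp hr hr₀ hreg hΓ' hT hρ
  have hcomm : ∀ b, Commute b A → Commute b (proj Γ A) := fun b hb =>
    commute_proj hr hreg hΓ hT hρ hb
  have hcomm' : ∀ b, Commute b A → Commute b (proj Γ' A) := fun b hb =>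
    commute_proj hr hreg hΓ' hT hρ hb
  have hA : Commute A A := Commute.refl A
  have key : ∀ z, (z ∈ spectrum ℂ A → z ∉ W) → ∃ X : H →L[ℂ] H, Commute X A ∧
      Commute X (proj Γ A) ∧ (algebraMap ℂ _ z - A) * X = proj Γ A ∧
        X * (algebraMap ℂ _ z - A) = proj Γ A := by
    intro z hz
    obtain ⟨X, hX1, hX2⟩ := h.exists_inverse_on_range hd hp hr hr₀ hreg hΓ hT hρ hz
    refine ⟨X, (hX1 A hA).symm, hcomm X (hX1 A hA).symm, hX2, ?_⟩
    rw [← hX2]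
    exact (Commute.sub_right (Algebra.commutes z X).symm (hX1 A hA).symm).eq
  have key' : ∀ z, (z ∈ spectrum ℂ A → z ∉ W') → ∃ X : H →L[ℂ] H, Commute X A ∧
      Commute X (proj Γ' A) ∧ (algebraMap ℂ _ z - A) * X = proj Γ' A ∧
        X * (algebraMap ℂ _ z - A) = proj Γ' A := by
    intro z hz
    obtain ⟨X, hX1, hX2⟩ := h.symm.exists_inverse_on_range hd hp hr hr₀ hreg hΓ' hT hρ hz
    refine ⟨X, (hX1 A hA).symm, hcomm' X (hX1 A hA).symm, hX2, ?_⟩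
    rw [← hX2]
    exact (Commute.sub_right (Algebra.commutes z X).symm (hX1 A hA).symm).eq
  have hunit : ∀ {z : ℂ} {X Y : H →L[ℂ] H}, (algebraMap ℂ _ z - A) * X = proj Γ A →
      X * (algebraMap ℂ _ z - A) = proj Γ A → (algebraMap ℂ _ z - A) * Y = proj Γ' A →
      Y * (algebraMap ℂ _ z - A) = proj Γ' A → z ∉ spectrum ℂ A := by
    intro z X Y hX1 hX2 hY1 hY2
    refine spectrum.notMem_iff.2 (isUnit_iff_exists.2 ⟨X + Y, ?_, ?_⟩)
    · rw [mul_add, hX1, hY1, hsum]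
    · rw [add_mul, hX2, hY2, hsum]
  have hker : (proj Γ A).ker = (proj Γ' A).range := by
    have hQ : proj Γ' A = 1 - proj Γ A := by rw [← hsum]; abel
    ext x
    constructor
    · intro hx
      refine ⟨x, ?_⟩
      have hx' : proj Γ A x = 0 := hx
      change proj Γ' A x = x
      rw [hQ]
      simp [hx']
    · rintro ⟨y, rfl⟩
      change proj Γ A (proj Γ' A y) = 0
      rw [hQ]
      have := DFunLike.congr_fun hidem.eq y
      simp only [mul_apply_eq_comp] at this
      simp [this]
  refine ⟨⟨Γ, ?_, ?_, ?_, rfl⟩, hidem, hcomm A hA, ⟨mapsTo_range_of_commute (hcomm A hA), ?_⟩,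
    ⟨by rw [hker]; exact mapsTo_range_of_commute (hcomm' A hA), ?_⟩⟩
  · rw [Set.disjoint_left]
    intro z hz hzA
    exact (hlt z hzA).ne (hΓ.support_subset hr.le hz).1
  · rintro a ⟨ha, haK⟩
    rw [h.index_eq hd hp hr hr₀ hreg hΓ (hlt a ha).ne, if_pos (hlt a ha),
      h.eq_one a ((hK a ha).1 haK)]
  · rintro a ⟨ha, haK⟩
    rw [h.index_eq hd hp hr hr₀ hreg hΓ (hlt a ha).ne, if_pos (hlt a ha),
      h.eq_zero a ((hW' a ha).2 fun hW => haK ((hK a ha).2 hW))]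
  · ext z
    rw [← not_iff_not, notMem_spectrum_restrict_iff hidem (hcomm A hA) rfl]
    constructor
    · rintro ⟨X, -, hX1, hX2⟩ ⟨hz, hzK⟩
      obtain ⟨Y, -, -, hY1, hY2⟩ := key' z fun hz hzW' => (hW' z hz).1 hzW' ((hK z hz).1 hzK)
      exact hunit hX1 hX2 hY1 hY2 hz
    · intro hz
      obtain ⟨X, -, hX⟩ := key z fun hzA hzW => hz ⟨hzA, (hK z hzA).2 hzW⟩
      exact ⟨X, hX⟩
  · ext z
    rw [← not_iff_not, notMem_spectrum_restrict_iff hidem' (hcomm' A hA) hker]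
    constructor
    · rintro ⟨Y, -, hY1, hY2⟩ ⟨hz, hzK⟩
      obtain ⟨X, -, -, hX1, hX2⟩ := key z fun hz hzW => hzK ((hK z hz).2 hzW)
      exact hunit hX1 hX2 hY1 hY2 hz
    · intro hz
      obtain ⟨Y, -, hY⟩ := key' z fun hzA hzW' => hz ⟨hzA, fun hzK =>
        (hW' z hzA).1 hzW' ((hK z hzA).1 hzK)⟩
      exact ⟨Y, hY⟩

end Restriction

/-! ### Splitting a power series along residue classes -/

section PowerSplitting

open Metric Filter

/-- The root of unity `e^{2πim/n}`. -/
lemma exp_eq_pow (n m : ℕ) :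
    Complex.exp (2 * Real.pi * Complex.I * m / n) =
      Complex.exp (2 * Real.pi * Complex.I / n) ^ m := by
  rw [← Complex.exp_nat_mul]
  ring_nf

lemma exp_neg_eq_pow (n m k : ℕ) :
    Complex.exp (-(2 * Real.pi * Complex.I * m * k / n)) =
      ((Complex.exp (2 * Real.pi * Complex.I / n) ^ m) ^ k)⁻¹ := by
  rw [Complex.exp_neg, ← pow_mul, ← Complex.exp_nat_mul]
  push_cast
  ring_nf

lemma sum_exp_mul_pow {n : ℕ} (hn : n ≠ 0) {k : ℕ} (hk : k < n) (j : ℕ) :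
    (n : ℂ)⁻¹ * ∑ m ∈ Finset.range n, Complex.exp (-(2 * Real.pi * Complex.I * m * k / n)) *
      Complex.exp (2 * Real.pi * Complex.I * m / n) ^ j = if j % n = k then 1 else 0 := by
  have hζ := Complex.isPrimitiveRoot_exp n hn
  set ζ := Complex.exp (2 * Real.pi * Complex.I / n) with hζdef
  have hζ0 : ζ ≠ 0 := Complex.exp_ne_zero _
  have hterm : ∀ m ∈ Finset.range n, Complex.exp (-(2 * Real.pi * Complex.I * m * k / n)) *
      Complex.exp (2 * Real.pi * Complex.I * m / n) ^ j = (ζ ^ j / ζ ^ k) ^ m := by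
    intro m _
    rw [exp_neg_eq_pow, exp_eq_pow, ← hζdef, div_pow, ← pow_mul, ← pow_mul, ← pow_mul, ← pow_mul,
      mul_comm m j, mul_comm m k, div_eq_inv_mul (ζ ^ (j * m))]
  have hjk : ζ ^ j = ζ ^ (j % n) := by
    conv_lhs => rw [← Nat.div_add_mod j n, pow_add, pow_mul, hζ.pow_eq_one, one_pow, one_mul]
  have hn' : (n : ℂ) ≠ 0 := Nat.cast_ne_zero.2 hn
  rw [Finset.sum_congr rfl hterm]
  split_ifs with h
  · rw [hjk, h, div_self (pow_ne_zero _ hζ0)]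
    simp [hn']
  · have hne : ζ ^ j / ζ ^ k ≠ 1 := by
      rw [Ne, div_eq_one_iff_eq (pow_ne_zero _ hζ0), hjk]
      exact fun he => h (hζ.pow_inj (Nat.mod_lt _ (Nat.pos_of_ne_zero hn)) hk he)
    rw [geom_sum_eq hne, div_pow, ← pow_mul, ← pow_mul, mul_comm j, mul_comm k, pow_mul, pow_mul,
      hζ.pow_eq_one]
    simp

/-- The part of a power series with exponents congruent to `k` modulo `n`. -/
lemma exists_power_part {f : ℂ → ℂ} {r : ℝ} (hr : 0 < r) (hf : DifferentiableOn ℂ f (ball 0 r))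
    {n : ℕ} (hn : n ≠ 0) {k : ℕ} (hk : k < n) :
    ∃ g : ℂ → ℂ, DifferentiableOn ℂ g (ball 0 (r ^ n)) ∧ ∀ w ∈ ball (0 : ℂ) r,
      w ^ k * g (w ^ n) = (n : ℂ)⁻¹ * ∑ m ∈ Finset.range n,
        Complex.exp (-(2 * Real.pi * Complex.I * m * k / n)) *
          f (Complex.exp (2 * Real.pi * Complex.I * m / n) * w) := by
  set c : ℕ → ℂ := fun j => (j.factorial : ℂ)⁻¹ * iteratedDeriv j f 0 with hc
  have hsum : ∀ w ∈ ball (0 : ℂ) r, HasSum (fun j => c j * w ^ j) (f w) := by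
    intro w hw
    have := Complex.hasSum_taylorSeries_on_ball hf hw
    simpa [hc, mul_assoc, mul_comm, mul_left_comm] using this
  refine ⟨fun v => ∑' j, c (n * j + k) * v ^ j, fun v hv => ?_, fun w hw => ?_⟩
  · have hv' : ‖v‖ < r ^ n := by simpa using hv
    obtain ⟨s, hs1, hs0, hsr⟩ : ∃ s, ‖v‖ < s ^ n ∧ 0 < s ∧ s < r := by
      have h1 : ∀ᶠ s in 𝓝[<] r, ‖v‖ < s ^ n :=
        ((continuous_pow n).tendsto r |>.mono_left nhdsWithin_le_nhds).eventually_const_lt hv'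
      obtain ⟨s, hs, hs'⟩ := (h1.and (Ioo_mem_nhdsLT hr)).exists
      exact ⟨s, hs, hs'⟩
    have hS : Summable fun j => ‖c j * (s : ℂ) ^ j‖ :=
      (hsum s (by simpa [abs_of_pos hs0] using hsr)).summable.norm
    have hS' : Summable fun j => (s ^ k)⁻¹ * ‖c (n * j + k) * (s : ℂ) ^ (n * j + k)‖ :=
      (hS.comp_injective (i := fun j => n * j + k) fun a b hab => by
        simpa [hn] using hab).mul_left _
    refine ((Complex.differentiableOn_tsum_of_summable_norm hS' (U := ball 0 (s ^ n))
      (fun j => by fun_prop) isOpen_ball fun j w hw => ?_).differentiableAt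
        (isOpen_ball.mem_nhds (by simpa using hs1))).differentiableWithinAt
    have hw' : ‖w‖ ≤ s ^ n := by simpa using (mem_ball_zero_iff.1 hw).le
    have hs0' : (s ^ k) ≠ 0 := (pow_pos hs0 k).ne'
    calc ‖c (n * j + k) * w ^ j‖ = ‖c (n * j + k)‖ * ‖w‖ ^ j := by
          rw [norm_mul (c (n * j + k)), norm_pow]
      _ ≤ ‖c (n * j + k)‖ * (s ^ n) ^ j := by gcongr
      _ = _ := by
        rw [norm_mul (c (n * j + k)), norm_pow, Complex.norm_of_nonneg hs0.le, pow_add, pow_mul]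
        field_simp
  · have hroot : ∀ m ∈ Finset.range n,
        HasSum (fun j => Complex.exp (-(2 * Real.pi * Complex.I * m * k / n)) *
          (c j * (Complex.exp (2 * Real.pi * Complex.I * m / n) * w) ^ j))
        (Complex.exp (-(2 * Real.pi * Complex.I * m * k / n)) *
          f (Complex.exp (2 * Real.pi * Complex.I * m / n) * w)) := by
      intro m _
      refine (hsum _ ?_).mul_left _
      have h1 : ‖Complex.exp (2 * Real.pi * Complex.I / n)‖ = 1 :=
        (Complex.isPrimitiveRoot_exp n hn).norm'_eq_one hn
      rw [mem_ball_zero_iff, norm_mul, exp_eq_pow, norm_pow, h1, one_pow, one_mul]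
      simpa using hw
    have htot := (hasSum_sum hroot).mul_left (n : ℂ)⁻¹
    have heq : (fun j => (n : ℂ)⁻¹ * ∑ m ∈ Finset.range n,
        Complex.exp (-(2 * Real.pi * Complex.I * m * k / n)) *
          (c j * (Complex.exp (2 * Real.pi * Complex.I * m / n) * w) ^ j)) =
        fun j => if j % n = k then c j * w ^ j else 0 := by
      funext j
      have := sum_exp_mul_pow hn hk j
      calc _ = ((n : ℂ)⁻¹ * ∑ m ∈ Finset.range n,
            Complex.exp (-(2 * Real.pi * Complex.I * m * k / n)) *
            Complex.exp (2 * Real.pi * Complex.I * m / n) ^ j) * (c j * w ^ j) := by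
            rw [mul_assoc (n : ℂ)⁻¹, Finset.sum_mul]
            congr 1
            exact Finset.sum_congr rfl fun m _ => by ring
        _ = _ := by rw [this]; split_ifs <;> simp
    rw [heq] at htot
    have hinj : Function.Injective fun j => n * j + k := fun a b hab => by simpa [hn] using hab
    rw [← htot.tsum_eq, ← hinj.tsum_eq, ← tsum_mul_left]
    · refine tsum_congr fun j => ?_
      rw [if_pos (by rw [Nat.mul_add_mod, Nat.mod_eq_of_lt hk])]
      ring
    · intro j hj
      by_cases h : j % n = k
      · exact ⟨j / n, by simp only; rw [← h, Nat.div_add_mod]⟩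
      · simp [h] at hj

variable {E : Type*} [NormedAddCommGroup E] [NormedSpace ℂ E]

/-- The substitution `v = wⁿ` in a circle integral. -/
lemma circleIntegral_pow {G : ℂ → E} {r : ℝ} (hr : 0 ≤ r) {n : ℕ} (hn : n ≠ 0)
    (hG : ContinuousOn G (sphere 0 (r ^ n))) :
    ∮ v in C(0, r ^ n), G v = ∮ w in C(0, r), w ^ (n - 1) • G (w ^ n) := by
  set F : ℝ → E := fun θ => (circleMap 0 (r ^ n) θ * Complex.I) • G (circleMap 0 (r ^ n) θ)
    with hF
  have hFc : Continuous F := ((continuous_circleMap 0 _).mul continuous_const).smul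
    (hG.comp_continuous (continuous_circleMap 0 _) fun θ =>
      circleMap_mem_sphere 0 (pow_nonneg hr n) θ)
  have hper : Function.Periodic F (2 * Real.pi) := fun θ => by
    simp only [hF, periodic_circleMap 0 (r ^ n) θ]
  have h1 : ∀ θ, (circleMap 0 r θ * Complex.I) •
      circleMap 0 r θ ^ (n - 1) • G (circleMap 0 r θ ^ n) = F (n * θ) := by
    intro θ
    simp only [hF]
    rw [smul_smul, ← circleMap_zero_pow]
    congr 1
    rw [mul_right_comm, ← pow_succ', Nat.sub_add_cancel (Nat.pos_of_ne_zero hn)]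
  have hn' : (n : ℝ) ≠ 0 := Nat.cast_ne_zero.2 hn
  simp only [circleIntegral, deriv_circleMap]
  simp only [h1]
  have h2 := hper.intervalIntegral_add_zsmul_eq n 0 (fun t₁ t₂ => hFc.intervalIntegrable t₁ t₂)
  rw [intervalIntegral.integral_comp_mul_left F hn']
  simp only [zero_add, zsmul_eq_mul, Int.cast_natCast, mul_zero, natCast_zsmul] at h2 ⊢
  rw [h2, ← Nat.cast_smul_eq_nsmul ℝ, smul_smul, inv_mul_cancel₀ hn', one_smul]

/-- Rotation invariance of circle integrals. -/
lemma circleIntegral_rotate (F : ℂ → E) (r α : ℝ) :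
    ∮ w in C(0, r), Complex.exp (α * Complex.I) • F (Complex.exp (α * Complex.I) * w) =
      ∮ w in C(0, r), F w := by
  simp only [circleIntegral, deriv_circleMap]
  set G : ℝ → E := fun θ => (circleMap 0 r θ * Complex.I) • F (circleMap 0 r θ) with hG
  have hper : Function.Periodic G (2 * Real.pi) := fun θ => by
    simp only [hG, periodic_circleMap 0 r θ]
  have h1 : ∀ θ, (circleMap 0 r θ * Complex.I) • Complex.exp (α * Complex.I) •
      F (Complex.exp (α * Complex.I) * circleMap 0 r θ) = G (θ + α) := by
    intro θ
    have : Complex.exp (α * Complex.I) * circleMap 0 r θ = circleMap 0 r (θ + α) := by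
      simp only [circleMap, zero_add]
      push_cast
      rw [add_mul, Complex.exp_add]
      ring
    rw [hG, smul_smul, this]
    congr 1
    rw [← this]
    ring
  simp only [h1]
  rw [intervalIntegral.integral_comp_add_right, zero_add, add_comm, hper.intervalIntegral_add_eq α 0,
    zero_add]

variable {R : Type*} [NormedRing R] [NormedAlgebra ℂ R]

lemma norm_le_of_mem_spectrum_of_pow {T : R} {n : ℕ} (hn : n ≠ 0) {ρ : ℝ} (hρ : 0 ≤ ρ)
    (hT : ∀ v ∈ spectrum ℂ (T ^ n), ‖v‖ ≤ ρ ^ n) : ∀ w ∈ spectrum ℂ T, ‖w‖ ≤ ρ := by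
  intro w hw
  have := hT _ (spectrum.pow_mem_pow T n hw)
  rw [norm_pow] at this
  exact (pow_le_pow_iff_left₀ (norm_nonneg w) hρ hn).1 this

variable [CompleteSpace R]

/-- `f(T) = ∑ₖ Tᵏ gₖ(Tⁿ)` for the parts `wᵏ gₖ(wⁿ)` of `f`. -/
lemma circleCalc_eq_sum_pow {T : R} {n : ℕ} (hn : n ≠ 0) {ρ r : ℝ} (hρ : 0 ≤ ρ) (hr : ρ < r)
    (hT : ∀ v ∈ spectrum ℂ (T ^ n), ‖v‖ ≤ ρ ^ n) {f : ℂ → ℂ} {g : ℕ → ℂ → ℂ}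
    (hf : ContinuousOn f (sphere 0 r)) (hg : ∀ k < n, ContinuousOn (g k) (sphere 0 (r ^ n)))
    (hfg : ∀ k < n, ∀ w ∈ sphere (0 : ℂ) r, w ^ k * g k (w ^ n) =
      (n : ℂ)⁻¹ * ∑ m ∈ Finset.range n,
        Complex.exp (-(2 * Real.pi * Complex.I * m * k / n)) *
          f (Complex.exp (2 * Real.pi * Complex.I * m / n) * w)) :
    circleCalc T f r = ∑ k ∈ Finset.range n, T ^ k * circleCalc (T ^ n) (g k) (r ^ n) := by
  have hr0 : 0 < r := hρ.trans_lt hr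
  have hn' : (n : ℂ) ≠ 0 := Nat.cast_ne_zero.2 hn
  have hrn : ρ ^ n < r ^ n := pow_lt_pow_left₀ hr hρ hn
  have hd1 : Disjoint (sphere (0 : ℂ) r) (spectrum ℂ T) :=
    IsSplitting.disjoint_sphere_spectrum (norm_le_of_mem_spectrum_of_pow hn hρ hT) hr
  have hdn : Disjoint (sphere (0 : ℂ) (r ^ n)) (spectrum ℂ (T ^ n)) :=
    IsSplitting.disjoint_sphere_spectrum hT hrn
  have hpow : ∀ w ∈ sphere (0 : ℂ) r, w ^ n ∈ sphere (0 : ℂ) (r ^ n) := by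
    intro w hw
    rw [mem_sphere_zero_iff_norm] at hw ⊢
    rw [norm_pow, hw]
  set Ψ : ℕ → ℂ → R := fun k u => (f u * u ^ (n - 1 - k)) • resolvent (T ^ n) (u ^ n) with hΨ
  have hres : ContinuousOn (fun u : ℂ => resolvent (T ^ n) (u ^ n)) (sphere 0 r) :=
    (continuousOn_resolvent hdn).comp (by fun_prop) hpow
  have hΨc : ∀ k, ContinuousOn (Ψ k) (sphere 0 r) := fun k => (hf.mul (by fun_prop)).smul hres
  have hnorm : ∀ m : ℕ, ‖Complex.exp (2 * Real.pi * Complex.I * m / n)‖ = 1 := by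
    intro m
    rw [exp_eq_pow, norm_pow, (Complex.isPrimitiveRoot_exp n hn).norm'_eq_one hn, one_pow]
  have hpart : ∀ k < n, ∮ v in C(0, r ^ n), g k v • resolvent (T ^ n) v =
      ∮ u in C(0, r), Ψ k u := by
    intro k hk
    rw [circleIntegral_pow (G := fun v => g k v • resolvent (T ^ n) v) hr0.le hn ((hg k hk).smul (continuousOn_resolvent hdn))]
    have hpt : Set.EqOn (fun w => w ^ (n - 1) • g k (w ^ n) • resolvent (T ^ n) (w ^ n))
        (fun w => (n : ℂ)⁻¹ • ∑ m ∈ Finset.range n,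
          Complex.exp (2 * Real.pi * Complex.I * m / n) •
            Ψ k (Complex.exp (2 * Real.pi * Complex.I * m / n) * w)) (sphere 0 r) := by
      intro w hw
      have h1 : w ^ (n - 1) * g k (w ^ n) = w ^ (n - 1 - k) * (w ^ k * g k (w ^ n)) := by
        rw [← mul_assoc, ← pow_add, Nat.sub_add_cancel (by omega)]
      simp only
      rw [smul_smul, h1, hfg k hk w hw, mul_left_comm, mul_smul, Finset.mul_sum, Finset.sum_smul]
      congr 1
      refine Finset.sum_congr rfl fun m _ => ?_
      have hζ := (Complex.isPrimitiveRoot_exp n hn).pow_eq_one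
      rw [exp_neg_eq_pow, exp_eq_pow]
      set ω := Complex.exp (2 * Real.pi * Complex.I / n) ^ m with hω
      have hωn : ω ^ n = 1 := by rw [hω, ← pow_mul, mul_comm m, pow_mul, hζ, one_pow]
      have hω0 : ω ≠ 0 := pow_ne_zero _ (Complex.exp_ne_zero _)
      have h2 : (ω ^ k)⁻¹ = ω * ω ^ (n - 1 - k) := by
        rw [inv_eq_iff_eq_inv, eq_comm, inv_eq_iff_eq_inv, ← pow_succ']
        refine eq_inv_of_mul_eq_one_left ?_
        rw [← pow_add, show n - 1 - k + 1 + k = n by omega, hωn]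
      simp only [hΨ]
      rw [smul_smul, mul_pow ω w n, hωn, one_mul, h2, mul_pow ω w]
      congr 1
      ring
    rw [circleIntegral.integral_congr hr0.le hpt, circleIntegral.integral_smul,
      circleIntegral.integral_fun_sum]
    · have hrot : ∀ m ∈ Finset.range n,
          ∮ w in C(0, r), Complex.exp (2 * Real.pi * Complex.I * m / n) •
            Ψ k (Complex.exp (2 * Real.pi * Complex.I * m / n) * w) = ∮ u in C(0, r), Ψ k u := by
        intro m _
        have := circleIntegral_rotate (Ψ k) r (2 * Real.pi * m / n)
        rw [show ((2 * Real.pi * m / n : ℝ) : ℂ) * Complex.I =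
          2 * Real.pi * Complex.I * m / n by push_cast; ring] at this
        exact this
      rw [Finset.sum_congr rfl hrot, Finset.sum_const, Finset.card_range,
        ← Nat.cast_smul_eq_nsmul ℂ, smul_smul, inv_mul_cancel₀ hn', one_smul]
    · intro m _
      refine ContinuousOn.circleIntegrable hr0.le (continuousOn_const.smul
        ((hΨc k).comp (by fun_prop) fun w hw => ?_))
      rw [mem_sphere_zero_iff_norm] at hw ⊢
      rw [norm_mul, hnorm, one_mul, hw]
  have hsum : Set.EqOn (fun u => f u • resolvent T u)
      (fun u => ∑ k ∈ Finset.range n, T ^ k * Ψ k u) (sphere 0 r) := by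
    intro u hu
    have hc : Commute T (algebraMap ℂ R u) := (Algebra.commutes u T).symm
    have h1 : (∑ k ∈ Finset.range n, T ^ k * algebraMap ℂ R u ^ (n - 1 - k)) *
        resolvent (T ^ n) (u ^ n) = resolvent T u := by
      have h2 := hc.mul_neg_geom_sum₂ n
      have h3 := sub_mul_resolvent (hdn.notMem_of_mem_left (hpow u hu))
      rw [map_pow] at h3
      rw [← one_mul (∑ k ∈ Finset.range n, T ^ k * algebraMap ℂ R u ^ (n - 1 - k)),
        ← resolvent_mul_sub (hd1.notMem_of_mem_left hu), mul_assoc (resolvent T u), h2, mul_assoc,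
        h3, mul_one]
    simp only [hΨ]
    rw [← h1, Finset.sum_mul, Finset.smul_sum]
    refine Finset.sum_congr rfl fun k _ => ?_
    rw [mul_smul, mul_smul_comm, mul_smul_comm, ← map_pow, mul_assoc, ← Algebra.smul_def,
      mul_smul_comm]
  rw [circleCalc, circleIntegral.integral_congr hr0.le hsum, circleIntegral.integral_fun_sum,
    Finset.smul_sum]
  · refine Finset.sum_congr rfl fun k hk => ?_
    rw [circleIntegral_mul_left _ ((hΨc k).circleIntegrable hr0.le), circleCalc,
      hpart k (Finset.mem_range.1 hk), mul_smul_comm]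
  · exact fun k _ => (continuousOn_const.mul (hΨc k)).circleIntegrable hr0.le

end PowerSplitting

/-! ### The von Neumann inequality for circle integrals -/

section VonNeumann

open Metric Filter

variable {H : Type*} [NormedAddCommGroup H] [InnerProductSpace ℂ H]

/-- Cauchy–Schwarz for the positive form `r² ⟪a, b⟫ - ⟪S a, S b⟫`. -/
lemma norm_defect_form_le {S : H →L[ℂ] H} {r : ℝ} (hS : ‖S‖ ≤ r) (a b : H) :
    ‖(r : ℂ) ^ 2 * inner ℂ a b - inner ℂ (S a) (S b)‖ ≤
      ((r ^ 2 * ‖a‖ ^ 2 - ‖S a‖ ^ 2) + (r ^ 2 * ‖b‖ ^ 2 - ‖S b‖ ^ 2)) / 2 := by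
  set F : ℂ := (r : ℂ) ^ 2 * inner ℂ a b - inner ℂ (S a) (S b) with hF
  obtain ⟨c, hc, hcF⟩ : ∃ c : ℂ, ‖c‖ = 1 ∧ c * F = ‖F‖ := by
    by_cases h : F = 0
    · exact ⟨1, by simp, by simp [h]⟩
    · have hn : (‖F‖ : ℂ) ≠ 0 := by simpa using h
      refine ⟨‖F‖ / F, by simp [h], div_mul_cancel₀ _ h⟩
  have h1 : ‖S (a - c • b)‖ ^ 2 ≤ r ^ 2 * ‖a - c • b‖ ^ 2 := by
    rw [← mul_pow]
    have := (S.le_opNorm (a - c • b)).trans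
      (mul_le_mul_of_nonneg_right hS (norm_nonneg (a - c • b)))
    gcongr
  have e1 : ‖a - c • b‖ ^ 2 = ‖a‖ ^ 2 - 2 * (c * inner ℂ a b).re + ‖b‖ ^ 2 := by
    rw [@norm_sub_sq ℂ, inner_smul_right, norm_smul, hc, one_mul]
    rfl
  have e2 : ‖S (a - c • b)‖ ^ 2 = ‖S a‖ ^ 2 - 2 * (c * inner ℂ (S a) (S b)).re + ‖S b‖ ^ 2 := by
    rw [map_sub, map_smul, @norm_sub_sq ℂ, inner_smul_right, norm_smul, hc, one_mul]
    rfl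
  have e3 : ‖F‖ = r ^ 2 * (c * inner ℂ a b).re - (c * inner ℂ (S a) (S b)).re := by
    have h2 : c * F = (r : ℂ) ^ 2 * (c * inner ℂ a b) - c * inner ℂ (S a) (S b) := by
      rw [hF]; ring
    have h3 := congrArg Complex.re (hcF.symm.trans h2)
    rw [Complex.ofReal_re, Complex.sub_re, ← Complex.ofReal_pow, Complex.re_ofReal_mul] at h3
    exact h3
  rw [e1, e2] at h1
  rw [e3]
  nlinarith [h1]

variable [CompleteSpace H]

open ContinuousLinearMap in
/-- The operator-valued Poisson kernel. -/
def poissonOp (T : H →L[ℂ] H) (v : ℂ) : H →L[ℂ] H :=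
  v • resolvent T v + resolvent (adjoint T) (starRingEnd ℂ v) * adjoint T

lemma notMem_spectrum_of_norm_lt {T : H →L[ℂ] H} {v : ℂ} (h : ‖T‖ < ‖v‖) :
    v ∉ spectrum ℂ T := fun hv => by
  have h1 := spectrum.norm_le_norm_mul_of_mem hv
  have h2 : ‖T‖ * ‖(1 : H →L[ℂ] H)‖ ≤ ‖T‖ * 1 := by
    gcongr
    exact ContinuousLinearMap.norm_id_le
  linarith

open ContinuousLinearMap in
lemma inner_poissonOp {T : H →L[ℂ] H} {v : ℂ} {r : ℝ} (hT : ‖T‖ < r) (hv : ‖v‖ = r) (x y : H) :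
    inner ℂ x (poissonOp T v y) =
      (r : ℂ) ^ 2 * inner ℂ (resolvent (adjoint T) (starRingEnd ℂ v) x)
          (resolvent (adjoint T) (starRingEnd ℂ v) y) -
        inner ℂ (adjoint T (resolvent (adjoint T) (starRingEnd ℂ v) x))
          (adjoint T (resolvent (adjoint T) (starRingEnd ℂ v) y)) := by
  set S := adjoint T with hS
  set u := starRingEnd ℂ v with hu
  set X := resolvent S u with hX
  have hSn : ‖S‖ = ‖T‖ := LinearIsometryEquiv.norm_map _ T
  have hTv : v ∉ spectrum ℂ T := notMem_spectrum_of_norm_lt (by rwa [hv])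
  have hSu : u ∉ spectrum ℂ S := notMem_spectrum_of_norm_lt (by rwa [hSn, hu, RCLike.norm_conj, hv])
  have huv : v * u = (r : ℂ) ^ 2 := by
    rw [hu, Complex.mul_conj, Complex.normSq_eq_norm_sq, hv]
    push_cast
    rfl
  have hXl : X * (algebraMap ℂ _ u - S) = 1 := resolvent_mul_sub hSu
  have hXr : (algebraMap ℂ _ u - S) * X = 1 := sub_mul_resolvent hSu
  have hXS : X * S = S * X := ((commute_resolvent (Commute.refl S) u).eq).symm
  have hadj : adjoint X = resolvent T v := by
    have h1 : adjoint (algebraMap ℂ (H →L[ℂ] H) u - S) = algebraMap ℂ _ v - T := by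
      rw [map_sub, hS, adjoint_adjoint, Algebra.algebraMap_eq_smul_one,
        Algebra.algebraMap_eq_smul_one, map_smulₛₗ, hu, starRingEnd_self_apply]
      congr 2
      exact adjoint_id
    have h2 : adjoint X * (algebraMap ℂ _ v - T) = 1 := by
      rw [← h1, mul_def, ← adjoint_comp, ← mul_def, hXr]
      exact adjoint_id
    calc adjoint X = adjoint X * ((algebraMap ℂ _ v - T) * resolvent T v) := by
          rw [sub_mul_resolvent hTv, mul_one]
      _ = resolvent T v := by rw [← mul_assoc, h2, one_mul]
  have hK : poissonOp T v = resolvent T v * ((r : ℂ) ^ 2 • 1 - T * S) * X := by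
    have h3 : (r : ℂ) ^ 2 • (1 : H →L[ℂ] H) - T * S =
        v • (algebraMap ℂ _ u - S) + (algebraMap ℂ _ v - T) * S := by
      rw [← huv, Algebra.algebraMap_eq_smul_one, Algebra.algebraMap_eq_smul_one, smul_sub,
        smul_smul, sub_mul, smul_mul_assoc, one_mul]
      abel
    rw [h3, mul_add, ← mul_assoc, resolvent_mul_sub hTv, one_mul, add_mul, mul_smul_comm,
      smul_mul_assoc, mul_assoc, hXr, mul_one, ← hXS]
    rfl
  rw [hK, ← hadj]
  simp only [mul_apply_eq_comp, sub_apply, smul_apply, one_apply_eq_self]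
  rw [adjoint_inner_right, inner_sub_right, inner_smul_right, hS, adjoint_inner_left]

lemma continuousOn_poissonOp {T : H →L[ℂ] H} {r : ℝ} (hT : ‖T‖ < r) :
    ContinuousOn (poissonOp T) (sphere 0 r) := by
  have hSn : ‖ContinuousLinearMap.adjoint T‖ = ‖T‖ := LinearIsometryEquiv.norm_map _ T
  refine ContinuousOn.add (continuousOn_id.smul (continuousOn_resolvent ?_))
    (ContinuousOn.mul (ContinuousOn.comp (g := resolvent (ContinuousLinearMap.adjoint T))
      (f := fun v => starRingEnd ℂ v) (t := sphere 0 r) (continuousOn_resolvent ?_)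
      Complex.continuous_conj.continuousOn ?_) continuousOn_const)
  · exact Set.disjoint_left.2 fun v hv => notMem_spectrum_of_norm_lt
      (by rwa [mem_sphere_zero_iff_norm.1 hv])
  · exact Set.disjoint_left.2 fun v hv => notMem_spectrum_of_norm_lt
      (by rwa [mem_sphere_zero_iff_norm.1 hv, hSn])
  · intro v hv
    rw [mem_sphere_zero_iff_norm] at hv ⊢
    rw [RCLike.norm_conj, hv]

/-- Poisson representation of `g(T)`. -/
lemma circleCalc_eq_integral_poissonOp {T : H →L[ℂ] H} {r : ℝ} (hT : ‖T‖ < r) {g : ℂ → ℂ}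
    (hg : DifferentiableOn ℂ g (closedBall 0 r)) :
    circleCalc T g r = (2 * Real.pi : ℂ)⁻¹ •
      ∫ θ in (0 : ℝ)..2 * Real.pi, g (circleMap 0 r θ) • poissonOp T (circleMap 0 r θ) := by
  set S := ContinuousLinearMap.adjoint T with hS
  have hr : 0 < r := (norm_nonneg T).trans_lt hT
  have hSn : ‖S‖ = ‖T‖ := LinearIsometryEquiv.norm_map _ T
  set Y : ℂ → (H →L[ℂ] H) := fun v => Ring.inverse ((r : ℂ) ^ 2 • 1 - v • S) with hY
  have hr2 : (r : ℂ) ^ 2 ≠ 0 := pow_ne_zero 2 (Complex.ofReal_ne_zero.2 hr.ne')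
  have hunit : ∀ v ∈ closedBall (0 : ℂ) r, IsUnit ((r : ℂ) ^ 2 • (1 : H →L[ℂ] H) - v • S) := by
    intro v hv
    have hv' : ‖v‖ ≤ r := by simpa using hv
    have h1 : ‖((r : ℂ) ^ 2)⁻¹ • v • S‖ < 1 := by
      rw [norm_smul, norm_smul, norm_inv, norm_pow, Complex.norm_of_nonneg hr.le, hSn,
        inv_mul_lt_one₀ (by positivity)]
      calc ‖v‖ * ‖T‖ ≤ r * ‖T‖ := by gcongr
        _ < r ^ 2 := by rw [pow_two]; gcongr
    have h2 := (isUnit_one_sub_of_norm_lt_one h1)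
    have h3 : (r : ℂ) ^ 2 • (1 : H →L[ℂ] H) - v • S =
        (Units.mk0 ((r : ℂ) ^ 2) hr2) • (1 - ((r : ℂ) ^ 2)⁻¹ • v • S) := by
      rw [Units.smul_mk0, smul_sub, smul_smul, mul_inv_cancel₀ hr2, one_smul]
    rw [h3]
    exact h2.smul _
  have hYd : ∀ v ∈ closedBall (0 : ℂ) r, DifferentiableAt ℂ Y v := by
    intro v hv
    obtain ⟨U, hU⟩ := hunit v hv
    have h1 : DifferentiableAt ℂ (fun v : ℂ => (r : ℂ) ^ 2 • (1 : H →L[ℂ] H) - v • S) v := by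
      fun_prop
    have h2 : DifferentiableAt ℂ (Ring.inverse : (H →L[ℂ] H) → _)
        ((r : ℂ) ^ 2 • (1 : H →L[ℂ] H) - v • S) := by
      rw [← hU]
      exact differentiableAt_inverse U.isUnit
    exact h2.comp v h1
  have hzero : ∮ v in C(0, r), g v • (Y v * S) = 0 := by
    refine Complex.circleIntegral_eq_zero_of_differentiable_on_off_countable hr.le
      Set.countable_empty ?_ ?_
    · exact hg.continuousOn.smul (ContinuousOn.mul
        (fun v hv => (hYd v hv).continuousAt.continuousWithinAt) continuousOn_const)
    · intro v hv
      refine DifferentiableAt.smul (hg.differentiableAt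
        (mem_of_superset (isOpen_ball.mem_nhds hv.1) ball_subset_closedBall)) ?_
      exact (hYd v (ball_subset_closedBall hv.1)).mul (differentiableAt_const _)
  have hdT : Disjoint (sphere (0 : ℂ) r) (spectrum ℂ T) := Set.disjoint_left.2 fun v hv =>
    notMem_spectrum_of_norm_lt (by rwa [mem_sphere_zero_iff_norm.1 hv])
  have hYX : ∀ v ∈ sphere (0 : ℂ) r, v • Y v = resolvent S (starRingEnd ℂ v) := by
    intro v hv
    have hvn : ‖v‖ = r := by simpa using hv
    have hSu : starRingEnd ℂ v ∉ spectrum ℂ S :=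
      notMem_spectrum_of_norm_lt (by rwa [hSn, RCLike.norm_conj, hvn])
    have huv : v * starRingEnd ℂ v = (r : ℂ) ^ 2 := by
      rw [Complex.mul_conj, Complex.normSq_eq_norm_sq, hvn]
      push_cast
      rfl
    have h1 : (r : ℂ) ^ 2 • (1 : H →L[ℂ] H) - v • S =
        v • (algebraMap ℂ _ (starRingEnd ℂ v) - S) := by
      rw [← huv, Algebra.algebraMap_eq_smul_one, smul_sub, smul_smul]
    have h2 := Ring.inverse_mul_cancel _ (hunit v (sphere_subset_closedBall hv))
    rw [h1, mul_smul_comm, ← smul_mul_assoc, ← h1] at h2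
    calc v • Y v = v • Y v * ((algebraMap ℂ _ (starRingEnd ℂ v) - S) *
          resolvent S (starRingEnd ℂ v)) := by rw [sub_mul_resolvent hSu, mul_one]
      _ = _ := by rw [← mul_assoc, h2, one_mul]
  have hint1 : CircleIntegrable (fun v => g v • resolvent T v) 0 r :=
    circleIntegrable_smul_resolvent hr.le (hg.continuousOn.mono sphere_subset_closedBall) hdT
  have hint2 : CircleIntegrable (fun v => g v • (Y v * S)) 0 r := by
    refine ContinuousOn.circleIntegrable hr.le (ContinuousOn.mono ?_ sphere_subset_closedBall)
    exact hg.continuousOn.smul (ContinuousOn.mul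
        (fun v hv => (hYd v hv).continuousAt.continuousWithinAt) continuousOn_const)
  have hmain : ∮ v in C(0, r), g v • resolvent T v =
      Complex.I • ∫ θ in (0 : ℝ)..2 * Real.pi,
        g (circleMap 0 r θ) • poissonOp T (circleMap 0 r θ) := by
    rw [← add_zero (∮ v in C(0, r), g v • resolvent T v), ← hzero,
      ← circleIntegral.integral_add hint1 hint2, circleIntegral,
      ← intervalIntegral.integral_smul]
    congr 1
    funext θ
    rw [deriv_circleMap, poissonOp, ← hYX _ (circleMap_mem_sphere 0 hr.le θ), smul_mul_assoc,
      ← smul_add, ← smul_add, smul_smul, smul_smul, smul_smul]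
    congr 1
    ring
  rw [circleCalc, hmain, smul_smul]
  congr 1
  rw [mul_inv, mul_assoc, inv_mul_cancel₀ Complex.I_ne_zero, mul_one]

/-- The **von Neumann inequality**. -/
theorem norm_circleCalc_le {T : H →L[ℂ] H} {r M : ℝ} (hT : ‖T‖ < r) {g : ℂ → ℂ}
    (hg : DifferentiableOn ℂ g (closedBall 0 r)) (hM0 : 0 ≤ M)
    (hM : ∀ v ∈ sphere (0 : ℂ) r, ‖g v‖ ≤ M) : ‖circleCalc T g r‖ ≤ M := by
  have hr : 0 < r := (norm_nonneg T).trans_lt hT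
  have hpi : (0 : ℝ) ≤ 2 * Real.pi := by positivity
  set κ : ℝ → (H →L[ℂ] H) := fun θ => poissonOp T (circleMap 0 r θ) with hκ
  have hκc : Continuous κ := (continuousOn_poissonOp hT).comp_continuous
    (continuous_circleMap 0 r) fun θ => circleMap_mem_sphere 0 hr.le θ
  have hgc : Continuous fun θ => g (circleMap 0 r θ) :=
    hg.continuousOn.comp_continuous (continuous_circleMap 0 r)
      fun θ => circleMap_mem_closedBall 0 hr.le θ
  have hrep : ∀ {h : ℂ → ℂ}, DifferentiableOn ℂ h (closedBall 0 r) → ∀ x y : H,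
      inner ℂ x (circleCalc T h r y) = (2 * Real.pi : ℂ)⁻¹ *
        ∫ θ in (0 : ℝ)..2 * Real.pi, h (circleMap 0 r θ) * inner ℂ x (κ θ y) := by
    intro h hh x y
    have hhc : Continuous fun θ => h (circleMap 0 r θ) :=
      hh.continuousOn.comp_continuous (continuous_circleMap 0 r)
        fun θ => circleMap_mem_closedBall 0 hr.le θ
    have := ((innerSL ℂ x).comp (ContinuousLinearMap.apply ℂ H y)).intervalIntegral_comp_comm
      ((hhc.smul hκc).intervalIntegrable (μ := MeasureTheory.volume) 0 (2 * Real.pi))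
    rw [circleCalc_eq_integral_poissonOp hT hh, smul_apply, inner_smul_right]
    congr 1
    simpa [inner_smul_right] using this.symm
  set D : H → ℝ → ℝ := fun x θ => (inner ℂ x (κ θ x)).re with hD
  have hDc : ∀ x, Continuous (D x) := fun x => Complex.continuous_re.comp
    (continuous_const.inner (hκc.clm_apply continuous_const))
  have hDint : ∀ x, ∫ θ in (0 : ℝ)..2 * Real.pi, D x θ = 2 * Real.pi * ‖x‖ ^ 2 := by
    intro x
    have h1 := hrep (differentiableOn_const (1 : ℂ)) x x
    rw [circleCalc_one hr (ρ := ‖T‖) (fun w hw => ?_) hT] at h1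
    · have hpi0 : (2 * Real.pi : ℂ) ≠ 0 := by simp [Real.pi_ne_zero]
      rw [one_apply_eq_self, inner_self_eq_norm_sq_to_K, eq_inv_mul_iff_mul_eq₀ hpi0] at h1
      simp only [one_mul] at h1
      have h2 := Complex.reCLM.intervalIntegral_comp_comm
        ((continuous_const.inner (hκc.clm_apply continuous_const) :
          Continuous fun θ => inner ℂ x (κ θ x)).intervalIntegrable
            (μ := MeasureTheory.volume) 0 (2 * Real.pi))
      simp only [Complex.reCLM_apply] at h2
      rw [hD]
      simp only
      rw [h2, ← h1]
      norm_cast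
      rw [Complex.re_ofReal_mul]
      rfl
    · by_contra! hlt
      exact notMem_spectrum_of_norm_lt hlt hw
  have hpt : ∀ x y θ, ‖inner ℂ x (κ θ y)‖ ≤ (D x θ + D y θ) / 2 := by
    intro x y θ
    have hv : ‖circleMap 0 r θ‖ = r := by simp [abs_of_pos hr]
    have hSn : ‖ContinuousLinearMap.adjoint T‖ = ‖T‖ := LinearIsometryEquiv.norm_map _ T
    have hDx : ∀ x, D x θ = r ^ 2 * ‖resolvent (ContinuousLinearMap.adjoint T)
          (starRingEnd ℂ (circleMap 0 r θ)) x‖ ^ 2 -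
        ‖ContinuousLinearMap.adjoint T (resolvent (ContinuousLinearMap.adjoint T)
          (starRingEnd ℂ (circleMap 0 r θ)) x)‖ ^ 2 := by
      intro x
      simp only [hD, hκ]
      rw [inner_poissonOp hT hv, inner_self_eq_norm_sq_to_K, inner_self_eq_norm_sq_to_K]
      norm_cast
      rw [Complex.sub_re, Complex.re_ofReal_mul]
      rfl
    rw [hDx, hDx, hκ, inner_poissonOp hT hv]
    exact norm_defect_form_le (by rw [hSn]; exact hT.le) _ _
  have hbound : ∀ x y, ‖inner ℂ x (circleCalc T g r y)‖ ≤ M * ((‖x‖ ^ 2 + ‖y‖ ^ 2) / 2) := by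
    intro x y
    rw [hrep hg, norm_mul]
    have h1 : ‖∫ θ in (0 : ℝ)..2 * Real.pi, g (circleMap 0 r θ) * inner ℂ x (κ θ y)‖ ≤
        ∫ θ in (0 : ℝ)..2 * Real.pi, M * ((D x θ + D y θ) / 2) := by
      refine intervalIntegral.norm_integral_le_of_norm_le hpi
        (Eventually.of_forall fun θ _ => ?_) ?_
      · rw [norm_mul]
        exact mul_le_mul (hM _ (circleMap_mem_sphere 0 hr.le θ)) (hpt x y θ) (norm_nonneg _) hM0
      · exact (continuous_const.mul (((hDc x).add (hDc y)).div_const 2)).intervalIntegrable _ _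
    have h2 : ∫ θ in (0 : ℝ)..2 * Real.pi, M * ((D x θ + D y θ) / 2) =
        M * ((2 * Real.pi * ‖x‖ ^ 2 + 2 * Real.pi * ‖y‖ ^ 2) / 2) := by
      rw [intervalIntegral.integral_const_mul, intervalIntegral.integral_div,
        intervalIntegral.integral_add ((hDc x).intervalIntegrable _ _)
          ((hDc y).intervalIntegrable _ _), hDint, hDint]
    rw [h2] at h1
    have h3 : ‖(2 * Real.pi : ℂ)⁻¹‖ = (2 * Real.pi)⁻¹ := by
      simp [abs_of_pos Real.pi_pos]
    rw [h3]
    calc _ ≤ (2 * Real.pi)⁻¹ * (M * ((2 * Real.pi * ‖x‖ ^ 2 + 2 * Real.pi * ‖y‖ ^ 2) / 2)) := by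
          gcongr
      _ = _ := by field_simp
  refine ContinuousLinearMap.opNorm_le_bound _ hM0 fun y => ?_
  set z := circleCalc T g r y with hz
  rcases eq_or_ne z 0 with h0 | h0
  · rw [h0, norm_zero]; positivity
  have hzn : 0 < ‖z‖ := norm_pos_iff.2 h0
  have hyn : 0 < ‖y‖ := by
    refine norm_pos_iff.2 fun h => h0 ?_
    rw [hz, h, map_zero]
  have h1 := hbound (((‖y‖ / ‖z‖ : ℝ) : ℂ) • z) y
  rw [← hz, inner_smul_left, norm_mul, RCLike.norm_conj, norm_smul, inner_self_eq_norm_sq_to_K,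
    Complex.norm_of_nonneg (by positivity), div_mul_cancel₀ _ hzn.ne', norm_pow,
    RCLike.norm_ofReal, abs_of_pos hzn] at h1
  have h2 : ‖y‖ / ‖z‖ * ‖z‖ ^ 2 = ‖y‖ * ‖z‖ := by field_simp
  rw [h2] at h1
  have h3 : ‖y‖ * ‖z‖ ≤ ‖y‖ * (M * ‖y‖) := by nlinarith [h1]
  exact le_of_mul_le_mul_left h3 hyn

end VonNeumann

/-! ### Uniform bounds for the functions of the multicentric representation -/

section Bound

open Metric Filter

variable {p : ℂ[X]}

lemma fiberTrace_eventuallyEq (hd : 0 < p.natDegree) (q : ℂ[X]) {φ φ' : ℂ → ℂ} {w₀ : ℂ}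
    (h : ∀ z, p.eval z = w₀ → φ =ᶠ[𝓝 z] φ') :
    fiberTrace p q φ =ᶠ[𝓝 w₀] fiberTrace p q φ' := by
  obtain ⟨m, hm, hlow⟩ := exists_pos_le_norm_eval_sub hd (w₀ := w₀)
    (O := interior {z | φ z = φ' z}) isOpen_interior
    (fun z hz => mem_interior_iff_mem_nhds.2 (h z hz))
  filter_upwards [ball_mem_nhds w₀ hm] with w hw
  refine Finset.sum_congr rfl fun ζ hζ => ?_
  have hζO : ζ ∈ interior {z | φ z = φ' z} := by
    by_contra hn
    have h1 := hlow ζ hn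
    rw [(mem_fiber hd).1 hζ, ← dist_eq_norm] at h1
    exact absurd hw (not_lt.2 h1)
  have heq : ζ ∈ {z | φ z = φ' z} := interior_subset hζO
  rw [show φ ζ = φ' ζ by simpa using heq]

lemma multicentricFun_eventuallyEq (hd : 0 < p.natDegree) (l : ℂ) {φ φ' : ℂ → ℂ} {w₀ : ℂ}
    (h : ∀ z, p.eval z = w₀ → φ =ᶠ[𝓝 z] φ') :
    multicentricFun p φ l =ᶠ[𝓝 w₀] multicentricFun p φ' l := by
  filter_upwards [(fiberTrace_eventuallyEq hd (diffQuot p l) h).eventually_nhds] with w hw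
  have hw' : fiberTrace p (diffQuot p l) φ =ᶠ[𝓝[≠] w] fiberTrace p (diffQuot p l) φ' :=
    mem_nhdsWithin_of_mem_nhds hw
  simp only [multicentricFun, traceExtension, limUnder, Filter.map_congr hw']

/-- Functions with a common germ at the centre are uniformly bounded on discs only slightly
larger than a given one. -/
lemma eventually_norm_le_of_germ (F : (ℂ → ℂ) → ℝ → Prop)
    (hF : ∀ f ρ, F f ρ → AnalyticOnNhd ℂ f (closedBall 0 ρ))
    (hgerm : ∀ f ρ f' ρ', F f ρ → F f' ρ' → f =ᶠ[𝓝 0] f') {μ : ℝ} (hμ : 0 ≤ μ) :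
    ∀ᶠ t : ℝ in atTop, ∀ f ρ, F f ρ → μ ≤ ρ → ρ ≤ μ + t⁻¹ →
      ∀ w ∈ closedBall (0 : ℂ) ρ, ‖f w‖ ≤ t := by
  by_cases hex : ∃ f₀ ρ₀, F f₀ ρ₀ ∧ μ ≤ ρ₀
  · obtain ⟨f₀, ρ₀, hf₀, hρ₀⟩ := hex
    have hsub : closedBall (0 : ℂ) μ ⊆ {z | AnalyticAt ℂ f₀ z} := fun z hz =>
      hF f₀ ρ₀ hf₀ z (closedBall_subset_closedBall hρ₀ hz)
    obtain ⟨ε, hε, hεsub⟩ := (isCompact_closedBall (0 : ℂ) μ).exists_cthickening_subset_open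
      (isOpen_analyticAt ℂ f₀) hsub
    rw [cthickening_closedBall hε.le hμ] at hεsub
    have hcont : ContinuousOn f₀ (closedBall 0 (ε + μ)) := fun z hz =>
      (hεsub hz).continuousAt.continuousWithinAt
    obtain ⟨B, hB⟩ := (isCompact_closedBall (0 : ℂ) (ε + μ)).exists_bound_of_continuousOn hcont
    have hev : ∀ᶠ t : ℝ in atTop, t⁻¹ < ε :=
      tendsto_inv_atTop_zero.eventually (gt_mem_nhds hε)
    filter_upwards [hev, eventually_ge_atTop B] with t ht hBt f ρ hf h1 h2 w hw
    have hle : ρ ≤ ε + μ := by linarith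
    have heq : Set.EqOn f f₀ (closedBall 0 ρ) :=
      (hF f ρ hf).eqOn_of_preconnected_of_eventuallyEq
        (fun z hz => hεsub (closedBall_subset_closedBall hle hz))
        (convex_closedBall (0 : ℂ) ρ).isPreconnected
        (mem_closedBall_self (hμ.trans h1)) (hgerm f ρ f₀ ρ₀ hf hf₀)
    rw [heq hw]
    exact (hB w (closedBall_subset_closedBall hle hw)).trans hBt
  · exact Eventually.of_forall fun t f ρ hf h1 => absurd ⟨f, ρ, hf, h1⟩ hex

lemma infDist_frontier_le_dist {V : Set ℂ} {z c : ℂ} (hz : z ∈ V) (hc : c ∉ V) :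
    infDist c (frontier V) ≤ dist c z := by
  obtain ⟨y, hy, hyd⟩ := exists_mem_frontier_infDist_compl_eq_dist (s := Vᶜ) hc
    (fun h => (h.symm ▸ Set.mem_univ z : z ∈ Vᶜ) hz)
  rw [frontier_compl] at hy
  rw [compl_compl] at hyd
  exact (infDist_le_dist_of_mem hy).trans (hyd ▸ infDist_le_dist_of_mem hz)

lemma exists_mem_roots (hd : 0 < p.natDegree) : ∃ l, l ∈ p.roots.toFinset := by
  obtain ⟨l, hl⟩ := IsAlgClosed.exists_root p (natDegree_pos_iff_degree_pos.1 hd).ne'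
  exact ⟨l, by simpa [hl.eq_zero] using ne_zero_of_natDegree_gt hd⟩

lemma eval_of_mem_roots {l : ℂ} (hl : l ∈ p.roots.toFinset) : p.eval l = 0 := by
  rw [Multiset.mem_toFinset] at hl
  exact (mem_roots'.1 hl).2

lemma isClosed_sublevel (p : ℂ[X]) (ρ : ℝ) : IsClosed {z | ‖p.eval z‖ ≤ ρ} :=
  isClosed_le p.continuous.norm continuous_const

lemma isCompact_sublevel (hd : 0 < p.natDegree) (ρ : ℝ) : IsCompact {z | ‖p.eval z‖ ≤ ρ} := by
  have := (isProperMap_eval hd).isCompact_preimage (isCompact_closedBall (0 : ℂ) ρ)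
  simpa [Set.preimage] using this

lemma exists_le_of_isOutsideCriticalDistance (hd : 0 < p.natDegree) :
    ∃ S > 0, ∀ ρ ≥ 0, ∀ s, IsOutsideCriticalDistance p {z | ‖p.eval z‖ ≤ ρ} s →
      0 < s ∧ s ≤ S := by
  obtain ⟨l, hl⟩ := exists_mem_roots hd
  refine ⟨1 + ∑ c ∈ (finite_critical hd).toFinset, dist c l, by positivity, fun ρ hρ s hs => ?_⟩
  obtain ⟨c, hc, hcV, rfl⟩ := hs.1
  have hlV : l ∈ {z | ‖p.eval z‖ ≤ ρ} := by simpa [eval_of_mem_roots hl] using hρ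
  constructor
  · have hne : (frontier {z | ‖p.eval z‖ ≤ ρ}).Nonempty :=
      nonempty_frontier_iff.2 ⟨⟨l, hlV⟩, fun h => hcV (h ▸ Set.mem_univ c)⟩
    exact (isClosed_frontier.notMem_iff_infDist_pos hne).1
      fun h => hcV ((isClosed_sublevel p ρ).frontier_subset h)
  · have h1 := infDist_frontier_le_dist hlV hcV
    have h2 : dist c l ≤ ∑ c ∈ (finite_critical hd).toFinset, dist c l :=
      Finset.single_le_sum (f := fun c => dist c l) (fun _ _ => dist_nonneg) (by simpa using hc)
    linarith

lemma norm_eval_derivative (p : ℂ[X]) (z : ℂ) :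
    ‖(derivative p).eval z‖ = ‖(derivative p).leadingCoeff‖ *
      ((derivative p).roots.map fun c => ‖z - c‖).prod := by
  rw [(IsAlgClosed.splits (derivative p)).eval_eq_prod_roots, norm_mul]
  congr 1
  induction (derivative p).roots using Multiset.induction with
  | empty => simp
  | cons a s ih => simp [ih]

lemma pow_card_le_prod_map {s : Multiset ℂ} {f : ℂ → ℝ} {a : ℝ} (ha : 0 ≤ a)
    (h : ∀ c ∈ s, a ≤ f c) : a ^ s.card ≤ (s.map f).prod := by
  induction s using Multiset.induction with
  | empty => simp
  | cons c s ih =>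
    rw [Multiset.card_cons, pow_succ', Multiset.map_cons, Multiset.prod_cons]
    have h1 := h c (Multiset.mem_cons_self c s)
    exact mul_le_mul h1 (ih fun c hc => h c (Multiset.mem_cons_of_mem hc)) (by positivity)
      (ha.trans h1)

/-- Levels not just above a critical level: the sum over the fibre is small enough. -/
lemma exists_bound_of_gap (hd : 0 < p.natDegree) {ε : ℝ} (hε : 0 < ε) (l : ℂ) :
    ∃ C, 0 ≤ C ∧ ∀ ρ ≥ 0, (∀ c, (derivative p).eval c = 0 → ‖p.eval c‖ ≤ ρ → ‖p.eval c‖ + ε < ρ) →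
      ∀ s, IsOutsideCriticalDistance p {z | ‖p.eval z‖ ≤ ρ} s → ∀ φ : ℂ → ℂ,
        (∀ z, ‖p.eval z‖ = ρ → ‖φ z‖ ≤ 1) → ∀ w, ‖w‖ = ρ → IsRegularValue p w ∧
          ‖fiberTrace p (diffQuot p l) φ w‖ ≤ C / s ^ (p.natDegree - 1) := by
  obtain ⟨S, hS, hsS⟩ := exists_le_of_isOutsideCriticalDistance hd
  set M := ∑ c ∈ (finite_critical hd).toFinset, ‖p.eval c‖
  have hMc : ∀ c, (derivative p).eval c = 0 → ‖p.eval c‖ ≤ M := fun c hc =>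
    Finset.single_le_sum (f := fun c => ‖p.eval c‖) (fun _ _ => norm_nonneg _) (by simpa using hc)
  obtain ⟨η, hη, hηu⟩ := Metric.uniformContinuousOn_iff.1
    ((isCompact_sublevel hd M).uniformContinuousOn_of_continuous p.continuous.continuousOn) ε hε
  obtain ⟨D, hD⟩ := (isCompact_sublevel hd M).exists_bound_of_continuousOn
    (diffQuot p l).continuous.continuousOn
  obtain ⟨l₀, hl₀⟩ := exists_mem_roots hd
  have hD0 : 0 ≤ D := (norm_nonneg _).trans (hD l₀ (by
    simpa [eval_of_mem_roots hl₀] using Finset.sum_nonneg fun _ _ => norm_nonneg _))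
  set κ := min 1 (η / S)
  have hκ : 0 < κ := lt_min one_pos (by positivity)
  set a := ‖(derivative p).leadingCoeff‖
  have hp' : derivative p ≠ 0 := fun h => by
    have := derivative_eq_zero.1 h
    omega
  have ha : 0 < a := norm_pos_iff.2 (leadingCoeff_ne_zero.2 hp')
  refine ⟨p.natDegree * (D / (a * κ ^ (p.natDegree - 1))), by positivity,
    fun ρ hρ hgap s hs φ hφ w hw => ?_⟩
  obtain ⟨hs0, hs1⟩ := hsS ρ hρ s hs
  have hreg : IsRegularValue p w := by
    intro ζ hζ h0
    have := hgap ζ h0 (by rw [hζ, hw])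
    rw [hζ, hw] at this
    linarith
  refine ⟨hreg, ?_⟩
  have hρM : ρ ≤ M := by
    obtain ⟨c, hc, hcV, -⟩ := hs.1
    exact (not_le.1 hcV).le.trans (hMc c hc)
  have hterm : ∀ ζ ∈ fiber p w, ‖(diffQuot p l).eval ζ / (derivative p).eval ζ * φ ζ‖ ≤
      D / (a * (κ * s) ^ (p.natDegree - 1)) := by
    intro ζ hζ
    have hζw : ‖p.eval ζ‖ = ρ := by rw [(mem_fiber hd).1 hζ, hw]
    have hζM : ζ ∈ {z | ‖p.eval z‖ ≤ M} := hζw.le.trans hρM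
    have hp'ζ : a * (κ * s) ^ (p.natDegree - 1) ≤ ‖(derivative p).eval ζ‖ := by
      rw [norm_eval_derivative]
      refine mul_le_mul_of_nonneg_left ?_ ha.le
      have hcard : (derivative p).roots.card = p.natDegree - 1 := by
        rw [← (IsAlgClosed.splits (derivative p)).natDegree_eq_card_roots,
          natDegree_derivative]
      rw [← hcard]
      refine pow_card_le_prod_map (by positivity) fun c hc => ?_
      have hc0 : (derivative p).eval c = 0 := (mem_roots'.1 hc).2
      by_cases hcV : ‖p.eval c‖ ≤ ρ
      · have h1 : η ≤ ‖ζ - c‖ := by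
          by_contra! hlt
          have := hηu ζ hζM c (hMc c hc0) (by rwa [dist_eq_norm])
          rw [dist_eq_norm] at this
          have h2 := hgap c hc0 hcV
          have h3 := norm_sub_norm_le (p.eval ζ) (p.eval c)
          rw [hζw] at h3
          linarith
        refine le_trans ?_ h1
        calc κ * s ≤ η / S * S := by
              gcongr
              exact min_le_right _ _
          _ = η := by field_simp
      · have h1 := infDist_frontier_le_dist (V := {z | ‖p.eval z‖ ≤ ρ}) hζw.le hcV
        have h2 := hs.2 ⟨c, hc0, hcV, rfl⟩
        rw [dist_comm, dist_eq_norm] at h1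
        calc κ * s ≤ 1 * s := by
              gcongr
              exact min_le_left _ _
          _ ≤ ‖ζ - c‖ := by linarith
    rw [norm_mul, norm_div]
    calc _ ≤ ‖(diffQuot p l).eval ζ‖ / ‖(derivative p).eval ζ‖ * 1 := by
          gcongr
          exact hφ ζ hζw
      _ ≤ _ := by
          rw [mul_one]
          gcongr
          exact hD ζ hζM
  calc ‖fiberTrace p (diffQuot p l) φ w‖ ≤
        ∑ ζ ∈ fiber p w, D / (a * (κ * s) ^ (p.natDegree - 1)) := norm_sum_le_of_le _ hterm
    _ = _ := by
        rw [Finset.sum_const, card_fiber hd hreg, nsmul_eq_mul, mul_pow]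
        field_simp

/-- The functions of the multicentric representation of a splitting are bounded by
`C / s ^ (d - 1)` on the circle, with a constant depending on `p` only. -/
lemma exists_bound_multicentricFun (hd : 0 < p.natDegree) :
    ∃ C > 0, ∀ ρ ≥ 0, ∀ r₀ > ρ, ∀ W W' φ, IsSplitting p r₀ W W' φ →
      ∀ s, IsOutsideCriticalDistance p {z | ‖p.eval z‖ ≤ ρ} s → 0 < s ∧
        ∀ l ∈ p.roots.toFinset, ∀ w, ‖w‖ = ρ →
          ‖multicentricFun p φ l w‖ ≤ C / s ^ (p.natDegree - 1) := by
  classical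
  obtain ⟨S, hS, hsS⟩ := exists_le_of_isOutsideCriticalDistance hd
  have hloc : ∀ l, ∀ Z : Finset ℂ, ∀ μ : ℝ, 0 ≤ μ → ∀ᶠ t : ℝ in atTop,
      ∀ f ρ, (0 ≤ ρ ∧ ∃ r₀ W W' φ, ρ < r₀ ∧ IsSplitting p r₀ W W' φ ∧
        (∀ z ∈ p.roots.toFinset, z ∈ W ↔ z ∈ Z) ∧ f = multicentricFun p φ l) →
      μ ≤ ρ → ρ ≤ μ + t⁻¹ → ∀ w ∈ closedBall (0 : ℂ) ρ, ‖f w‖ ≤ t := by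
    intro l Z μ hμ
    refine eventually_norm_le_of_germ _ ?_ ?_ hμ
    · rintro f ρ ⟨-, r₀, W, W', φ, hr, h, -, rfl⟩ w hw
      exact analyticAt_traceExtension hd h.differentiableOn (degree_diffQuot_lt hd l)
        (closedBall_subset_ball hr hw)
    · rintro f ρ f' ρ' ⟨hρ, r, W, W', φ, hr, h, hZ, rfl⟩ ⟨hρ', r', Y, Y', ψ, hr', h', hZ', rfl⟩
      refine multicentricFun_eventuallyEq hd l fun z hz => ?_
      have hz' : z ∈ p.roots.toFinset := by simpa [hz] using ne_zero_of_natDegree_gt hd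
      have hiff : z ∈ W ↔ z ∈ Y := (hZ z hz').trans (hZ' z hz').symm
      by_cases hW : z ∈ W
      · filter_upwards [h.isOpen_left.mem_nhds hW, h'.isOpen_left.mem_nhds (hiff.1 hW)] with x h1 h2
        rw [h.eq_one x h1, h'.eq_one x h2]
      · have hW' : z ∈ W' := (h.cover z (by rw [hz, norm_zero]; linarith)).resolve_left hW
        have hY' : z ∈ Y' := (h'.cover z (by rw [hz, norm_zero]; linarith)).resolve_left
          (fun hY => hW (hiff.2 hY))
        filter_upwards [h.isOpen_right.mem_nhds hW', h'.isOpen_right.mem_nhds hY'] with x h1 h2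
        rw [h.eq_zero x h1, h'.eq_zero x h2]
  have hall : ∀ᶠ t : ℝ in atTop, ∀ l ∈ p.roots.toFinset, ∀ Z ∈ p.roots.toFinset.powerset,
      ∀ μ ∈ insert 0 ((finite_critical hd).toFinset.image fun c => ‖p.eval c‖),
      ∀ f ρ, (0 ≤ ρ ∧ ∃ r₀ W W' φ, ρ < r₀ ∧ IsSplitting p r₀ W W' φ ∧
        (∀ z ∈ p.roots.toFinset, z ∈ W ↔ z ∈ Z) ∧ f = multicentricFun p φ l) →
      μ ≤ ρ → ρ ≤ μ + t⁻¹ → ∀ w ∈ closedBall (0 : ℂ) ρ, ‖f w‖ ≤ t := by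
    refine (eventually_all_finset _).2 fun l _ => (eventually_all_finset _).2 fun Z _ =>
      (eventually_all_finset _).2 fun μ hμ => hloc l Z μ ?_
    rcases Finset.mem_insert.1 hμ with rfl | hμ
    · exact le_rfl
    · obtain ⟨c, -, rfl⟩ := Finset.mem_image.1 hμ
      exact norm_nonneg _
  obtain ⟨t, ht, ht0⟩ := (hall.and (eventually_gt_atTop 0)).exists
  choose C hC0 hC using fun l => exists_bound_of_gap hd (inv_pos.2 ht0) l
  refine ⟨t * S ^ (p.natDegree - 1) + ∑ l ∈ p.roots.toFinset, C l,
    add_pos_of_pos_of_nonneg (by positivity) (Finset.sum_nonneg fun l _ => hC0 l),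
    fun ρ hρ r₀ hr W W' φ h s hs => ?_⟩
  obtain ⟨hs0, hs1⟩ := hsS ρ hρ s hs
  refine ⟨hs0, fun l hl w hw => ?_⟩
  by_cases hμ : ∃ μ ∈ insert 0 ((finite_critical hd).toFinset.image fun c => ‖p.eval c‖),
      μ ≤ ρ ∧ ρ ≤ μ + t⁻¹
  · obtain ⟨μ, hμ, h1, h2⟩ := hμ
    have := ht l hl (p.roots.toFinset.filter (· ∈ W)) (by simp) μ hμ
      (multicentricFun p φ l) ρ ⟨hρ, r₀, W, W', φ, hr, h, fun z hz => by
        rw [Finset.mem_filter]; exact ⟨fun hh => ⟨hz, hh⟩, fun hh => hh.2⟩, rfl⟩ h1 h2 w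
      (by simpa using hw.le)
    refine this.trans ((le_div_iff₀ (by positivity)).2 ?_)
    have h3 : t * s ^ (p.natDegree - 1) ≤ t * S ^ (p.natDegree - 1) := by gcongr
    linarith [Finset.sum_nonneg fun l (_ : l ∈ p.roots.toFinset) => hC0 l]
  · push Not at hμ
    obtain ⟨hreg, hb⟩ := hC l ρ hρ (fun c hc hcρ => hμ _ (Finset.mem_insert_of_mem
      (Finset.mem_image.2 ⟨c, by simpa using hc, rfl⟩)) hcρ) s hs φ (fun z hz => by
        rcases h.cover z (by rw [hz]; exact hr) with hz | hz
        · simp [h.eq_one z hz]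
        · simp [h.eq_zero z hz]) w hw
    rw [multicentricFun, traceExtension_eq hd h.differentiableOn (degree_diffQuot_lt hd l)
      (by rw [mem_ball_zero_iff, hw]; exact hr) hreg]
    refine hb.trans ?_
    gcongr
    have h1 : C l ≤ ∑ l ∈ p.roots.toFinset, C l := Finset.single_le_sum (fun l _ => hC0 l) hl
    have h2 : 0 ≤ t * S ^ (p.natDegree - 1) := by positivity
    linarith

end Bound

/-! ### Neighbourhoods of sublevel sets -/

section Sublevel

open Metric Filter

variable {p : ℂ[X]}

lemma eventually_forall_sublevel (hd : 0 < p.natDegree) {ρ : ℝ} (hρ : 0 ≤ ρ) {Q : ℂ → Prop}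
    (h : ∀ᶠ z in 𝓝ˢ {z | ‖p.eval z‖ ≤ ρ}, Q z) :
    ∀ᶠ r in 𝓝[>] ρ, ∀ z, ‖p.eval z‖ < r → Q z := by
  obtain ⟨O, hO, hVO, hOQ⟩ := mem_nhdsSet_iff_exists.1 h
  have hcl : IsClosed ((fun z => p.eval z) '' Oᶜ) :=
    (isProperMap_eval hd).isClosedMap _ hO.isClosed_compl
  have hsub : closedBall (0 : ℂ) ρ ⊆ ((fun z => p.eval z) '' Oᶜ)ᶜ := by
    rintro w hw ⟨z, hz, rfl⟩
    exact hz (hVO (by simpa using hw))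
  obtain ⟨ε, hε, hεsub⟩ := (isCompact_closedBall (0 : ℂ) ρ).exists_cthickening_subset_open
    hcl.isOpen_compl hsub
  rw [cthickening_closedBall hε.le hρ] at hεsub
  filter_upwards [Ioo_mem_nhdsGT (show ρ < ε + ρ by linarith)] with r hr z hz
  by_contra hn
  have hm : p.eval z ∈ closedBall (0 : ℂ) (ε + ρ) := by simpa using (hz.trans hr.2).le
  exact hεsub hm ⟨z, fun hzO => hn (hOQ hzO), rfl⟩

lemma eventually_forall_ball {ρ : ℝ} (hρ : 0 ≤ ρ) {Q : ℂ → Prop}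
    (h : ∀ᶠ w in 𝓝ˢ (closedBall (0 : ℂ) ρ), Q w) : ∀ᶠ r in 𝓝[>] ρ, ∀ w ∈ ball (0 : ℂ) r, Q w := by
  have := eventually_forall_sublevel (p := X) (by simp) hρ (Q := Q) (by
    have heq : {z : ℂ | ‖(X : ℂ[X]).eval z‖ ≤ ρ} = closedBall 0 ρ := by ext; simp
    rwa [heq])
  simpa using this

lemma eventually_differentiableOn_ball {ρ : ℝ} (hρ : 0 ≤ ρ) {f : ℂ → ℂ}
    (hf : AnalyticOnNhd ℂ f (closedBall 0 ρ)) :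
    ∀ᶠ r in 𝓝[>] ρ, DifferentiableOn ℂ f (ball 0 r) := by
  have : ∀ᶠ w in 𝓝ˢ (closedBall (0 : ℂ) ρ), AnalyticAt ℂ f w :=
    eventually_nhdsSet_iff_forall.2 fun w hw => (hf w hw).eventually_analyticAt
  filter_upwards [eventually_forall_ball hρ this] with r hr w hw
  exact (hr w hw).differentiableAt.differentiableWithinAt

lemma exists_regular_radius_of_eventually (hd : 0 < p.natDegree) {ρ : ℝ} {Q : ℝ → Prop}
    (h : ∀ᶠ r in 𝓝[>] ρ, Q r) :
    ∃ r R, ρ < r ∧ r < R ∧ Q R ∧ ∀ w : ℂ, ‖w‖ = r → IsRegularValue p w := by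
  obtain ⟨R, hR, hρR⟩ := (h.and self_mem_nhdsWithin).exists
  obtain ⟨r, hr, hreg⟩ := exists_regular_radius hd (show ρ < R from hρR)
  exact ⟨r, R, hr.1, hr.2, hR, hreg⟩

lemma tendsto_pow_nhdsGT {ρ : ℝ} (hρ : 0 ≤ ρ) {n : ℕ} (hn : n ≠ 0) :
    Tendsto (fun r : ℝ => r ^ n) (𝓝[>] ρ) (𝓝[>] (ρ ^ n)) := by
  refine tendsto_nhdsWithin_iff.2 ⟨((continuous_pow n).tendsto ρ).mono_left nhdsWithin_le_nhds, ?_⟩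
  filter_upwards [self_mem_nhdsWithin] with r hr
  exact pow_lt_pow_left₀ hr hρ hn

/-- A function equal to `1` near a component and to `0` near the rest of a sublevel set comes
from a splitting of a slightly larger sublevel set. -/
lemma exists_isSplitting (hd : 0 < p.natDegree) {ρ : ℝ} (hρ : 0 ≤ ρ) {K : Set ℂ} {φ : ℂ → ℂ}
    (hφ1 : ∀ᶠ z in 𝓝ˢ K, φ z = 1) (hφ0 : ∀ᶠ z in 𝓝ˢ ({z | ‖p.eval z‖ ≤ ρ} \ K), φ z = 0) :
    ∃ r₀ W W', ρ < r₀ ∧ IsSplitting p r₀ W W' φ ∧ K ⊆ W ∧ {z | ‖p.eval z‖ ≤ ρ} \ K ⊆ W' := by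
  obtain ⟨W, hW, hKW, hW1⟩ := mem_nhdsSet_iff_exists.1 hφ1
  obtain ⟨W', hW', hKW', hW0⟩ := mem_nhdsSet_iff_exists.1 hφ0
  have hcov : ∀ᶠ z in 𝓝ˢ {z | ‖p.eval z‖ ≤ ρ}, z ∈ W ∪ W' := by
    refine (hW.union hW').mem_nhdsSet.2 fun z hz => ?_
    by_cases hK : z ∈ K
    · exact Or.inl (hKW hK)
    · exact Or.inr (hKW' ⟨hz, hK⟩)
  obtain ⟨r₀, hr₀, hρr⟩ := ((eventually_forall_sublevel hd hρ hcov).and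
    self_mem_nhdsWithin).exists
  refine ⟨r₀, W, W', hρr, ⟨hW, hW', ?_, hr₀, fun z hz => hW1 hz, fun z hz => hW0 hz⟩, hKW, hKW'⟩
  refine Set.disjoint_left.2 fun z hz hz' => one_ne_zero (α := ℂ) ?_
  rw [← show φ z = 1 from hW1 hz, show φ z = 0 from hW0 hz']

/-- The multicentric representation of a splitting. -/
lemma IsSplitting.isMulticentricFamily {r₀ ρ : ℝ} {W W' : Set ℂ} {φ : ℂ → ℂ}
    (h : IsSplitting p r₀ W W' φ) (hd : 0 < p.natDegree) (hp : p.roots.Nodup) (hr₀ : ρ < r₀) :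
    IsMulticentricFamily p φ {z | ‖p.eval z‖ ≤ ρ} ρ (multicentricFun p φ) where
  analytic := fun l _ w hw => analyticAt_traceExtension hd h.differentiableOn
    (degree_diffQuot_lt hd l) (closedBall_subset_ball hr₀ hw)
  representation := by
    have hO : {z | ‖p.eval z‖ < r₀} ∈ 𝓝ˢ {z | ‖p.eval z‖ ≤ ρ} :=
      (isOpen_lt p.continuous.norm continuous_const).mem_nhdsSet.2 fun z hz => lt_of_le_of_lt hz hr₀
    filter_upwards [hO] with z hz
    exact (sum_rootBasis_mul_multicentricFun hd hp h.differentiableOn hz).symm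
  formula := fun l hl w hw hw0 hreg => by
    rw [multicentricValue_eq_fiberTrace hd hl hw0, multicentricFun,
      traceExtension_eq hd h.differentiableOn (degree_diffQuot_lt hd l)
        (closedBall_subset_ball hr₀ hw) hreg]

lemma exists_isPowerSplitting {f : ℂ → ℂ → ℂ} {n : ℕ} (hn : n ≠ 0) {ρ : ℝ} (hρ : 0 ≤ ρ)
    (hf : ∀ l ∈ p.roots.toFinset, AnalyticOnNhd ℂ (f l) (closedBall 0 ρ)) :
    ∃ g, IsPowerSplitting p n ρ f g := by
  have hex : ∀ l k, ∃ g : ℂ → ℂ, l ∈ p.roots.toFinset → k < n →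
      AnalyticOnNhd ℂ g (closedBall 0 (ρ ^ n)) ∧ ∀ᶠ w in 𝓝ˢ (closedBall (0 : ℂ) ρ),
        w ^ k * g (w ^ n) = (n : ℂ)⁻¹ * ∑ m ∈ Finset.range n,
          Complex.exp (-(2 * Real.pi * Complex.I * m * k / n)) *
            f l (Complex.exp (2 * Real.pi * Complex.I * m / n) * w) := by
    intro l k
    by_cases hlk : l ∈ p.roots.toFinset ∧ k < n
    · obtain ⟨r, hr, hρr⟩ := ((eventually_differentiableOn_ball hρ (hf l hlk.1)).and
        self_mem_nhdsWithin).exists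
      have hρr' : ρ < r := hρr
      obtain ⟨g, hg, hgf⟩ := exists_power_part (hρ.trans_lt hρr') hr hn hlk.2
      refine ⟨g, fun _ _ => ⟨(hg.analyticOnNhd isOpen_ball).mono
        (closedBall_subset_ball (pow_lt_pow_left₀ hρr' hρ hn)), ?_⟩⟩
      filter_upwards [isOpen_ball.mem_nhdsSet.2 (closedBall_subset_ball hρr')] with w hw
      exact hgf w hw
    · exact ⟨0, fun h1 h2 => absurd ⟨h1, h2⟩ hlk⟩
  choose g hg using hex
  exact ⟨g, fun l hl k hk => (hg l k hl hk).1, fun l hl k hk => (hg l k hl hk).2⟩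

/-- The parts `wᵏ gₖ(wⁿ)` of `f` are bounded by `sup |f|`. -/
lemma norm_power_part_le {f g : ℂ → ℂ} {n k : ℕ} (hn : n ≠ 0) {ρ M : ℝ} (hρ : 0 ≤ ρ)
    (hk : ρ = 0 → k = 0) (hg : AnalyticOnNhd ℂ g (closedBall 0 (ρ ^ n)))
    (hf : ∀ w, ‖w‖ = ρ → ‖f w‖ ≤ M)
    (hfg : ∀ w ∈ closedBall (0 : ℂ) ρ, w ^ k * g (w ^ n) = (n : ℂ)⁻¹ * ∑ m ∈ Finset.range n,
      Complex.exp (-(2 * Real.pi * Complex.I * m * k / n)) *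
        f (Complex.exp (2 * Real.pi * Complex.I * m / n) * w)) :
    ∀ v ∈ closedBall (0 : ℂ) (ρ ^ n), ‖g v‖ ≤ M / ρ ^ k := by
  have hρk : 0 < ρ ^ k := by
    rcases hρ.eq_or_lt with h0 | h0
    · simp [hk h0.symm]
    · positivity
  have hnorm : ∀ x : ℝ, ‖Complex.exp (x * Complex.I)‖ = 1 := Complex.norm_exp_ofReal_mul_I
  have hsph : ∀ v : ℂ, ‖v‖ = ρ ^ n → ‖g v‖ ≤ M / ρ ^ k := by
    intro v hv
    obtain ⟨w, rfl⟩ := IsAlgClosed.exists_pow_nat_eq v (Nat.pos_of_ne_zero hn)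
    rw [norm_pow] at hv
    have hw : ‖w‖ = ρ := (pow_left_inj₀ (norm_nonneg w) hρ hn).1 hv
    have h1 := congrArg norm (hfg w (by simp [hw]))
    rw [norm_mul, norm_pow, hw] at h1
    rw [le_div_iff₀' hρk, h1, norm_mul, norm_inv, Complex.norm_natCast]
    have h2 : ‖∑ m ∈ Finset.range n, Complex.exp (-(2 * Real.pi * Complex.I * m * k / n)) *
        f (Complex.exp (2 * Real.pi * Complex.I * m / n) * w)‖ ≤ ∑ m ∈ Finset.range n, M := by
      refine norm_sum_le_of_le _ fun m _ => ?_
      have e1 : -(2 * Real.pi * Complex.I * m * k / n) =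
          ((-(2 * Real.pi * m * k / n) : ℝ) : ℂ) * Complex.I := by push_cast; ring
      have e2 : 2 * Real.pi * Complex.I * m / n =
          ((2 * Real.pi * m / n : ℝ) : ℂ) * Complex.I := by push_cast; ring
      rw [norm_mul, e1, hnorm, one_mul]
      exact hf _ (by rw [norm_mul, e2, hnorm, one_mul, hw])
    rw [Finset.sum_const, Finset.card_range, nsmul_eq_mul] at h2
    have hn' : (0 : ℝ) < n := by exact_mod_cast Nat.pos_of_ne_zero hn
    rw [inv_mul_le_iff₀ hn']
    exact h2
  rcases hρ.eq_or_lt with h0 | h0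
  · intro v hv
    refine hsph v ?_
    rw [← h0, zero_pow hn] at hv ⊢
    simpa using hv
  · intro v hv
    have hR : ρ ^ n ≠ 0 := by positivity
    refine Complex.norm_le_of_forall_mem_frontier_norm_le (U := ball 0 (ρ ^ n)) isBounded_ball
      ⟨?_, ?_⟩ (fun z hz => hsph z ?_) ?_
    · exact fun z hz => (hg z (ball_subset_closedBall hz)).differentiableAt.differentiableWithinAt
    · rw [closure_ball 0 hR]
      exact fun z hz => (hg z hz).continuousAt.continuousWithinAt
    · rw [frontier_ball 0 hR] at hz
      simpa using hz
    · rwa [closure_ball 0 hR]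

end Sublevel

/-! ### The functional calculus on lemniscate sets -/

section Calculus

open Metric Filter IsSplitting

variable {H : Type*} [NormedAddCommGroup H] [InnerProductSpace ℂ H] [CompleteSpace H]
  {p : ℂ[X]}

lemma norm_le_of_mem_spectrum {T : H →L[ℂ] H} {v : ℂ} (hv : v ∈ spectrum ℂ T) : ‖v‖ ≤ ‖T‖ := by
  by_contra! h
  exact notMem_spectrum_of_norm_lt h hv

lemma isHolomorphicCalculus_integral (hd : 0 < p.natDegree) (hp : p.roots.Nodup)
    {A : H →L[ℂ] H} {φ : ℂ → ℂ} {r r₀ : ℝ} (hr : 0 < r) (hr₀ : r < r₀)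
    (hreg : ∀ w : ℂ, ‖w‖ = r → IsRegularValue p w) {Γ : PlaneCycle}
    (hΓ : IsFiberCycle p r Set.univ Γ) (hA : ∀ z ∈ spectrum ℂ A, ‖p.eval z‖ < r)
    (hφ : DifferentiableOn ℂ φ {z | ‖p.eval z‖ < r₀}) :
    IsHolomorphicCalculus A φ
      ((2 * Real.pi * Complex.I : ℂ)⁻¹ • Γ.integral fun z => φ z • resolvent A z) := by
  have hidx := fun a ha => (IsSplitting.univ p r₀).index_eq hd hp hr hr₀ hreg hΓ (a := a) ha
  refine ⟨{z | ‖p.eval z‖ < r₀}, isOpen_lt p.continuous.norm continuous_const,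
    fun z hz => (hA z hz).trans hr₀, hφ, Γ, fun z hz => ?_, fun a ha => ?_, fun a ha => ?_, rfl⟩
  · have hz' : ‖p.eval z‖ = r := by simpa using hΓ.support_subset hr.le hz
    exact ⟨hz'.trans_lt hr₀, fun h => (hA z h).ne hz'⟩
  · rw [hidx a (hA a ha).ne, if_pos (hA a ha)]
  · have ha' : r < ‖p.eval a‖ := hr₀.trans_le (by simpa using ha)
    rw [hidx a ha'.ne', if_neg ha'.not_gt]

lemma isHolomorphicCalculus_circleCalc {T : H →L[ℂ] H} {g : ℂ → ℂ} {r r₀ : ℝ} (hr : 0 < r)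
    (hr₀ : r < r₀) (hT : ∀ v ∈ spectrum ℂ T, ‖v‖ < r) (hg : DifferentiableOn ℂ g (ball 0 r₀)) :
    IsHolomorphicCalculus T g (circleCalc T g r) := by
  have hd : 0 < (X : ℂ[X]).natDegree := by simp
  have hp : (X : ℂ[X]).roots.Nodup := by simp
  have hreg : ∀ w : ℂ, ‖w‖ = r → IsRegularValue X w := fun w _ ζ _ => by simp
  have hset : {z : ℂ | ‖(X : ℂ[X]).eval z‖ < r₀} = ball 0 r₀ := by ext; simp
  obtain ⟨Γ, hΓ⟩ := (IsSplitting.univ X r₀).exists_cycle hd hr hr₀ hreg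
  have h1 := isHolomorphicCalculus_integral (φ := g) hd hp hr hr₀ hreg hΓ (A := T)
    (by simpa using hT) (by rwa [hset])
  have hgc : ContinuousOn g (sphere 0 r) :=
    hg.continuousOn.mono (sphere_subset_closedBall.trans (closedBall_subset_ball hr₀))
  have hdisj : Disjoint (sphere (0 : ℂ) r) (spectrum ℂ T) :=
    Set.disjoint_left.2 fun z hz hzT => (hT z hzT).ne (by simpa using hz)
  have hsph : {z : ℂ | ‖(X : ℂ[X]).eval z‖ = r} = sphere 0 r := by ext; simp
  have h2 := IsSplitting.integral_smul_resolvent (φ := g) hd hp hr hreg hΓ (f := fun _ => g)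
    (fun _ _ => hgc) (by rwa [hsph]) (fun z _ => by simp [rootBasis]) (a := T) (by simpa using hdisj)
  rw [h2] at h1
  simpa [rootBasis] using h1

/-- The von Neumann inequality for functions holomorphic near the closed disc. -/
lemma norm_circleCalc_le_of_closedBall {T : H →L[ℂ] H} {ρ M r r₀ : ℝ} {g : ℂ → ℂ}
    (hT : ‖T‖ ≤ ρ) (hg : DifferentiableOn ℂ g (ball 0 r₀)) (hr : ρ < r) (hr₀ : r < r₀)
    (hM0 : 0 ≤ M) (hM : ∀ v ∈ closedBall (0 : ℂ) ρ, ‖g v‖ ≤ M) : ‖circleCalc T g r‖ ≤ M := by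
  have hρ : 0 ≤ ρ := (norm_nonneg T).trans hT
  refine le_of_forall_pos_le_add fun ε hε => ?_
  have hev : ∀ᶠ v in 𝓝ˢ (closedBall (0 : ℂ) ρ), ‖g v‖ < M + ε :=
    eventually_nhdsSet_iff_forall.2 fun v hv => by
      have hc : ContinuousAt g v := (hg.differentiableAt (isOpen_ball.mem_nhds
        (closedBall_subset_ball (hr.trans hr₀) hv))).continuousAt
      exact hc.norm.eventually_lt_const (by linarith [hM v hv])
  obtain ⟨r₂, hr₂, hρr₂⟩ := ((eventually_forall_ball hρ hev).and
    (Ioo_mem_nhdsGT hr)).exists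
  obtain ⟨r₁, hr₁⟩ := exists_between hρr₂.1
  rw [circleCalc_congr_radius (hρ.trans_lt hr₁.1) hg
    (fun w hw => (norm_le_of_mem_spectrum hw).trans hT) hr₁.1 (hr₁.2.trans hρr₂.2).le hr₀]
  refine norm_circleCalc_le (hT.trans_lt hr₁.1) (hg.mono (closedBall_subset_ball
    ((hr₁.2.trans hρr₂.2).trans hr₀))) (by linarith) fun v hv => ?_
  exact (hr₂ v (closedBall_subset_ball hr₁.2 (sphere_subset_closedBall hv))).le

/-- The spectral projection in terms of the functions of any multicentric representation. -/
lemma IsSplitting.proj_eq_sum_pow {r₀ ρ r : ℝ} {W W' : Set ℂ} {φ : ℂ → ℂ} {Γ : PlaneCycle}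
    {A : H →L[ℂ] H} (h : IsSplitting p r₀ W W' φ) (hd : 0 < p.natDegree) (hp : p.roots.Nodup)
    (hρ : 0 ≤ ρ) (hρr : ρ < r) (hr₀ : r < r₀) (hreg : ∀ w : ℂ, ‖w‖ = r → IsRegularValue p w)
    (hΓ : IsFiberCycle p r W Γ) {n : ℕ} (hn : n ≠ 0) (hT : ‖aeval A p ^ n‖ ≤ ρ ^ n)
    {f : ℂ → ℂ → ℂ} {g : ℂ → ℕ → ℂ → ℂ}
    (hf : IsMulticentricFamily p φ {z | ‖p.eval z‖ ≤ ρ} ρ f) (hg : IsPowerSplitting p n ρ f g) :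
    ∃ r₁ r₂, ρ ^ n < r₁ ∧ r₁ < r₂ ∧ (∀ l ∈ p.roots.toFinset, ∀ k < n,
      DifferentiableOn ℂ (g l k) (ball 0 r₂)) ∧
      proj Γ A = ∑ l ∈ p.roots.toFinset, aeval A (rootBasis p l) *
        ∑ k ∈ Finset.range n, aeval A p ^ k * circleCalc (aeval A p ^ n) (g l k) r₁ := by
  have hTn : ∀ v ∈ spectrum ℂ (aeval A p ^ n), ‖v‖ ≤ ρ ^ n := fun v hv =>
    (norm_le_of_mem_spectrum hv).trans hT
  have hT1 := norm_le_of_mem_spectrum_of_pow hn hρ hTn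
  have hev : ∀ᶠ R in 𝓝[>] ρ, R < r ∧
      (∀ l ∈ p.roots.toFinset, DifferentiableOn ℂ (f l) (ball 0 R)) ∧
      (∀ z, ‖p.eval z‖ < R →
        φ z = ∑ l ∈ p.roots.toFinset, (rootBasis p l).eval z * f l (p.eval z)) ∧
      ∀ l ∈ p.roots.toFinset, ∀ k ∈ Finset.range n,
        DifferentiableOn ℂ (g l k) (ball 0 (R ^ n)) ∧
        ∀ w ∈ ball (0 : ℂ) R, w ^ k * g l k (w ^ n) = (n : ℂ)⁻¹ * ∑ m ∈ Finset.range n,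
          Complex.exp (-(2 * Real.pi * Complex.I * m * k / n)) *
            f l (Complex.exp (2 * Real.pi * Complex.I * m / n) * w) := by
    refine Eventually.and ?_ (Eventually.and ?_ (Eventually.and ?_ ?_))
    · filter_upwards [Ioo_mem_nhdsGT hρr] with R hR using hR.2
    · exact (eventually_all_finset _).2 fun l hl =>
        eventually_differentiableOn_ball hρ (hf.analytic l hl)
    · exact eventually_forall_sublevel hd hρ hf.representation
    · refine (eventually_all_finset _).2 fun l hl => (eventually_all_finset _).2 fun k hk => ?_
      have hk' := Finset.mem_range.1 hk
      exact ((tendsto_pow_nhdsGT hρ hn).eventually (eventually_differentiableOn_ball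
        (by positivity) (hg.analytic l hl k hk'))).and
          (eventually_forall_ball hρ (hg.formula l hl k hk'))
  obtain ⟨r', R, hρr', hr'R, ⟨hRr, hfd, hrep, hgd⟩, hreg'⟩ :=
    exists_regular_radius_of_eventually hd hev
  have hr'0 : 0 < r' := hρ.trans_lt hρr'
  have hdisj := disjoint_sphere_spectrum hT1 hρr
  have hdisj' := disjoint_sphere_spectrum hT1 hρr'
  have hr'r : r' < r := hr'R.trans hRr
  have hsub : sphere (0 : ℂ) r' ⊆ ball 0 R :=
    sphere_subset_closedBall.trans (closedBall_subset_ball hr'R)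
  have hsub₀ : sphere (0 : ℂ) r' ⊆ ball 0 r₀ :=
    sphere_subset_closedBall.trans (closedBall_subset_ball (hr'r.trans hr₀))
  have hpow : r' ^ n < R ^ n := pow_lt_pow_left₀ hr'R hr'0.le hn
  refine ⟨r' ^ n, R ^ n, pow_lt_pow_left₀ hρr' hρ hn, hpow,
    fun l hl k hk => (hgd l hl k (Finset.mem_range.2 hk)).1, ?_⟩
  have e1 := circleIntegral_fiber_resolvent hd hp A hr'0.le hreg' hdisj' (φ := φ) (f := f)
    (fun l hl => (hfd l hl).continuousOn.mono hsub) (fun z hz => hrep z (hz.trans_lt hr'R))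
  have e2 := circleIntegral_fiber_resolvent hd hp A hr'0.le hreg' hdisj' (φ := φ)
    (f := multicentricFun p φ)
    (fun l _ => (h.differentiableOn_multicentricFun hd l).continuousOn.mono hsub₀)
    (fun z hz => (sum_rootBasis_mul_multicentricFun hd hp h.differentiableOn
      (hz.trans_lt (hr'r.trans hr₀))).symm)
  rw [proj, h.integral_resolvent hd hp (hρ.trans_lt hρr) hr₀ hreg hΓ hdisj]
  simp only [circleCalc_congr_radius hr'0 (h.differentiableOn_multicentricFun hd _) hT1 hρr'
    hr'r.le hr₀]
  rw [← e2, e1]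
  refine Finset.sum_congr rfl fun l hl => ?_
  rw [circleCalc_eq_sum_pow hn hρ hρr' hTn ((hfd l hl).continuousOn.mono hsub) (g := g l)]
  · intro k hk
    exact (hgd l hl k (Finset.mem_range.2 hk)).1.continuousOn.mono
      (sphere_subset_closedBall.trans (closedBall_subset_ball hpow))
  · intro k hk w hw
    exact (hgd l hl k (Finset.mem_range.2 hk)).2 w (hsub hw)

end Calculus

/-! ### Lemniscate sets of operators -/

section Lemniscate

open Metric Filter IsSplitting

variable {H : Type*} [NormedAddCommGroup H] [InnerProductSpace ℂ H] {p : ℂ[X]} {n : ℕ}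

lemma lemniscateLevel_nonneg (p : ℂ[X]) (n : ℕ) (A : H →L[ℂ] H) : 0 ≤ lemniscateLevel p n A :=
  Real.rpow_nonneg (norm_nonneg _) _

lemma lemniscateLevel_pow (hn : n ≠ 0) (A : H →L[ℂ] H) :
    lemniscateLevel p n A ^ n = ‖aeval A p ^ n‖ := by
  rw [lemniscateLevel, one_div, Real.rpow_inv_natCast_pow (norm_nonneg _) hn]

lemma lemniscateSet_eq (hn : n ≠ 0) (A : H →L[ℂ] H) :
    lemniscateSet p n A = {z | ‖p.eval z‖ ≤ lemniscateLevel p n A} := by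
  ext z
  change ‖p.eval z ^ n‖ ≤ ‖aeval A p ^ n‖ ↔ ‖p.eval z‖ ≤ lemniscateLevel p n A
  rw [← lemniscateLevel_pow hn, norm_pow,
    pow_le_pow_iff_left₀ (norm_nonneg _) (lemniscateLevel_nonneg p n A) hn]

lemma natDegree_pos_of_nontrivial_componentsOf {A : H →L[ℂ] H}
    (hV : (componentsOf (lemniscateSet p n A)).Nontrivial) : 0 < p.natDegree := by
  by_contra hd
  obtain ⟨a, rfl⟩ : ∃ a, p = C a := ⟨_, eq_C_of_natDegree_eq_zero (by omega)⟩
  obtain ⟨_, ⟨x, hx, rfl⟩, _, ⟨y, hy, rfl⟩, hne⟩ := hV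
  have huniv : lemniscateSet (C a) n A = Set.univ := by
    refine Set.eq_univ_of_forall fun z => ?_
    have hx' : ‖(C a).eval x ^ n‖ ≤ ‖aeval A (C a) ^ n‖ := hx
    change ‖(C a).eval z ^ n‖ ≤ ‖aeval A (C a) ^ n‖
    simpa using hx'
  rw [huniv, connectedComponentIn_univ, connectedComponentIn_univ,
    PreconnectedSpace.connectedComponent_eq_univ, PreconnectedSpace.connectedComponent_eq_univ] at hne
  exact hne rfl

lemma IsSplitting.one_le_iSup_norm {r₀ : ℝ} {W W' V : Set ℂ} {φ : ℂ → ℂ}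
    (h : IsSplitting p r₀ W W' φ) (hV : ∀ z ∈ V, ‖p.eval z‖ < r₀) {x : ℂ} (hx : x ∈ V)
    (hxW : x ∈ W) : 1 ≤ ⨆ z : V, ‖φ z‖ := by
  have hbdd : BddAbove (Set.range fun z : V => ‖φ z‖) := by
    refine ⟨1, ?_⟩
    rintro _ ⟨z, rfl⟩
    rcases h.cover z (hV z z.2) with hz | hz
    · simp [h.eq_one _ hz]
    · simp [h.eq_zero _ hz]
  have := le_ciSup hbdd ⟨x, hx⟩
  simpa [h.eq_one x hxW] using this

variable [CompleteSpace H]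

lemma IsSplitting.isHolomorphicCalculus_proj {r₀ ρ r : ℝ} {W W' : Set ℂ} {φ : ℂ → ℂ}
    {Γ : PlaneCycle} {A : H →L[ℂ] H} (h : IsSplitting p r₀ W W' φ) (hd : 0 < p.natDegree)
    (hp : p.roots.Nodup) (hr : 0 < r) (hr₀ : r < r₀)
    (hreg : ∀ w : ℂ, ‖w‖ = r → IsRegularValue p w) (hΓ : IsFiberCycle p r W Γ)
    (hT : ∀ w ∈ spectrum ℂ (aeval A p), ‖w‖ ≤ ρ) (hρ : ρ < r) :
    IsHolomorphicCalculus A φ (proj Γ A) := by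
  obtain ⟨Γ', hΓ'⟩ := (IsSplitting.univ p r₀).exists_cycle hd hr hr₀ hreg
  have hdisj := disjoint_sphere_spectrum hT hρ
  have hφ := h.differentiableOn
  have heq : proj Γ A = (2 * Real.pi * Complex.I : ℂ)⁻¹ •
      Γ'.integral fun z => φ z • resolvent A z := by
    rw [proj, h.integral_resolvent hd hp hr hr₀ hreg hΓ hdisj,
      integral_smul_resolvent hd hp hr hreg hΓ' (f := multicentricFun p φ) _ _ _ hdisj]
    · exact fun l _ => (h.differentiableOn_multicentricFun hd l).continuousOn.mono
        (sphere_subset_closedBall.trans (closedBall_subset_ball hr₀))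
    · exact hφ.continuousOn.mono fun z hz => lt_of_eq_of_lt hz hr₀
    · exact fun z hz => (sum_rootBasis_mul_multicentricFun hd hp hφ (hz.trans_lt hr₀)).symm
  rw [heq]
  exact isHolomorphicCalculus_integral hd hp hr hr₀ hreg hΓ' (fun z hz =>
    (hT _ (spectrum.subset_polynomial_aeval A p ⟨z, hz, rfl⟩)).trans_lt hρ) hφ

/-- The norm of the spectral projection, given a bound for the multicentric representation. -/
lemma IsSplitting.norm_proj_le {r₀ ρ r : ℝ} {W W' : Set ℂ} {φ : ℂ → ℂ} {Γ : PlaneCycle}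
    {A : H →L[ℂ] H} (h : IsSplitting p r₀ W W' φ) (hd : 0 < p.natDegree) (hp : p.roots.Nodup)
    (hρ : 0 ≤ ρ) (hρr : ρ < r) (hr₀ : r < r₀) (hreg : ∀ w : ℂ, ‖w‖ = r → IsRegularValue p w)
    (hΓ : IsFiberCycle p r W Γ) (hn : n ≠ 0) (hT : ‖aeval A p ^ n‖ ≤ ρ ^ n)
    (hρn : ρ = 0 → n = 1) {M : ℝ} (hM0 : 0 ≤ M)
    (hM : ∀ l ∈ p.roots.toFinset, ∀ w, ‖w‖ = ρ → ‖multicentricFun p φ l w‖ ≤ M) :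
    ‖proj Γ A‖ ≤ M * (∑ k ∈ Finset.range n, ‖aeval A p ^ k‖ / ρ ^ k) *
      ∑ l ∈ p.roots.toFinset, ‖aeval A (rootBasis p l)‖ := by
  have hf := h.isMulticentricFamily hd hp (hρr.trans hr₀)
  obtain ⟨g, hg⟩ := exists_isPowerSplitting hn hρ hf.analytic
  obtain ⟨r₁, r₂, h1, h12, hgd, heq⟩ :=
    h.proj_eq_sum_pow hd hp hρ hρr hr₀ hreg hΓ hn hT hf hg
  have hB : ∀ l ∈ p.roots.toFinset, ∀ k ∈ Finset.range n,
      ‖circleCalc (aeval A p ^ n) (g l k) r₁‖ ≤ M / ρ ^ k := fun l hl k hk => by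
    have hk' := Finset.mem_range.1 hk
    exact norm_circleCalc_le_of_closedBall hT (hgd l hl k hk') h1 h12 (by positivity)
      (norm_power_part_le hn hρ (fun h0 => by have := hρn h0; omega) (hg.analytic l hl k hk')
        (hM l hl) fun w hw => (hg.formula l hl k hk').self_of_nhdsSet w hw)
  rw [heq, Finset.mul_sum]
  refine norm_sum_le_of_le _ fun l hl => (norm_mul_le _ _).trans ?_
  rw [mul_comm ‖aeval A (rootBasis p l)‖, Finset.mul_sum]
  refine mul_le_mul_of_nonneg_right (norm_sum_le_of_le _ fun k hk => ?_) (norm_nonneg _)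
  calc _ ≤ ‖aeval A p ^ k‖ * (M / ρ ^ k) :=
        (norm_mul_le _ _).trans (mul_le_mul_of_nonneg_left (hB l hl k hk) (norm_nonneg _))
    _ = _ := by ring

end Lemniscate

end

theorem mainTheorem3 (p : ℂ[X]) (hp0 : p ≠ 0) (hp : p.roots.Nodup) :
    ∃ C : ℝ, 0 < C ∧
      ∀ (H : Type*) [NormedAddCommGroup H] [InnerProductSpace ℂ H] [CompleteSpace H]
        (A : H →L[ℂ] H) (n : ℕ) (_hn : 1 ≤ n)
        (_hV : (componentsOf (lemniscateSet p n A)).Nontrivial)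
        (K : Set ℂ) (_hK : K ∈ componentsOf (lemniscateSet p n A))
        (φ : ℂ → ℂ) (_hφ1 : ∀ᶠ z in 𝓝ˢ K, φ z = 1)
        (_hφ0 : ∀ᶠ z in 𝓝ˢ (lemniscateSet p n A \ K), φ z = 0),
        (∃ f g, IsMulticentricFamily p φ (lemniscateSet p n A) (lemniscateLevel p n A) f ∧
          IsPowerSplitting p n (lemniscateLevel p n A) f g) ∧
        ∃ P : H →L[ℂ] H,
          IsHolomorphicCalculus A φ P ∧
          IsRieszProjection A K P ∧
          (∀ f g, IsMulticentricFamily p φ (lemniscateSet p n A) (lemniscateLevel p n A) f →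
            IsPowerSplitting p n (lemniscateLevel p n A) f g →
            ∃ B : ℂ → ℕ → (H →L[ℂ] H),
              (∀ l ∈ p.roots.toFinset, ∀ k < n,
                IsHolomorphicCalculus (aeval A p ^ n) (g l k) (B l k)) ∧
              P = ∑ l ∈ p.roots.toFinset, aeval A (rootBasis p l) *
                ∑ k ∈ Finset.range n, aeval A p ^ k * B l k) ∧
          (n = 1 ∨ aeval A p ^ n ≠ 0 →
            ∀ s, IsOutsideCriticalDistance p (lemniscateSet p n A) s →
              ‖P‖ ≤ (1 + C / s ^ (p.natDegree - 1)) *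
                (∑ k ∈ Finset.range n, ‖aeval A p ^ k‖ / lemniscateLevel p n A ^ k) *
                (∑ l ∈ p.roots.toFinset, ‖aeval A (rootBasis p l)‖) *
                ⨆ z : lemniscateSet p n A, ‖φ z‖) := by
  by_cases hd : 0 < p.natDegree
  swap
  · exact ⟨1, one_pos, fun H _ _ _ A n _ hV =>
      absurd (natDegree_pos_of_nontrivial_componentsOf hV) hd⟩
  obtain ⟨C, hC0, hC⟩ := exists_bound_multicentricFun hd
  refine ⟨C, hC0, fun H _ _ _ A n hn _ K hK φ hφ1 hφ0 => ?_⟩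
  have hn0 : n ≠ 0 := Nat.one_le_iff_ne_zero.1 hn
  have hρ := lemniscateLevel_nonneg p n A
  have hTn := (lemniscateLevel_pow (p := p) hn0 A).ge
  have hTpow : lemniscateLevel p n A = 0 → aeval A p ^ n = 0 := fun h => by
    rw [h, zero_pow hn0] at hTn
    exact norm_le_zero_iff.1 hTn
  rw [lemniscateSet_eq hn0] at hK hφ0 ⊢
  set ρ := lemniscateLevel p n A
  have hT := norm_le_of_mem_spectrum_of_pow hn0 hρ fun v hv =>
    (norm_le_of_mem_spectrum hv).trans hTn
  obtain ⟨r₀, W, W', hr₀, h, hKW, hKW'⟩ := exists_isSplitting hd hρ hφ1 hφ0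
  have hf := h.isMulticentricFamily hd hp hr₀
  obtain ⟨g, hg⟩ := exists_isPowerSplitting hn0 hρ hf.analytic
  obtain ⟨r, ⟨hρr, hrr₀⟩, hreg⟩ := exists_regular_radius hd hr₀
  have hr : 0 < r := hρ.trans_lt hρr
  obtain ⟨Γ, hΓ⟩ := h.exists_cycle hd hr hrr₀ hreg
  refine ⟨⟨_, g, hf, hg⟩, IsSplitting.proj Γ A,
    h.isHolomorphicCalculus_proj hd hp hr hrr₀ hreg hΓ hT hρr,
    h.isRieszProjection hd hp hr hrr₀ hreg hΓ hT hρr fun z hz => ⟨fun hzK => hKW hzK, fun hzW => ?_⟩,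
    fun f' g' hf' hg' => ?_, fun hnT s hs => ?_⟩
  · by_contra hzK
    have hzV : ‖p.eval z‖ ≤ ρ := hT _ (spectrum.subset_polynomial_aeval A p ⟨z, hz, rfl⟩)
    exact h.disjoint.notMem_of_mem_left hzW (hKW' ⟨hzV, hzK⟩)
  · obtain ⟨r₁, r₂, h1, h12, hgd, heq⟩ :=
      h.proj_eq_sum_pow hd hp hρ hρr hrr₀ hreg hΓ hn0 hTn hf' hg'
    exact ⟨fun l k => circleCalc (aeval A p ^ n) (g' l k) r₁, fun l hl k hk =>
      isHolomorphicCalculus_circleCalc ((pow_nonneg hρ n).trans_lt h1) h12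
        (fun v hv => ((norm_le_of_mem_spectrum hv).trans hTn).trans_lt h1) (hgd l hl k hk), heq⟩
  · obtain ⟨hs0, hb⟩ := hC ρ hρ r₀ hr₀ W W' φ h s hs
    obtain ⟨x, hx, rfl⟩ := hK
    have hsup := h.one_le_iSup_norm (fun z hz => lt_of_le_of_lt hz hr₀) hx
      (hKW (mem_connectedComponentIn hx))
    have hP := h.norm_proj_le (A := A) hd hp hρ hρr hrr₀ hreg hΓ hn0 hTn
      (fun h0 => hnT.resolve_right (not_not.2 (hTpow h0))) (by positivity) hb
    have hS : 0 ≤ (∑ k ∈ Finset.range n, ‖aeval A p ^ k‖ / ρ ^ k) *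
        ∑ l ∈ p.roots.toFinset, ‖aeval A (rootBasis p l)‖ := by positivity
    have hM : 0 ≤ C / s ^ (p.natDegree - 1) := by positivity
    rw [mul_assoc] at hP
    rw [mul_assoc (1 + C / s ^ (p.natDegree - 1))]
    refine le_trans ?_ (le_mul_of_one_le_right (by positivity) hsup)
    exact hP.trans (mul_le_mul_of_nonneg_right (by linarith) hS)
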